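/- **Setting.** For a form $f\in\mathbb C[x_0,\dots,x_3]$ let $\{f=0\}\subset\mathbb P^3$ be its zero locus; $f$ is non-singular if there is no $v\in\mathbb C^4\setminus\{0\}$ at which $f$ and all its partial derivatives vanish. A smooth quartic surface is $\{f=0\}$ with $f$ a non-singular form of degree $4$. A subgroup $G\subset \mathrm{PGL}_4(\mathbb C)$ fixes $X\subset\mathbb P^3$ if $(A)X=X$ for all $(A)\in G$. $G$ is primitive if there is no set $\Gamma$ of non-zero subspaces of $\mathbb C^4$ with $|\Gamma|\ge 2$, $\mathbb C^4=\bigoplus_{V\in\Gamma}V$ and $(A)V\in\Gamma$ for all $(A)\in G$, $V\in\Gamma$. Let $\omega=e^{2\pi i/3}$, $\zeta=e^{2\pi i/7}$, $\lambda_\pm=\frac{-1\pm i\sqrt{15}}{4}$, $\nu_\pm=\frac{\sqrt3\pm i\sqrt5}{2\sqrt2}$, $s=\zeta^2-\zeta^5$, $t=\zeta^4-\zeta^3$, $u=\zeta-\zeta^6$. Let $(P)\subset \mathrm{PGL}_4(\mathbb C)$ be the group generated by the classes of $$\operatorname{diag}(1,\zeta^4,\zeta^2,\zeta),\quad \begin{pmatrix}1&0&0&0\\0&0&1&0\\0&0&0&1\\0&1&0&0\end{pmatrix},\quad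 \frac{i}{\sqrt7}\begin{pmatrix}-i\sqrt7&0&0&0\\0&u&s&t\\0&s&t&u\\0&t&u&s\end{pmatrix}.$$ Let $(Q_1)$ be generated by $$\operatorname{diag}(1,1,\omega,\omega^2),\quad \frac13\begin{pmatrix}3&0&0&0\\0&-1&2&2\\0&2&-1&2\\0&2&2&-1\end{pmatrix},\quad \begin{pmatrix}1&0&0&0\\0&-1&0&0\\0&0&0&\lambda_+\\0&0&\lambda_-&0\end{pmatrix}.$$ Put $$D=\operatorname{diag}(\omega,\omega,\omega^2,\omega^2),\quad E=\frac1{\sqrt3}\begin{pmatrix}1&0&0&\sqrt2\\0&1&\sqrt2&0\\0&\sqrt2&-1&0\\\sqrt2&0&0&-1\end{pmatrix}.$$ Let $(Q_4)$ and $(Q_5)$ be generated by $D,E$ and, respectively, $$\begin{pmatrix}0&0&0&\nu_+\\0&0&\nu_+&0\\0&\nu_-&0&0\\\nu_-&0&0&0\end{pmatrix},\qquad \begin{pmatrix}0&0&0&\nu_+\\0&0&\nu_-&0\\0&\nu_+&0&0\\\nu_-&0&0&0\end{pmatrix},$$ and let $(R_3)$ and $(Q_7)$ be generated by $(Q_5)$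 and, respectively, $$\begin{pmatrix}0&0&1&0\\0&0&0&-1\\1&0&0&0\\0&-1&0&0\end{pmatrix},\qquad \frac1{\sqrt5}\begin{pmatrix}0&0&\sqrt3&i\sqrt2\\0&0&-i\sqrt2&-\sqrt3\\\sqrt3&i\sqrt2&0&0\\-i\sqrt2&-\sqrt3&0&0\end{pmatrix}.$$ **Theorem.** 1. $(P)$ is non-primitive and isomorphic to $\mathrm{PSL}_2(\mathbb F_7)$. 2. Let $G\subset\mathrm{PGL}_4(\mathbb C)$ be a non-primitive subgroup isomorphic to $\mathfrak A_5$, $\mathfrak S_5$, $\mathfrak A_6$ or $\mathrm{PSL}_2(\mathbb F_7)$. Then $G$ fixes some smooth quartic surface if and only if $G$ is conjugate to $(P)$ in $\mathrm{PGL}_4(\mathbb C)$. 3. None of the groups $(Q_1)$, $(Q_4)$, $(Q_5)$, $(R_3)$, $(Q_7)$ fixes a smooth quartic surface. 4. The smooth quartic surfaces fixed by $(P)$ are exactly the smooth members of the pencil $$\{\lambda_0x_0^4+\lambda_1(x_1^3x_2+x_1x_3^3+x_2^3x_3)=0\},\qquad[\lambda_0:\lambda_1]\in\mathbb P^1,$$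 and the member over $[\lambda_0:\lambda_1]$ is singular (that is, its defining form is not non-singular) if and only if $[\lambda_0:\lambda_1]$ is $[1:0]$ or $[0:1]$. -/

import Mathlib

open scoped MatrixGroups LinearAlgebra.Projectivization Pointwise
open MvPolynomial

noncomputable section

namespace QuarticSurface

/-! ### Forms, surfaces in projective three-space, and the action of `PGL(4, ℂ)` -/

/-- Complex projective space `ℙ³`. -/
abbrev P3 : Type := ℙ ℂ (Fin 4 → ℂ)

/-- The zero locus in `ℙ³` of a form `f` in four variables. -/
def surfaceOf (f : MvPolynomial (Fin 4) ℂ) : Set P3 :=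
  {x | eval x.rep f = 0}

/-- For a form, membership in the zero locus can be tested on any homogeneous coordinates. -/
theorem mk_mem_surfaceOf {f : MvPolynomial (Fin 4) ℂ} {d : ℕ} (hf : f.IsHomogeneous d)
    (v : Fin 4 → ℂ) (hv : v ≠ 0) :
    Projectivization.mk ℂ v hv ∈ surfaceOf f ↔ eval v f = 0 := by
  obtain ⟨a, ha⟩ := Projectivization.exists_smul_eq_mk_rep ℂ v hv
  have key : eval (a • v) f = (a : ℂ) ^ d * eval v f := by
    rw [show (a • v : Fin 4 → ℂ) = fun i => (a : ℂ) * v i from rfl]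
    rw [MvPolynomial.eval_eq, MvPolynomial.eval_eq, Finset.mul_sum]
    refine Finset.sum_congr rfl fun m hm => ?_
    have hd : ∑ i, m i = d := by
      have := hf (MvPolynomial.mem_support_iff.mp hm)
      rw [← this, Finsupp.weight_apply, Finsupp.sum_fintype] <;> simp
    simp only [mul_pow, Finset.prod_mul_distrib]
    rw [Finset.prod_pow_eq_pow_sum]
    have h2 : ∑ i ∈ m.support, m i = d := by
      rw [← hd]
      exact Finset.sum_subset (Finset.subset_univ _) (by simp)
    rw [h2]
    ring
  change eval (Projectivization.mk ℂ v hv).rep f = 0 ↔ _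
  rw [← ha, key]
  simp

/-- A form is non-singular if it has no singular zero, i.e. no non-zero vector at which the form
and all its partial derivatives vanish. -/
def IsNonsingular (f : MvPolynomial (Fin 4) ℂ) : Prop :=
  ∀ v : Fin 4 → ℂ, v ≠ 0 → eval v f = 0 → ∃ i, eval v (pderiv i f) ≠ 0

/-- Smooth quartic surfaces `X = {f = 0} ⊂ ℙ³`. -/
def IsSmoothQuarticSurface (X : Set P3) : Prop :=
  ∃ f : MvPolynomial (Fin 4) ℂ, f.IsHomogeneous 4 ∧ IsNonsingular f ∧ X = surfaceOf f

/-- `X` is `G`-invariant: `(A) X = X` for all `(A) ∈ G`. -/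
def IsInvariantUnder (G : Subgroup PGL(4, ℂ)) (X : Set P3) : Prop :=
  ∀ A ∈ G, A • X = X

/-- `G` fixes some smooth quartic surface. -/
def FixesSmoothQuartic (G : Subgroup PGL(4, ℂ)) : Prop :=
  ∃ X : Set P3, IsSmoothQuarticSurface X ∧ IsInvariantUnder G X

/-! ### Primitive subgroups -/

/-- A `G`-decomposition of `ℂ⁴`: a set of at least two non-zero subspaces whose internal direct sum
is `ℂ⁴` and which is permuted by `G`. -/
structure IsDecomposition (G : Subgroup PGL(4, ℂ)) (Γ : Set (Submodule ℂ (Fin 4 → ℂ))) : Prop where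
  nontrivial : Γ.Nontrivial
  ne_bot : ∀ V ∈ Γ, V ≠ ⊥
  indep : sSupIndep Γ
  sSup_eq_top : sSup Γ = ⊤
  map_mem : ∀ A : GL (Fin 4) ℂ, Matrix.ProjGenLinGroup.mk A ∈ G → ∀ V ∈ Γ,
    V.map (Matrix.mulVecLin (A : Matrix (Fin 4) (Fin 4) ℂ)) ∈ Γ

/-- `G` is primitive if there is no `G`-decomposition of `ℂ⁴`. -/
def IsPrimitiveGroup (G : Subgroup PGL(4, ℂ)) : Prop :=
  ¬ ∃ Γ, IsDecomposition G Γ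

/-- Subgroups `G`, `H` of `PGL(4, ℂ)` are conjugate. -/
def AreConjugate (G H : Subgroup PGL(4, ℂ)) : Prop :=
  ∃ T : PGL(4, ℂ), G = H.map (MulAut.conj T).toMonoidHom

/-! ### The explicit groups -/

/-- The subgroup of `PGL(4, ℂ)` generated by the classes of the matrices in `S`
(all of which are invertible in the cases below). -/
def generatedBy (S : Set (Matrix (Fin 4) (Fin 4) ℂ)) : Subgroup PGL(4, ℂ) :=
  Subgroup.closure
    {g | ∃ A : GL (Fin 4) ℂ, (A : Matrix (Fin 4) (Fin 4) ℂ) ∈ S ∧ g = Matrix.ProjGenLinGroup.mk A}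

/-- The primitive third root of unity `exp (2πi/3)`. -/
def ω : ℂ := Complex.exp (2 * Real.pi * Complex.I / 3)

/-- The primitive seventh root of unity `exp (2πi/7)`. -/
def ζ : ℂ := Complex.exp (2 * Real.pi * Complex.I / 7)

/-- The positive square root of a natural number, as a complex number. -/
def rt (n : ℕ) : ℂ := ((Real.sqrt n : ℝ) : ℂ)

def lamPlus : ℂ := (-1 + Complex.I * rt 15) / 4

def lamMinus : ℂ := (-1 - Complex.I * rt 15) / 4

def nuPlus : ℂ := (rt 3 + Complex.I * rt 5) / (2 * rt 2)

def nuMinus : ℂ := (rt 3 - Complex.I * rt 5) / (2 * rt 2)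

def uMinus : ℂ := ζ - ζ ^ 6

def sMinus : ℂ := ζ ^ 2 - ζ ^ 5

def tMinus : ℂ := ζ ^ 4 - ζ ^ 3

def matS : Matrix (Fin 4) (Fin 4) ℂ :=
  !![1, 0, 0, 0;
     0, ζ ^ 4, 0, 0;
     0, 0, ζ ^ 2, 0;
     0, 0, 0, ζ]

def matT : Matrix (Fin 4) (Fin 4) ℂ :=
  !![1, 0, 0, 0;
     0, 0, 1, 0;
     0, 0, 0, 1;
     0, 1, 0, 0]

def matR : Matrix (Fin 4) (Fin 4) ℂ :=
  (Complex.I / rt 7) •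
    !![-Complex.I * rt 7, 0, 0, 0;
       0, uMinus, sMinus, tMinus;
       0, sMinus, tMinus, uMinus;
       0, tMinus, uMinus, sMinus]

/-- The group `(P)`. -/
def groupP : Subgroup PGL(4, ℂ) := generatedBy {matS, matT, matR}

def matQ11 : Matrix (Fin 4) (Fin 4) ℂ :=
  !![1, 0, 0, 0;
     0, 1, 0, 0;
     0, 0, ω, 0;
     0, 0, 0, ω ^ 2]

def matQ12 : Matrix (Fin 4) (Fin 4) ℂ :=
  !![1, 0, 0, 0;
     0, -1 / 3, 2 / 3, 2 / 3;
     0, 2 / 3, -1 / 3, 2 / 3;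
     0, 2 / 3, 2 / 3, -1 / 3]

def matQ13 : Matrix (Fin 4) (Fin 4) ℂ :=
  !![1, 0, 0, 0;
     0, -1, 0, 0;
     0, 0, 0, lamPlus;
     0, 0, lamMinus, 0]

def matQ41 : Matrix (Fin 4) (Fin 4) ℂ :=
  !![ω, 0, 0, 0;
     0, ω, 0, 0;
     0, 0, ω ^ 2, 0;
     0, 0, 0, ω ^ 2]

def matQ42 : Matrix (Fin 4) (Fin 4) ℂ :=
  !![1 / rt 3, 0, 0, rt 2 / rt 3;
     0, 1 / rt 3, rt 2 / rt 3, 0;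
     0, rt 2 / rt 3, -(1 / rt 3), 0;
     rt 2 / rt 3, 0, 0, -(1 / rt 3)]

def matQ43 : Matrix (Fin 4) (Fin 4) ℂ :=
  !![0, 0, 0, nuPlus;
     0, 0, nuPlus, 0;
     0, nuMinus, 0, 0;
     nuMinus, 0, 0, 0]

def matQ53 : Matrix (Fin 4) (Fin 4) ℂ :=
  !![0, 0, 0, nuPlus;
     0, 0, nuMinus, 0;
     0, nuPlus, 0, 0;
     nuMinus, 0, 0, 0]

def matR34 : Matrix (Fin 4) (Fin 4) ℂ :=
  !![0, 0, 1, 0;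
     0, 0, 0, -1;
     1, 0, 0, 0;
     0, -1, 0, 0]

def matQ74 : Matrix (Fin 4) (Fin 4) ℂ :=
  (1 / rt 5) •
    !![0, 0, rt 3, Complex.I * rt 2;
       0, 0, -Complex.I * rt 2, -rt 3;
       rt 3, Complex.I * rt 2, 0, 0;
       -Complex.I * rt 2, -rt 3, 0, 0]

/-- The group `(Q₁)`. -/
def groupQ1 : Subgroup PGL(4, ℂ) := generatedBy {matQ11, matQ12, matQ13}

/-- The group `(Q₄)`. -/
def groupQ4 : Subgroup PGL(4, ℂ) := generatedBy {matQ41, matQ42, matQ43}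

/-- The group `(Q₅)`. -/
def groupQ5 : Subgroup PGL(4, ℂ) := generatedBy {matQ41, matQ42, matQ53}

/-- The group `(R₃)`. -/
def groupR3 : Subgroup PGL(4, ℂ) := generatedBy {matQ41, matQ42, matQ53, matR34}

/-- The group `(Q₇)`. -/
def groupQ7 : Subgroup PGL(4, ℂ) := generatedBy {matQ41, matQ42, matQ53, matQ74}

/-! ### The pencil -/

/-- The quartic form `l₀ x₀⁴ + l₁ (x₁³ x₂ + x₁ x₃³ + x₂³ x₃)`. -/
def pencil (l : Fin 2 → ℂ) : MvPolynomial (Fin 4) ℂ :=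
  C (l 0) * X 0 ^ 4 + C (l 1) * (X 1 ^ 3 * X 2 + X 1 * X 3 ^ 3 + X 2 ^ 3 * X 3)

/-! ### All generators above are invertible -/

theorem rt_mul_self (n : ℕ) : rt n * rt n = n := by
  unfold rt
  rw [← Complex.ofReal_mul, Real.mul_self_sqrt (by positivity)]
  simp

theorem ω_pow : ω ^ 3 = 1 := by
  unfold ω
  rw [← Complex.exp_nat_mul, ← Complex.exp_two_pi_mul_I]
  congr 1
  push_cast
  ring

theorem ζ_pow : ζ ^ 7 = 1 := by
  unfold ζ
  rw [← Complex.exp_nat_mul, ← Complex.exp_two_pi_mul_I]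
  congr 1
  push_cast
  ring

theorem ζ_ne_one : ζ ≠ 1 := by
  have h := Complex.isPrimitiveRoot_exp 7 (by norm_num)
  have := h.ne_one (by norm_num)
  simpa [ζ] using this

theorem ζ_sum : 1 + ζ + ζ ^ 2 + ζ ^ 3 + ζ ^ 4 + ζ ^ 5 + ζ ^ 6 = 0 := by
  have h : (ζ - 1) * (1 + ζ + ζ ^ 2 + ζ ^ 3 + ζ ^ 4 + ζ ^ 5 + ζ ^ 6) = 0 := by
    linear_combination ζ_pow
  exact (mul_eq_zero.mp h).resolve_left (sub_ne_zero.mpr ζ_ne_one)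

theorem det_matS : matS.det ≠ 0 := by
  have h : matS.det = 1 := by
    simp [matS, Matrix.det_succ_row_zero, Fin.sum_univ_succ, Fin.succAbove]
    linear_combination ζ_pow
  rw [h]
  exact one_ne_zero

theorem det_matT : matT.det ≠ 0 := by
  simp [matT, Matrix.det_succ_row_zero, Fin.sum_univ_succ, Fin.succAbove]

theorem det_ne_zero_of_mul_self {M : Matrix (Fin 4) (Fin 4) ℂ} (h : M * M = 1) : M.det ≠ 0 := by
  intro h0
  have := congrArg Matrix.det h
  simp [h0] at this

theorem rt_ne_zero {n : ℕ} (hn : n ≠ 0) : rt n ≠ 0 := by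
  intro h
  have := rt_mul_self n
  rw [h, mul_zero] at this
  exact hn (by exact_mod_cast this.symm)

theorem det_matR : matR.det ≠ 0 := by
  apply det_ne_zero_of_mul_self
  have h7 := rt_mul_self 7
  have hr := rt_ne_zero (n := 7) (by norm_num)
  push_cast at h7
  have hc : (Complex.I / rt 7) * (Complex.I / rt 7) * 7 = -1 := by
    field_simp
    linear_combination 7 * Complex.I_mul_I + h7
  have hd : Complex.I / rt 7 * (-Complex.I * rt 7) = 1 := by
    field_simp
    linear_combination -Complex.I_mul_I
  have h1 : uMinus * uMinus + sMinus * sMinus + tMinus * tMinus = -7 := by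
    unfold uMinus sMinus tMinus
    linear_combination (ζ ^ 5 + ζ ^ 3 + ζ - 6) * ζ_pow + ζ_sum
  have h2 : uMinus * sMinus + sMinus * tMinus + tMinus * uMinus = 0 := by
    unfold uMinus sMinus tMinus
    linear_combination (ζ ^ 4 - ζ ^ 3) * ζ_pow
  unfold matR
  generalize Complex.I / rt 7 = c at hc hd ⊢
  generalize -Complex.I * rt 7 = e at hd ⊢
  generalize uMinus = u at h1 h2 ⊢
  generalize sMinus = s at h1 h2 ⊢
  generalize tMinus = t at h1 h2 ⊢
  ext i j
  fin_cases i <;> fin_cases j <;> simp [Matrix.mul_apply, Fin.sum_univ_succ] <;>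
    first
      | linear_combination (c * e + 1) * hd
      | linear_combination c * c * h1 - hc
      | linear_combination c * c * h2

theorem det_matQ11 : matQ11.det ≠ 0 := by
  have h : matQ11.det = 1 := by
    simp [matQ11, Matrix.det_succ_row_zero, Fin.sum_univ_succ, Fin.succAbove]
    linear_combination ω_pow
  rw [h]
  exact one_ne_zero

theorem det_matQ12 : matQ12.det ≠ 0 := by
  apply det_ne_zero_of_mul_self
  ext i j
  fin_cases i <;> fin_cases j <;> simp [matQ12, Matrix.mul_apply, Fin.sum_univ_succ] <;> norm_num

theorem lamPlus_mul_lamMinus : lamPlus * lamMinus = 1 := by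
  have h := rt_mul_self 15
  push_cast at h
  unfold lamPlus lamMinus
  linear_combination (-(1 / 16) * rt 15 * rt 15) * Complex.I_mul_I + (1 / 16) * h

theorem nuPlus_mul_nuMinus : nuPlus * nuMinus = 1 := by
  have h2 := rt_mul_self 2
  have h3 := rt_mul_self 3
  have h5 := rt_mul_self 5
  have hr := rt_ne_zero (n := 2) (by norm_num)
  push_cast at h2 h3 h5
  unfold nuPlus nuMinus
  field_simp
  linear_combination h3 + h5 - rt 5 * rt 5 * Complex.I_mul_I - 4 * h2

theorem det_matQ13 : matQ13.det ≠ 0 := by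
  have h := lamPlus_mul_lamMinus
  apply det_ne_zero_of_mul_self
  ext i j
  fin_cases i <;> fin_cases j <;> simp [matQ13, Matrix.mul_apply, Fin.sum_univ_succ] <;>
    linear_combination h

theorem det_matQ41 : matQ41.det ≠ 0 := by
  have h : matQ41.det = 1 := by
    simp [matQ41, Matrix.det_succ_row_zero, Fin.sum_univ_succ, Fin.succAbove]
    linear_combination (ω ^ 3 + 1) * ω_pow
  rw [h]
  exact one_ne_zero

theorem det_matQ42 : matQ42.det ≠ 0 := by
  have h2 := rt_mul_self 2
  have h3 := rt_mul_self 3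
  have hr := rt_ne_zero (n := 3) (by norm_num)
  push_cast at h2 h3
  apply det_ne_zero_of_mul_self
  ext i j
  fin_cases i <;> fin_cases j <;> simp [matQ42, Matrix.mul_apply, Fin.sum_univ_succ] <;>
    field_simp <;> first | linear_combination h2 - h3 | ring

theorem det_matQ43 : matQ43.det ≠ 0 := by
  have h := nuPlus_mul_nuMinus
  apply det_ne_zero_of_mul_self
  ext i j
  fin_cases i <;> fin_cases j <;> simp [matQ43, Matrix.mul_apply, Fin.sum_univ_succ] <;>
    linear_combination h

theorem det_matQ53 : matQ53.det ≠ 0 := by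
  have h := nuPlus_mul_nuMinus
  apply det_ne_zero_of_mul_self
  ext i j
  fin_cases i <;> fin_cases j <;> simp [matQ53, Matrix.mul_apply, Fin.sum_univ_succ] <;>
    linear_combination h

theorem det_matR34 : matR34.det ≠ 0 := by
  apply det_ne_zero_of_mul_self
  ext i j
  fin_cases i <;> fin_cases j <;> simp [matR34, Matrix.mul_apply, Fin.sum_univ_succ]

theorem det_matQ74 : matQ74.det ≠ 0 := by
  have h2 := rt_mul_self 2
  have h3 := rt_mul_self 3
  have h5 := rt_mul_self 5
  have hr := rt_ne_zero (n := 5) (by norm_num)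
  push_cast at h2 h3 h5
  apply det_ne_zero_of_mul_self
  have hc : 1 / rt 5 * (1 / rt 5) * 5 = 1 := by
    field_simp
    linear_combination -h5
  have hI := Complex.I_mul_I
  unfold matQ74
  generalize 1 / rt 5 = c at hc ⊢
  ext i j
  fin_cases i <;> fin_cases j <;> simp [Matrix.mul_apply, Fin.sum_univ_succ] <;>
    first
      | linear_combination c * c * h3 - c * c * rt 2 * rt 2 * hI + c * c * h2 + hc
      | ring

end QuarticSurface

end

open QuarticSurface

namespace QuarticSurface

-- The engine is a constraint on the linear symmetries of a non-singular quartic form `f`. If `f ∘ A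
-- = f` and `A v = l v`, the gradient of `f` at `v` is either zero or a left eigenvector of `A` for
-- `l⁻³`. If it is zero, smoothness gives `f(v) ≠ 0`, so `l⁴ = 1` and `l⁻³ = l`. Thus the spectrum
-- of `A` is stable under `l ↦ l⁻³` (`exists_eigenvector_of_isNonsingular`). Hence a symmetry of
-- order three has eigenvalue 1, whereas one of order five does not: it would have five distinct
-- eigenvalues.
--
-- By the Nullstellensatz, a projectivity preserving a smooth quartic multiplies its form by a
-- scalar. An element of odd order that is inverted by another element of the group has a lift for
-- which this scalar is 1 (`exists_real_lift`, `pull_eq_self_of_real`).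
--
-- A decomposition of `ℂ⁴` has at most four summands, so elements of prime order at least five fix
-- each of them. The subgroups they generate therefore preserve complementary subspaces of
-- dimensions 1+3 or 2+2. An icosahedral subgroup contradicts the constraints in both cases
-- (`not_fixesSmoothQuartic_of_icosahedral`). For `PSL₂(𝔽₇)` the case 2+2 is impossible
-- (`false_of_klein_of_planes`). In the case 1+3 an eigenbasis of the element `s` of order seven,
-- permuted by the element `t` of order three, puts both in standard form; two traces and the
-- relations then determine the involution `r`, and the group is conjugate to `(P)`
-- (`areConjugate_of_klein_of_line`). The isomorphism `(P) ≅ PSL₂(𝔽₇)` comes from a Bruhat normal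
-- form deduced from the relations alone (`IsKleinTriple.nonempty_mulEquiv`).
--
-- Of the remaining groups, four contain `D`, which has order three, is inverted in the group and
-- lacks the eigenvalue 1; `(Q₁)` contains an element of order five with a fixed vector. Finally,
-- invariance under `s` leaves five quartic monomials, and `t` and `r` cut their span down to the
-- pencil.

local notation "M4" => Matrix (Fin 4) (Fin 4) ℂ

/-! ### Linear substitutions -/

/-- The form `f ∘ A` obtained from `f` by the linear substitution `A`. -/
noncomputable def pull (A : Matrix (Fin 4) (Fin 4) ℂ) :
    MvPolynomial (Fin 4) ℂ →ₐ[ℂ] MvPolynomial (Fin 4) ℂ :=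
  aeval fun i => ∑ j, C (A i j) * X j

theorem eval_pull (A : M4) (f : MvPolynomial (Fin 4) ℂ) (v : Fin 4 → ℂ) :
    eval v (pull A f) = eval (A.mulVec v) f := by
  induction f using MvPolynomial.induction_on with
  | C a => simp [pull]
  | add p q hp hq => simp [hp, hq]
  | mul_X p i hp => simp [hp]; left; simp [pull, Matrix.mulVec, dotProduct]

theorem pull_pull (A B : M4) (f : MvPolynomial (Fin 4) ℂ) :
    pull A (pull B f) = pull (B * A) f := by
  refine MvPolynomial.funext fun v => ?_
  simp [eval_pull]

@[simp]
theorem pull_one (f : MvPolynomial (Fin 4) ℂ) : pull 1 f = f := by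
  refine MvPolynomial.funext fun v => ?_
  simp [eval_pull]

theorem pull_isHomogeneous (A : M4) {f : MvPolynomial (Fin 4) ℂ} {d : ℕ}
    (hf : f.IsHomogeneous d) : (pull A f).IsHomogeneous d := by
  have := hf.aeval (fun i => ∑ j, C (A i j) * (X j : MvPolynomial (Fin 4) ℂ)) (n := 1) fun i =>
    IsHomogeneous.sum _ _ _ fun j _ => by
      simpa using (isHomogeneous_C (Fin 4) (A i j)).mul (isHomogeneous_X ℂ j)
  simpa [pull] using this

theorem eval_smul_of_isHomogeneous {f : MvPolynomial (Fin 4) ℂ} {d : ℕ} (hf : f.IsHomogeneous d)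
    (c : ℂ) (v : Fin 4 → ℂ) : eval (c • v) f = c ^ d * eval v f := by
  rw [MvPolynomial.eval_eq, MvPolynomial.eval_eq, Finset.mul_sum]
  refine Finset.sum_congr rfl fun m hm => ?_
  have hd : ∑ i, m i = d := by
    have := hf (MvPolynomial.mem_support_iff.mp hm)
    rw [← this, Finsupp.weight_apply, Finsupp.sum_fintype] <;> simp
  have h2 : ∑ i ∈ m.support, m i = d := by
    rw [← hd]
    exact Finset.sum_subset (Finset.subset_univ _) (by simp)
  simp only [Pi.smul_apply, smul_eq_mul, mul_pow, Finset.prod_mul_distrib]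
  rw [Finset.prod_pow_eq_pow_sum, h2]
  ring

theorem pderiv_pull (A : M4) (f : MvPolynomial (Fin 4) ℂ) (j : Fin 4) :
    pderiv j (pull A f) = ∑ i, C (A i j) * pull A (pderiv i f) := by
  induction f using MvPolynomial.induction_on with
  | C a => simp [pull]
  | add p q hp hq => simp [hp, hq, mul_add, Finset.sum_add_distrib]
  | mul_X p k hp =>
    have hX : pderiv j (pull A (X k)) = C (A k j) := by
      simp [pull, Derivation.leibniz, pderiv_X, Pi.single_apply]
    have hk (i : Fin 4) : C (A i j) * pull A (pderiv i (p * X k)) =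
        pull A p * (if i = k then C (A i j) else 0) +
          pull A (X k) * (C (A i j) * pull A (pderiv i p)) := by
      rw [Derivation.leibniz, pderiv_X, Pi.single_apply, map_add, smul_eq_mul, smul_eq_mul,
        map_mul, map_mul]
      by_cases h : i = k
      · rw [if_pos h, if_pos h.symm, map_one]
        ring
      · rw [if_neg h, if_neg (Ne.symm h), map_zero]
        ring
    rw [map_mul, Derivation.leibniz, hp, hX, smul_eq_mul, smul_eq_mul, Finset.sum_congr rfl
      fun i _ => hk i, Finset.sum_add_distrib, ← Finset.mul_sum, ← Finset.mul_sum,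
      Finset.sum_ite_eq' Finset.univ k, if_pos (Finset.mem_univ k)]

theorem eval_pderiv_pull (A : M4) (f : MvPolynomial (Fin 4) ℂ) (j : Fin 4) (v : Fin 4 → ℂ) :
    eval v (pderiv j (pull A f)) = ∑ i, A i j * eval (A.mulVec v) (pderiv i f) := by
  simp [pderiv_pull, eval_pull]

theorem isNonsingular_pull {f : MvPolynomial (Fin 4) ℂ} (hf : IsNonsingular f) (A : GL (Fin 4) ℂ) :
    IsNonsingular (pull A f) := by
  intro v hv h0
  rw [eval_pull] at h0
  have hAv : (A : M4).mulVec v ≠ 0 := fun h => hv <| by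
    have := congrArg ((↑(A⁻¹) : M4).mulVec) h
    simpa [Matrix.mulVec_mulVec, ← Units.val_mul] using this
  by_contra! hd
  obtain ⟨i, hi⟩ := hf _ hAv h0
  apply hi
  -- Chain rule: the gradient of `f ∘ A` at `v` is the gradient of `f` at `A v`, as a row vector,
  -- times `A`.
  have h1 : Matrix.vecMul (fun i => eval ((A : M4).mulVec v) (pderiv i f)) (A : M4) = 0 := by
    ext j
    have := hd j
    rw [eval_pderiv_pull] at this
    simpa [Matrix.vecMul, dotProduct, mul_comm] using this
  have h2 := congrArg (fun w => Matrix.vecMul w (↑(A⁻¹) : M4)) h1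
  simp only [Matrix.vecMul_vecMul, ← Units.val_mul] at h2
  simpa using congrFun h2 i

/-- A form fixed by `X` is singular at an eigenvector of eigenvalue `l` as soon as `l⁻³` is not
an eigenvalue of `X`. -/
theorem exists_eigenvector_of_isNonsingular {f : MvPolynomial (Fin 4) ℂ} (hf : f.IsHomogeneous 4)
    (hs : IsNonsingular f) {A : M4} (hA : pull A f = f) {l : ℂ} {v : Fin 4 → ℂ} (hv : v ≠ 0)
    (hl : A.mulVec v = l • v) : ∃ w ≠ 0, l ^ 3 • A.mulVec w = w := by
  by_contra! hinj
  have hdet : (l ^ 3 • A - 1).det ≠ 0 := by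
    intro h0
    obtain ⟨w, hw, hw'⟩ := Matrix.exists_mulVec_eq_zero_iff.mpr h0
    refine hinj w hw ?_
    rw [Matrix.sub_mulVec, Matrix.smul_mulVec, Matrix.one_mulVec] at hw'
    exact sub_eq_zero.mp hw'
  -- If `l⁴ = 1`, the vector `v` itself would serve as `w`.
  have h4 : l ^ 4 ≠ 1 := fun h => hinj v hv <| by
    rw [hl, smul_smul, ← pow_succ, h, one_smul]
  have hfv : eval v f = 0 := by
    have h1 : eval v f = l ^ 4 * eval v f := by
      conv_lhs => rw [← hA, eval_pull, hl, eval_smul_of_isHomogeneous hf]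
    have h2 : (l ^ 4 - 1) * eval v f = 0 := by linear_combination -h1
    exact (mul_eq_zero.mp h2).resolve_left (sub_ne_zero.mpr h4)
  obtain ⟨i, hi⟩ := hs v hv hfv
  apply hi
  -- The partial derivatives have degree three, so differentiating `f ∘ A = f` at `v` shows that the
  -- gradient is fixed by `l³ A` from the right, hence is zero when `l³ A - 1` is invertible.
  have hvec : Matrix.vecMul (fun i => eval v (pderiv i f)) (l ^ 3 • A - 1) = 0 := by
    ext j
    have h1 := eval_pderiv_pull A f j v
    rw [hA, hl] at h1
    simp only [eval_smul_of_isHomogeneous hf.pderiv] at h1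
    rw [Matrix.vecMul_sub, Matrix.vecMul_one, Pi.sub_apply, h1]
    simp [Matrix.vecMul, dotProduct, sub_eq_zero]
    refine Finset.sum_congr rfl fun i _ => ?_
    ring
  by_contra hne
  refine hdet (Matrix.exists_vecMul_eq_zero_iff.mp ⟨_, ?_, hvec⟩)
  exact fun h => hne (congrFun h i)

/-! ### Forms with the same zero locus -/

/-- By the Nullstellensatz `p` divides a power of the prime `X 0`, so it is associated to a power of
`X 0`. A positive power would vanish at the second coordinate vector. -/
theorem isUnit_of_zeros {p : MvPolynomial (Fin 4) ℂ} (hp : ∀ v, eval v p = 0 → v = 0) :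
    IsUnit p := by
  have hX : X (0 : Fin 4) ∈ (Ideal.span {p}).radical := by
    rw [← vanishingIdeal_zeroLocus_eq_radical (K := ℂ), mem_vanishingIdeal_iff]
    intro v hv
    have : eval v p = 0 := by
      simpa [aeval_eq_eval] using (mem_zeroLocus_iff.mp hv) p (Ideal.mem_span_singleton_self p)
    simp [hp v this]
  obtain ⟨n, hn⟩ := hX
  rw [Ideal.mem_span_singleton] at hn
  obtain ⟨k, -, u, hu⟩ := (dvd_prime_pow (MvPolynomial.X_prime (R := ℂ)) n).mp hn
  rcases Nat.eq_zero_or_pos k with rfl | hk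
  · rw [pow_zero] at hu
    exact IsUnit.of_mul_eq_one _ hu
  · exfalso
    have h1 := congrArg (eval (Pi.single 1 1)) hu
    have hu' : eval (Pi.single 1 1) (u : MvPolynomial (Fin 4) ℂ) ≠ 0 :=
      (u.isUnit.map (eval (Pi.single 1 1))).ne_zero
    simp only [map_mul, map_pow, eval_X] at h1
    rw [show (Pi.single (1 : Fin 4) (1 : ℂ) : Fin 4 → ℂ) 0 = 0 by simp, zero_pow hk.ne'] at h1
    have h2 := hp _ ((mul_eq_zero.mp h1).resolve_right hu')
    simpa using congrFun h2 1

/-- At a non-zero zero of `p`, the product `p² q` and all its partial derivatives vanish. -/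
theorem squarefree_of_isNonsingular {f : MvPolynomial (Fin 4) ℂ} (hs : IsNonsingular f) :
    Squarefree f := by
  rintro p ⟨q, rfl⟩
  refine isUnit_of_zeros fun v hv => ?_
  by_contra hne
  obtain ⟨i, hi⟩ := hs v hne (by simp [hv])
  exact hi (by simp [Derivation.leibniz, hv])

theorem ne_zero_of_isNonsingular {f : MvPolynomial (Fin 4) ℂ} (hs : IsNonsingular f) : f ≠ 0 := by
  rintro rfl
  obtain ⟨i, hi⟩ := hs (Pi.single 0 1) (by simp) (by simp)
  simp at hi

/-- The Nullstellensatz gives `f ∣ gⁿ`; since `f` is squarefree, `f ∣ g`, and the quotient has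
degree zero. -/
theorem eq_smul_of_zeros {f g : MvPolynomial (Fin 4) ℂ} {d : ℕ} (hf : f.IsHomogeneous d)
    (hg : g.IsHomogeneous d) (hs : IsNonsingular f) (hg0 : g ≠ 0)
    (h : ∀ v, eval v f = 0 → eval v g = 0) : ∃ c : ℂ, c ≠ 0 ∧ g = c • f := by
  have hX : g ∈ (Ideal.span {f}).radical := by
    rw [← vanishingIdeal_zeroLocus_eq_radical (K := ℂ), mem_vanishingIdeal_iff]
    intro v hv
    have : eval v f = 0 := by
      simpa [aeval_eq_eval] using (mem_zeroLocus_iff.mp hv) f (Ideal.mem_span_singleton_self f)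
    simpa [aeval_eq_eval] using h v this
  obtain ⟨n, hn⟩ := hX
  rw [Ideal.mem_span_singleton] at hn
  obtain ⟨q, rfl⟩ := (squarefree_of_isNonsingular hs).isRadical n g hn
  have hf0 := ne_zero_of_isNonsingular hs
  have hq0 : q ≠ 0 := right_ne_zero_of_mul hg0
  have hdeg := totalDegree_mul_of_isDomain hf0 hq0
  rw [hf.totalDegree hf0, hg.totalDegree hg0] at hdeg
  have hq := totalDegree_eq_zero_iff_eq_C.mp (show q.totalDegree = 0 by omega)
  refine ⟨coeff 0 q, fun h0 => hq0 (by rw [hq, h0, C_0]), ?_⟩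
  rw [MvPolynomial.smul_eq_C_mul, ← hq, mul_comm]

/-! ### The action on surfaces -/

theorem mk_mem_smul_surfaceOf {f : MvPolynomial (Fin 4) ℂ} {d : ℕ} (hf : f.IsHomogeneous d)
    (A : GL (Fin 4) ℂ) (v : Fin 4 → ℂ) (hv : v ≠ 0) :
    Projectivization.mk ℂ v hv ∈ (Matrix.ProjGenLinGroup.mk A)⁻¹ • surfaceOf f ↔
      eval ((A : M4).mulVec v) f = 0 := by
  rw [Set.mem_inv_smul_set_iff, Projectivization.PGL.mk_smul_mk, mk_mem_surfaceOf hf]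
  rfl

theorem inv_smul_surfaceOf {f : MvPolynomial (Fin 4) ℂ} {d : ℕ} (hf : f.IsHomogeneous d)
    (A : GL (Fin 4) ℂ) :
    (Matrix.ProjGenLinGroup.mk A)⁻¹ • surfaceOf f = surfaceOf (pull A f) := by
  ext x
  induction x using Projectivization.ind with
  | h v hv =>
    rw [mk_mem_smul_surfaceOf hf, mk_mem_surfaceOf (pull_isHomogeneous _ hf), eval_pull]

/-- The forms `f ∘ A` and `f` have the same degree and the same zeros, so they are proportional.
This turns invariance of a surface into semi-invariance of its form. -/
theorem exists_pull_eq_smul {f : MvPolynomial (Fin 4) ℂ} (hf : f.IsHomogeneous 4)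
    (hs : IsNonsingular f) {G : Subgroup PGL(4, ℂ)} (hG : IsInvariantUnder G (surfaceOf f))
    {A : GL (Fin 4) ℂ} (hA : Matrix.ProjGenLinGroup.mk A ∈ G) :
    ∃ c : ℂ, c ≠ 0 ∧ pull A f = c • f := by
  refine eq_smul_of_zeros hf (pull_isHomogeneous _ hf) hs
    (ne_zero_of_isNonsingular (isNonsingular_pull hs A)) fun v hv => ?_
  by_cases h0 : v = 0
  · rw [eval_pull, h0]
    simpa [h0] using hv
  · rw [← mk_mem_surfaceOf (pull_isHomogeneous _ hf) v h0, ← inv_smul_surfaceOf hf,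
      hG _ (G.inv_mem hA), mk_mem_surfaceOf hf]
    exact hv

/-! ### Lifts of projectivities to matrices -/

theorem mk_mul_of_mem_center (A : GL (Fin 4) ℂ) {z : GL (Fin 4) ℂ}
    (hz : z ∈ Subgroup.center (GL (Fin 4) ℂ)) :
    Matrix.ProjGenLinGroup.mk (z * A) = Matrix.ProjGenLinGroup.mk A := by
  rw [map_mul, Matrix.ProjGenLinGroup.mk_eq_one.mpr hz, one_mul]

theorem exists_smul_of_mk_eq {A B : GL (Fin 4) ℂ}
    (h : Matrix.ProjGenLinGroup.mk A = Matrix.ProjGenLinGroup.mk B) :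
    ∃ c : ℂ, c ≠ 0 ∧ (B : M4) = c • (A : M4) := by
  obtain ⟨u, rfl⟩ := Matrix.ProjGenLinGroup.mk_eq_mk_iff.mp h
  refine ⟨u, u.ne_zero, ?_⟩
  ext i j
  simp [Matrix.GeneralLinearGroup.coe_scalar, mul_comm]

theorem mk_eq_of_smul {A B : GL (Fin 4) ℂ} {c : ℂ} (h : (B : M4) = c • (A : M4)) :
    Matrix.ProjGenLinGroup.mk A = Matrix.ProjGenLinGroup.mk B := by
  have hc : c ≠ 0 := by
    rintro rfl
    rw [zero_smul] at h
    exact B.ne_zero h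
  refine Matrix.ProjGenLinGroup.mk_eq_mk_iff.mpr ⟨Units.mk0 c hc, ?_⟩
  apply Units.ext
  rw [h]
  ext i j
  simp [Matrix.GeneralLinearGroup.coe_scalar, mul_comm]

/-- Two lifts of the same projectivity which fix the same non-zero vector agree. -/
theorem eq_of_mk_eq_of_mulVec_eq {A B : GL (Fin 4) ℂ} {e : Fin 4 → ℂ} (he : e ≠ 0)
    (hA : (A : M4).mulVec e = e) (hB : (B : M4).mulVec e = e)
    (h : Matrix.ProjGenLinGroup.mk A = Matrix.ProjGenLinGroup.mk B) : A = B := by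
  obtain ⟨c, -, hc⟩ := exists_smul_of_mk_eq h
  rw [hc, Matrix.smul_mulVec, hA] at hB
  have h1 : (c - 1) • e = 0 := by rw [sub_smul, hB, one_smul, sub_self]
  have h2 : c = 1 := sub_eq_zero.mp ((smul_eq_zero.mp h1).resolve_right he)
  apply Units.ext
  rw [hc, h2, one_smul]

/-- A projectivity with fixed point `[e]` lifts to a matrix fixing the vector `e`. -/
theorem exists_lift_mulVec_eq {A : GL (Fin 4) ℂ} {e : Fin 4 → ℂ} {c : ℂ} (he : e ≠ 0)
    (h : (A : M4).mulVec e = c • e) :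
    ∃ B : GL (Fin 4) ℂ, Matrix.ProjGenLinGroup.mk B = Matrix.ProjGenLinGroup.mk A ∧
      (B : M4).mulVec e = e := by
  have hc : c ≠ 0 := by
    rintro rfl
    apply he
    have := congrArg ((↑(A⁻¹) : M4).mulVec) h
    simpa [Matrix.mulVec_mulVec, ← Units.val_mul] using this
  let B : GL (Fin 4) ℂ := A * Matrix.GeneralLinearGroup.scalar (Fin 4) (Units.mk0 c⁻¹ (inv_ne_zero
      hc))
  have hB : (B : M4) = c⁻¹ • (A : M4) := by
    ext i j
    simp [B, Matrix.GeneralLinearGroup.coe_scalar, mul_comm]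
  refine ⟨B, (mk_eq_of_smul hB).symm, ?_⟩
  rw [hB, Matrix.smul_mulVec, h, smul_smul, inv_mul_cancel₀ hc, one_smul]

/-- The `m`-th power of any lift is a scalar; dividing the lift by an `m`-th root of that scalar
normalises it. -/
theorem exists_lift_pow_eq_one {x : PGL(4, ℂ)} {m : ℕ} (hm : 0 < m) (hx : x ^ m = 1) :
    ∃ A : GL (Fin 4) ℂ, Matrix.ProjGenLinGroup.mk A = x ∧ A ^ m = 1 := by
  obtain ⟨A, rfl⟩ := Matrix.ProjGenLinGroup.mk_surjective x
  rw [← map_pow, Matrix.ProjGenLinGroup.mk_eq_one,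
    Matrix.GeneralLinearGroup.center_eq_range_scalar] at hx
  obtain ⟨u, hu⟩ := hx
  obtain ⟨d, hd⟩ := IsAlgClosed.exists_pow_nat_eq ((u⁻¹ : ℂˣ) : ℂ) hm
  have hd0 : d ≠ 0 := by
    rintro rfl
    rw [zero_pow hm.ne'] at hd
    exact (u⁻¹).ne_zero hd.symm
  have hz : Matrix.GeneralLinearGroup.scalar (Fin 4) (Units.mk0 d hd0) ∈
      Subgroup.center (GL (Fin 4) ℂ) := by
    rw [Matrix.GeneralLinearGroup.center_eq_range_scalar]
    exact ⟨_, rfl⟩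
  refine ⟨Matrix.GeneralLinearGroup.scalar (Fin 4) (Units.mk0 d hd0) * A,
    mk_mul_of_mem_center A hz, ?_⟩
  have hcomm : Commute (Matrix.GeneralLinearGroup.scalar (Fin 4) (Units.mk0 d hd0)) A :=
    (Subgroup.mem_center_iff.mp hz A).symm
  rw [hcomm.mul_pow, ← hu, ← map_pow, ← map_mul]
  have : Units.mk0 d hd0 ^ m * u = 1 := by
    apply Units.ext
    simp [hd]
  rw [this, map_one]

/-- A projectivity of odd order `m` which is conjugate to its inverse lifts to a matrix of order
dividing `m` which is conjugate to its inverse. -/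
theorem exists_real_lift {x k : PGL(4, ℂ)} {m : ℕ} (hm : Odd m) (hx : x ^ m = 1)
    (hk : k * x * k⁻¹ = x⁻¹) :
    ∃ A K : GL (Fin 4) ℂ, Matrix.ProjGenLinGroup.mk A = x ∧ Matrix.ProjGenLinGroup.mk K = k ∧
      A ^ m = 1 ∧ K * A = A⁻¹ * K := by
  obtain ⟨A, rfl, hA⟩ := exists_lift_pow_eq_one hm.pos hx
  obtain ⟨K, rfl⟩ := Matrix.ProjGenLinGroup.mk_surjective k
  obtain ⟨j, hj⟩ := hm
  set n := K * A * K⁻¹ * A with hn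
  have hnc : n ∈ Subgroup.center (GL (Fin 4) ℂ) := by
    rw [← Matrix.ProjGenLinGroup.mk_eq_one, hn, map_mul, map_mul, map_mul, map_inv, hk,
      inv_mul_cancel]
  have hcomm (B : GL (Fin 4) ℂ) : Commute n B := (Subgroup.mem_center_iff.mp hnc B).symm
  have hconj : K * A * K⁻¹ = n * A⁻¹ := by rw [hn]; group
  have hnm : n ^ m = 1 := by
    have h1 : (K * A * K⁻¹) ^ m = 1 := by rw [conj_pow, hA]; group
    rw [hconj, (hcomm _).mul_pow, inv_pow, hA, inv_one, mul_one] at h1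
    exact h1
  have hz : n ^ j ∈ Subgroup.center (GL (Fin 4) ℂ) := Subgroup.pow_mem _ hnc j
  have hzc (B : GL (Fin 4) ℂ) : Commute (n ^ j) B := (hcomm B).pow_left j
  -- Here `K A K⁻¹ = n A⁻¹` with `n` scalar and `n ^ (2j+1) = 1`. Rescaling `A` by `n ^ j` absorbs
  -- `n`, because `(n ^ j)² n = 1`.
  refine ⟨n ^ j * A, K, mk_mul_of_mem_center A hz, rfl, ?_, ?_⟩
  · rw [(hzc A).mul_pow, hA, mul_one, ← pow_mul, mul_comm, pow_mul, hnm, one_pow]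
  · have h2 : n ^ j * n = (n ^ j)⁻¹ := by
      rw [eq_inv_iff_mul_eq_one, ← hnm, hj, ← pow_succ, ← pow_add]
      congr 1
      ring
    calc K * (n ^ j * A) = n ^ j * (K * A * K⁻¹) * K := by
          rw [← mul_assoc, ← (hzc K).eq]; group
      _ = (n ^ j * n) * A⁻¹ * K := by rw [hconj]; group
      _ = (n ^ j * A)⁻¹ * K := by
          rw [h2, mul_inv_rev, ((hzc A).inv_inv).eq]

theorem smul_form_injective {f : MvPolynomial (Fin 4) ℂ} (hf : f ≠ 0) {c d : ℂ}
    (h : c • f = d • f) : c = d := by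
  have : (c - d) • f = 0 := by rw [sub_smul, h, sub_self]
  exact sub_eq_zero.mp ((smul_eq_zero.mp this).resolve_right hf)

theorem pull_pow_eq {f : MvPolynomial (Fin 4) ℂ} {A : M4} {c : ℂ} (h : pull A f = c • f) (n : ℕ) :
    pull (A ^ n) f = c ^ n • f := by
  induction n with
  | zero => simp
  | succ n ih => rw [pow_succ', ← pull_pull, h, map_smul, ih, smul_smul, pow_succ']

theorem eq_one_of_pow_odd {c : ℂ} {m : ℕ} (hm : Odd m) (h1 : c ^ m = 1) (h2 : c * c = 1) :
    c = 1 := by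
  obtain ⟨j, rfl⟩ := hm
  rwa [pow_succ, pow_mul, sq, h2, one_pow, one_mul] at h1

/-- Let `f ∘ A = c f`. The order of `A` gives `c ^ m = 1`, and `A K A = K` gives `c² = 1`; since `m`
is odd, `c = 1`. -/
theorem pull_eq_self_of_real {f : MvPolynomial (Fin 4) ℂ} (hf : f ≠ 0) {A K : GL (Fin 4) ℂ}
    {m : ℕ} (hm : Odd m) (hA : A ^ m = 1) (hK : K * A = A⁻¹ * K)
    (hA' : ∃ c : ℂ, c ≠ 0 ∧ pull A f = c • f) (hK' : ∃ c : ℂ, c ≠ 0 ∧ pull K f = c • f) :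
    pull A f = f := by
  obtain ⟨c, hc, hcA⟩ := hA'
  obtain ⟨d, hd, hdK⟩ := hK'
  have h1 : c ^ m = 1 := by
    apply smul_form_injective hf
    rw [← pull_pow_eq hcA, ← Units.val_pow_eq_pow_val, hA]
    simp
  have h2 : A * K * A = K := by rw [mul_assoc, hK, mul_inv_cancel_left]
  have h3 : c * c = 1 := by
    have h4 : pull ((A * K * A : GL (Fin 4) ℂ) : M4) f = (c * d * c) • f := by
      rw [Units.val_mul, Units.val_mul, ← pull_pull, ← pull_pull, hcA, map_smul, hdK, map_smul,
        map_smul, hcA, smul_smul, smul_smul]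
    rw [h2, hdK] at h4
    have h5 := smul_form_injective hf h4
    have h6 : d * (c * c - 1) = 0 := by linear_combination -h5
    exact sub_eq_zero.mp ((mul_eq_zero.mp h6).resolve_left hd)
  rw [hcA, eq_one_of_pow_odd hm h1 h3, one_smul]

/-! ### Eigenvectors of matrices of finite order -/

/-- The subspace `U` is mapped into itself by `A`. -/
def Preserves (A : M4) (U : Submodule ℂ (Fin 4 → ℂ)) : Prop := ∀ v ∈ U, A.mulVec v ∈ U

theorem exists_eigenvector_mem {A : M4} {U : Submodule ℂ (Fin 4 → ℂ)} (hU : U ≠ ⊥)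
    (hA : Preserves A U) : ∃ l : ℂ, ∃ w ∈ U, w ≠ 0 ∧ A.mulVec w = l • w := by
  have : Nontrivial U := Submodule.nontrivial_iff_ne_bot.mpr hU
  obtain ⟨l, hl⟩ := Module.End.exists_eigenvalue ((Matrix.toLin' A).restrict (p := U) (q := U)
    (fun v hv => by simpa using hA v hv))
  obtain ⟨w, hw⟩ := hl.exists_hasEigenvector
  refine ⟨l, w, w.2, by simpa using hw.2, ?_⟩
  have := congrArg Subtype.val hw.apply_eq_smul
  simpa using this

theorem pow_mulVec_eq {A : M4} {v : Fin 4 → ℂ} {l : ℂ} (h : A.mulVec v = l • v) (n : ℕ) :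
    (A ^ n).mulVec v = l ^ n • v := by
  induction n with
  | zero => simp
  | succ n ih => rw [pow_succ, ← Matrix.mulVec_mulVec, h, Matrix.mulVec_smul, ih, smul_smul,
      pow_succ']

theorem pow_eq_one_of_eigenvector {A : M4} {v : Fin 4 → ℂ} (hv : v ≠ 0) {l : ℂ}
    (h : A.mulVec v = l • v) {n : ℕ} (hn : A ^ n = 1) : l ^ n = 1 := by
  have h1 := pow_mulVec_eq h n
  rw [hn, Matrix.one_mulVec] at h1
  have h2 : (l ^ n - 1) • v = 0 := by rw [sub_smul, ← h1, one_smul, sub_self]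
  exact sub_eq_zero.mp ((smul_eq_zero.mp h2).resolve_right hv)

theorem Preserves.pow {A : M4} {U : Submodule ℂ (Fin 4 → ℂ)} (hA : Preserves A U) (n : ℕ) :
    Preserves (A ^ n) U := by
  induction n with
  | zero => intro v hv; simpa using hv
  | succ n ih => intro v hv; rw [pow_succ, ← Matrix.mulVec_mulVec]; exact ih _ (hA v hv)

theorem exists_eigenvector_ne_one {A : M4} {U : Submodule ℂ (Fin 4 → ℂ)} (hA : Preserves A U)
    {m : ℕ} (hm0 : 0 < m) (hm : A ^ m = 1) {v : Fin 4 → ℂ} (hv : v ∈ U) (hne : A.mulVec v ≠ v) :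
    ∃ l : ℂ, l ≠ 1 ∧ l ^ m = 1 ∧ ∃ w ∈ U, w ≠ 0 ∧ A.mulVec w = l • w := by
  -- The sum `N` of the powers of `A` annihilates the image of `A - 1` and is multiplication by `m`
  -- on fixed vectors. So an eigenvector in `U ⊓ ker N` has eigenvalue different from 1, and `A v -
  -- v` shows that this space is non-zero.
  set N : M4 := ∑ j ∈ Finset.range m, A ^ j with hN
  have hNA : N * (A - 1) = 0 := by rw [hN, geom_sum_mul, hm, sub_self]
  have hcomm : Commute A N := by
    rw [hN]
    exact Commute.sum_right _ _ _ fun j _ => (Commute.refl A).pow_right j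
  set U' : Submodule ℂ (Fin 4 → ℂ) := U ⊓ LinearMap.ker N.mulVecLin with hU'
  have hA' : Preserves A U' := by
    rintro w ⟨hw1, hw2⟩
    refine ⟨hA w hw1, ?_⟩
    rw [SetLike.mem_coe, LinearMap.mem_ker, Matrix.mulVecLin_apply] at hw2 ⊢
    rw [Matrix.mulVec_mulVec, ← hcomm.eq, ← Matrix.mulVec_mulVec, hw2, Matrix.mulVec_zero]
  have hbot : U' ≠ ⊥ := by
    rw [Submodule.ne_bot_iff]
    refine ⟨A.mulVec v - v, ⟨U.sub_mem (hA v hv) hv, ?_⟩, sub_ne_zero.mpr hne⟩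
    rw [SetLike.mem_coe, LinearMap.mem_ker, Matrix.mulVecLin_apply]
    have : A.mulVec v - v = (A - 1).mulVec v := by rw [Matrix.sub_mulVec, Matrix.one_mulVec]
    rw [this, Matrix.mulVec_mulVec, hNA, Matrix.zero_mulVec]
  obtain ⟨l, w, ⟨hwU, hwN⟩, hw0, hw⟩ := exists_eigenvector_mem hbot hA'
  have hlm := pow_eq_one_of_eigenvector hw0 hw hm
  refine ⟨l, ?_, hlm, w, hwU, hw0, hw⟩
  rintro rfl
  have h2 : N.mulVec w = (m : ℂ) • w := by
    rw [hN, Matrix.sum_mulVec, Finset.sum_congr rfl fun j _ => pow_mulVec_eq hw j]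
    simp [← Nat.cast_smul_eq_nsmul ℂ]
  rw [SetLike.mem_coe, LinearMap.mem_ker, Matrix.mulVecLin_apply, h2] at hwN
  rcases smul_eq_zero.mp hwN with h3 | h3
  · exact hm0.ne' (by exact_mod_cast h3)
  · exact hw0 h3

theorem card_le_finrank_of_eigenvectors {A : M4} {U : Submodule ℂ (Fin 4 → ℂ)} {n : ℕ}
    {l : Fin n → ℂ} (hl : Function.Injective l) {w : Fin n → Fin 4 → ℂ} (hw : ∀ i, w i ∈ U)
    (hw0 : ∀ i, w i ≠ 0) (h : ∀ i, A.mulVec (w i) = l i • w i) : n ≤ Module.finrank ℂ U := by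
  have hli : LinearIndependent ℂ w :=
    Module.End.eigenvectors_linearIndependent' (Matrix.toLin' A) l hl w fun i =>
      Module.End.hasEigenvector_iff.mpr ⟨Module.End.mem_eigenspace_iff.mpr (by simpa using h i),
        hw0 i⟩
  have hli' : LinearIndependent ℂ (fun i => (⟨w i, hw i⟩ : U)) :=
    LinearIndependent.of_comp U.subtype hli
  simpa using hli'.fintype_card_le_finrank

/-! ### Symmetries of order five and three of a non-singular quartic form -/

/-- A matrix of order five fixing a non-singular quartic form does not have eigenvalue one. -/
theorem false_of_order_five {f : MvPolynomial (Fin 4) ℂ} (hf : f.IsHomogeneous 4)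
    (hs : IsNonsingular f) {A : M4} (hA : pull A f = f) (h5 : A ^ 5 = 1) (h1 : A ≠ 1)
    {e : Fin 4 → ℂ} (he : e ≠ 0) (hAe : A.mulVec e = e) : False := by
  obtain ⟨v, hv⟩ : ∃ v, A.mulVec v ≠ v := by
    by_contra! h
    exact h1 (Matrix.ext_of_mulVec_single fun i => by rw [h, Matrix.one_mulVec])
  obtain ⟨l, hl1, hl5, w, -, hw0, hw⟩ :=
    exists_eigenvector_ne_one (U := ⊤) (fun _ _ => trivial) (by norm_num) h5 (Submodule.mem_top (x
        := v)) hv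
  -- For fifth roots of unity `l⁻³ = l²`. As 2 generates the units modulo 5, repeated squaring
  -- reaches all four non-trivial roots; with the eigenvalue 1 this makes five eigenvalues in
  -- dimension four.
  have step {l : ℂ} (hl : l ^ 5 = 1) (h : ∃ w ≠ 0, A.mulVec w = l • w) :
      ∃ w ≠ 0, A.mulVec w = l ^ 2 • w := by
    obtain ⟨w, hw0, hw⟩ := h
    obtain ⟨w', hw0', hw'⟩ := exists_eigenvector_of_isNonsingular hf hs hA hw0 hw
    refine ⟨w', hw0', ?_⟩
    conv_rhs => rw [← hw', smul_smul, ← pow_add, hl, one_smul]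
  have hprim : IsPrimitiveRoot l 5 := IsPrimitiveRoot.of_map_of_injective
    (f := MonoidHom.id ℂ) (by
      have : Fact (Nat.Prime 5) := ⟨by norm_num⟩
      have := orderOf_eq_prime (p := 5) (by simpa using hl5) hl1
      rw [MonoidHom.id_apply, ← this]
      exact IsPrimitiveRoot.orderOf l) Function.injective_id
  have e1 : ∃ w ≠ 0, A.mulVec w = l • w := ⟨w, hw0, hw⟩
  have e2 := step hl5 e1
  have e4 := step (by rw [← pow_mul, mul_comm, pow_mul, hl5, one_pow]) e2
  have e3 := step (by rw [← pow_mul, ← pow_mul, show 2 * 2 * 5 = 5 * 4 by rfl, pow_mul, hl5,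
    one_pow]) e4
  rw [← pow_mul] at e4 e3
  rw [← pow_mul, show 2 * 2 * 2 = 5 + 3 by rfl, pow_add, hl5, one_mul] at e3
  have key : ∀ i : Fin 5, ∃ w ≠ 0, A.mulVec w = l ^ (i : ℕ) • w := by
    intro i
    fin_cases i
    · exact ⟨e, he, by simpa using hAe⟩
    · simpa using e1
    · exact e2
    · exact e3
    · exact e4
  choose ws hws0 hws using key
  have := card_le_finrank_of_eigenvectors (U := ⊤) (l := fun i : Fin 5 => l ^ (i : ℕ))
    (fun i j hij => Fin.ext (hprim.pow_inj i.2 j.2 hij)) (fun _ => Submodule.mem_top) hws0 hws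
  simp at this

/-- A matrix of order three fixing a non-singular quartic form has eigenvalue one. -/
theorem exists_fixed_of_order_three {f : MvPolynomial (Fin 4) ℂ} (hf : f.IsHomogeneous 4)
    (hs : IsNonsingular f) {A : M4} (hA : pull A f = f) (h3 : A ^ 3 = 1) :
    ∃ e ≠ 0, A.mulVec e = e := by
  obtain ⟨l, w, -, hw0, hw⟩ := exists_eigenvector_mem (A := A) (U := ⊤) top_ne_bot
    (fun _ _ => trivial)
  obtain ⟨w', hw0', hw'⟩ := exists_eigenvector_of_isNonsingular hf hs hA hw0 hw
  rw [pow_eq_one_of_eigenvector hw0 hw h3, one_smul] at hw'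
  exact ⟨w', hw0', hw'⟩

/-! ### Invariant subspaces and decompositions -/

/-- The group of projectivities which preserve the subspace `U`. -/
def stabilizerOf (U : Submodule ℂ (Fin 4 → ℂ)) : Subgroup PGL(4, ℂ) where
  carrier := {g | ∃ A : GL (Fin 4) ℂ, Matrix.ProjGenLinGroup.mk A = g ∧
    Preserves A U ∧ Preserves (↑(A⁻¹) : M4) U}
  one_mem' := ⟨1, map_one _, fun v hv => by simpa using hv, fun v hv => by simpa using hv⟩
  mul_mem' := by
    rintro _ _ ⟨A, rfl, hA, hA'⟩ ⟨B, rfl, hB, hB'⟩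
    refine ⟨A * B, map_mul _ _ _, fun v hv => ?_, fun v hv => ?_⟩
    · rw [Units.val_mul, ← Matrix.mulVec_mulVec]
      exact hA _ (hB _ hv)
    · rw [mul_inv_rev, Units.val_mul, ← Matrix.mulVec_mulVec]
      exact hB' _ (hA' _ hv)
  inv_mem' := by
    rintro _ ⟨A, rfl, hA, hA'⟩
    exact ⟨A⁻¹, map_inv _ _, hA', by rwa [inv_inv]⟩

theorem preserves_of_mem_stabilizerOf {U : Submodule ℂ (Fin 4 → ℂ)} {A : GL (Fin 4) ℂ}
    (h : Matrix.ProjGenLinGroup.mk A ∈ stabilizerOf U) : Preserves A U := by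
  obtain ⟨B, hB, hBU, -⟩ := h
  obtain ⟨c, -, hc⟩ := exists_smul_of_mk_eq hB
  intro v hv
  rw [hc, Matrix.smul_mulVec]
  exact U.smul_mem c (hBU v hv)

/-- The element permutes at most four summands, and each of its orbits has length 1 or `p`; since `p
≥ 5`, every orbit is a point. -/
theorem map_eq_of_prime_order {G : Subgroup PGL(4, ℂ)} {Γ : Set (Submodule ℂ (Fin 4 → ℂ))}
    (hΓ : IsDecomposition G Γ) {p : ℕ} (hp : p.Prime) (h5 : 5 ≤ p) {A : GL (Fin 4) ℂ}
    (hA : Matrix.ProjGenLinGroup.mk A ∈ G) (hAp : Matrix.ProjGenLinGroup.mk A ^ p = 1)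
    {V : Submodule ℂ (Fin 4 → ℂ)} (hV : V ∈ Γ) :
    V.map (Matrix.mulVecLin (A : M4)) = V := by
  let φ : Γ → Γ := fun U => ⟨U.1.map (Matrix.mulVecLin (A : M4)), hΓ.map_mem A hA U.1 U.2⟩
  have hiter (n : ℕ) : ((φ^[n] ⟨V, hV⟩ : Γ) : Submodule ℂ (Fin 4 → ℂ)) =
      V.map (Matrix.mulVecLin ((A : M4) ^ n)) := by
    induction n with
    | zero => simp
    | succ n ih =>
      rw [Function.iterate_succ_apply']
      change Submodule.map _ (φ^[n] ⟨V, hV⟩ : Γ).1 = _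
      rw [ih, ← Submodule.map_comp, ← Matrix.mulVecLin_mul, ← pow_succ']
  have hper : Function.IsPeriodicPt φ p ⟨V, hV⟩ := by
    apply Subtype.ext
    rw [hiter]
    obtain ⟨c, hc, hcA⟩ := exists_smul_of_mk_eq (A := 1) (B := A ^ p) (by rw [map_pow, hAp,
        map_one])
    rw [Units.val_pow_eq_pow_val] at hcA
    rw [hcA]
    have : Matrix.mulVecLin (c • ((1 : GL (Fin 4) ℂ) : M4)) = c • LinearMap.id := by
      ext v i
      simp
    rw [this, Submodule.map_smul _ _ _ hc, Submodule.map_id]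
  have : Finite Γ := (WellFoundedGT.finite_of_sSupIndep hΓ.indep).to_subtype
  have := Fintype.ofFinite Γ
  have hcard : Fintype.card Γ ≤ 4 := by
    have hind := (sSupIndep_iff Γ).mp hΓ.indep
    have := Fintype.ofFinite {i : Γ // (i : Submodule ℂ (Fin 4 → ℂ)) ≠ ⊥}
    have h1 := hind.subtype_ne_bot_le_finrank
    rw [Module.finrank_fin_fun] at h1
    refine le_trans (Fintype.card_le_of_injective (fun U => ⟨U, hΓ.ne_bot U.1 U.2⟩) ?_) h1
    intro U U' h
    simpa using h
  rcases (Nat.dvd_prime hp).mp hper.minimalPeriod_dvd with h1 | h1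
  · exact congrArg Subtype.val (Function.minimalPeriod_eq_one_iff_isFixedPt.mp h1)
  · exfalso
    have hinj : Function.Injective (fun i : Fin p => φ^[(i : ℕ)] ⟨V, hV⟩) := fun i j hij =>
      Fin.ext (Function.iterate_injOn_Iio_minimalPeriod (by simp [h1]) (by simp [h1]) hij)
    have := Fintype.card_le_of_injective _ hinj
    rw [Fintype.card_fin] at this
    omega

/-- A non-primitive group has a pair of complementary subspaces preserved by all elements of prime
order at least five. -/
theorem exists_isCompl_of_not_isPrimitiveGroup {G : Subgroup PGL(4, ℂ)}
    (hG : ¬ IsPrimitiveGroup G) :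
    ∃ V W : Submodule ℂ (Fin 4 → ℂ), IsCompl V W ∧
      (Module.finrank ℂ V = 1 ∧ Module.finrank ℂ W = 3 ∨
        Module.finrank ℂ V = 2 ∧ Module.finrank ℂ W = 2) ∧
      ∀ g ∈ G, ∀ p : ℕ, p.Prime → 5 ≤ p → g ^ p = 1 → g ∈ stabilizerOf V ⊓ stabilizerOf W := by
  obtain ⟨Γ, hΓ⟩ := not_not.mp hG
  obtain ⟨V, hV, V', hV', hne⟩ := hΓ.nontrivial
  set W := sSup (Γ \ {V}) with hW
  have hdisj : Disjoint V W := hΓ.indep hV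
  have htop : V ⊔ W = ⊤ := by
    rw [hW, ← sSup_insert, Set.insert_sdiff_singleton, Set.insert_eq_of_mem hV, hΓ.sSup_eq_top]
  have hVW : IsCompl V W := ⟨hdisj, codisjoint_iff.mpr htop⟩
  have hW0 : W ≠ ⊥ := fun h => hΓ.ne_bot V' hV' <| by
    rw [eq_bot_iff, ← h]
    exact le_sSup ⟨hV', hne.symm⟩
  have hpres : ∀ g ∈ G, ∀ p : ℕ, p.Prime → 5 ≤ p → g ^ p = 1 →
      g ∈ stabilizerOf V ⊓ stabilizerOf W := by
    intro g hg p hp h5 hgp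
    obtain ⟨A, rfl⟩ := Matrix.ProjGenLinGroup.mk_surjective g
    have key (B : GL (Fin 4) ℂ) (hB : Matrix.ProjGenLinGroup.mk B ∈ G)
        (hBp : Matrix.ProjGenLinGroup.mk B ^ p = 1) : Preserves B V ∧ Preserves B W := by
      have hU : ∀ U ∈ Γ, U ≤ U.comap (Matrix.mulVecLin (B : M4)) := fun U hU =>
        Submodule.map_le_iff_le_comap.mp (map_eq_of_prime_order hΓ hp h5 hB hBp hU).le
      refine ⟨fun v hv => hU V hV hv, ?_⟩
      have : W ≤ W.comap (Matrix.mulVecLin (B : M4)) := sSup_le fun U hU' =>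
        (hU U hU'.1).trans (Submodule.comap_mono (le_sSup hU'))
      exact fun v hv => this hv
    have hA := key A hg hgp
    have hA' := key A⁻¹ (by rw [map_inv]; exact G.inv_mem hg) (by rw [map_inv, inv_pow, hgp,
        inv_one])
    exact ⟨⟨A, rfl, hA.1, hA'.1⟩, ⟨A, rfl, hA.2, hA'.2⟩⟩
  have hsum := Submodule.finrank_add_eq_of_isCompl hVW
  rw [Module.finrank_fin_fun] at hsum
  have h1 : 0 < Module.finrank ℂ V := Module.finrank_pos_iff.mpr
    (Submodule.nontrivial_iff_ne_bot.mpr (hΓ.ne_bot V hV))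
  have h2 : 0 < Module.finrank ℂ W := Module.finrank_pos_iff.mpr
    (Submodule.nontrivial_iff_ne_bot.mpr hW0)
  rcases (by omega : Module.finrank ℂ V = 1 ∨ Module.finrank ℂ V = 2 ∨ Module.finrank ℂ V = 3)
    with h | h | h
  · exact ⟨V, W, hVW, Or.inl ⟨h, by omega⟩, hpres⟩
  · exact ⟨V, W, hVW, Or.inr ⟨h, by omega⟩, hpres⟩
  -- A summand of dimension three has a line as complement; the two are interchanged so that the
  -- line comes first.
  · refine ⟨W, V, hVW.symm, Or.inl ⟨by omega, h⟩, fun g hg p hp h5 hgp => ?_⟩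
    rw [inf_comm]
    exact hpres g hg p hp h5 hgp

/-! ### Real elements of order three on two planes -/

theorem mulVec_ne_zero (A : GL (Fin 4) ℂ) {v : Fin 4 → ℂ} (hv : v ≠ 0) :
    (A : M4).mulVec v ≠ 0 := fun h => hv <| by
  have := congrArg ((↑(A⁻¹) : M4).mulVec) h
  simpa [Matrix.mulVec_mulVec, ← Units.val_mul] using this

theorem inv_mulVec_eq {A : GL (Fin 4) ℂ} {v w : Fin 4 → ℂ} (h : (A : M4).mulVec v = w) :
    (↑(A⁻¹) : M4).mulVec w = v := by
  rw [← h, Matrix.mulVec_mulVec, ← Units.val_mul, inv_mul_cancel]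
  simp

theorem mulVec_inv_mulVec (A : GL (Fin 4) ℂ) (v : Fin 4 → ℂ) :
    (A : M4).mulVec ((↑(A⁻¹) : M4).mulVec v) = v := by
  rw [Matrix.mulVec_mulVec, ← Units.val_mul, mul_inv_cancel]
  simp

/-- If `A` is conjugate to its inverse by `K`, then `K` maps eigenvectors to eigenvectors for the
inverse eigenvalue. -/
theorem smul_mulVec_of_real {A K : GL (Fin 4) ℂ} (hK : K * A = A⁻¹ * K) {l : ℂ} {v : Fin 4 → ℂ}
    (h : (A : M4).mulVec v = l • v) :
    l • (A : M4).mulVec ((K : M4).mulVec v) = (K : M4).mulVec v := by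
  have h1 : A * K * A = K := by rw [mul_assoc, hK, mul_inv_cancel_left]
  conv_rhs => rw [← h1, Units.val_mul, Units.val_mul, ← Matrix.mulVec_mulVec,
    ← Matrix.mulVec_mulVec, h, Matrix.mulVec_smul, Matrix.mulVec_smul]

/-- Otherwise `A` has an eigenvalue `l ≠ 1` on the plane, `K` carries its eigenvector to one for
`l⁻¹`, and `e` supplies the eigenvalue 1: three distinct eigenvalues on a plane. -/
theorem forall_fixed_of_order_three {A K : GL (Fin 4) ℂ} (hA : A ^ 3 = 1) (hK : K * A = A⁻¹ * K)
    {V : Submodule ℂ (Fin 4 → ℂ)} (hAV : Preserves A V) (hKV : Preserves K V)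
    (hV : Module.finrank ℂ V = 2) {e : Fin 4 → ℂ} (he : e ∈ V) (he0 : e ≠ 0)
    (hAe : (A : M4).mulVec e = e) : ∀ v ∈ V, (A : M4).mulVec v = v := by
  by_contra! h
  obtain ⟨v, hv, hne⟩ := h
  obtain ⟨l, hl1, hl3, w, hwV, hw0, hw⟩ := exists_eigenvector_ne_one hAV (m := 3) (by norm_num)
    (by rw [← Units.val_pow_eq_pow_val, hA]; rfl) hv hne
  have hl0 : l ≠ 0 := by
    rintro rfl
    norm_num at hl3
  have hprim : IsPrimitiveRoot l 3 := by
    have : Fact (Nat.Prime 3) := ⟨by norm_num⟩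
    have h3 := orderOf_eq_prime (p := 3) (by simpa using hl3) hl1
    have := IsPrimitiveRoot.orderOf l
    rwa [h3] at this
  have key : ∀ i : Fin 3, ∃ w ∈ V, w ≠ 0 ∧ (A : M4).mulVec w = l ^ (i : ℕ) • w := by
    intro i
    fin_cases i
    · exact ⟨e, he, he0, by simpa using hAe⟩
    · exact ⟨w, hwV, hw0, by simpa using hw⟩
    · refine ⟨(K : M4).mulVec w, hKV w hwV, mulVec_ne_zero K hw0, ?_⟩
      conv_rhs => rw [← smul_mulVec_of_real hK hw, smul_smul]
      simp only
      rw [← pow_succ, hl3, one_smul]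
  choose ws hwsV hws0 hws using key
  have := card_le_finrank_of_eigenvectors (U := V) (l := fun i : Fin 3 => l ^ (i : ℕ))
    (fun i j hij => Fin.ext (hprim.pow_inj i.2 j.2 hij)) hwsV hws0 hws
  omega

/-- The matrix `A` has a fixed vector, whose components in `V` and `W` are again fixed. A non-zero
component forces `A` to be the identity on its plane. -/
theorem fixed_summand_of_order_three {f : MvPolynomial (Fin 4) ℂ} (hf : f.IsHomogeneous 4)
    (hs : IsNonsingular f) {A K : GL (Fin 4) ℂ} (hAf : pull A f = f) (hA : A ^ 3 = 1)
    (hK : K * A = A⁻¹ * K) {V W : Submodule ℂ (Fin 4 → ℂ)} (hVW : IsCompl V W)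
    (hV : Module.finrank ℂ V = 2) (hW : Module.finrank ℂ W = 2) (hAV : Preserves A V)
    (hAW : Preserves A W) (hKV : Preserves K V) (hKW : Preserves K W) :
    (∀ v ∈ V, (A : M4).mulVec v = v) ∨ (∀ v ∈ W, (A : M4).mulVec v = v) := by
  obtain ⟨e, he0, hAe⟩ := exists_fixed_of_order_three hf hs hAf
    (by rw [← Units.val_pow_eq_pow_val, hA]; rfl)
  obtain ⟨v, hv, w, hw, hvw⟩ := Submodule.mem_sup.mp
    (hVW.sup_eq_top ▸ Submodule.mem_top : e ∈ V ⊔ W)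
  have h1 : (A : M4).mulVec v - v = -((A : M4).mulVec w - w) := by
    rw [← hvw, Matrix.mulVec_add] at hAe
    have : (A : M4).mulVec v - v + ((A : M4).mulVec w - w) = 0 := by
      rw [← sub_eq_zero] at hAe
      rw [← hAe]
      abel
    exact eq_neg_of_add_eq_zero_left this
  have h2 : (A : M4).mulVec v - v = 0 := Submodule.disjoint_def.mp hVW.disjoint _
    (V.sub_mem (hAV v hv) hv) (h1 ▸ W.neg_mem (W.sub_mem (hAW w hw) hw))
  have h3 : (A : M4).mulVec w - w = 0 := by
    rw [h2] at h1
    exact neg_eq_zero.mp h1.symm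
  by_cases hv0 : v = 0
  · right
    refine forall_fixed_of_order_three hA hK hAW hKW hW hw ?_ (sub_eq_zero.mp h3)
    rintro rfl
    exact he0 (by rw [← hvw, hv0, add_zero])
  · left
    exact forall_fixed_of_order_three hA hK hAV hKV hV hv hv0 (sub_eq_zero.mp h2)

/-! ### Groups containing the icosahedral group -/

/-- Three elements of an icosahedral group: `c` has order three, the commutator of `c` and `k` has
order five, and these two elements are inverted by `l` and `k`. -/
structure IsIcosahedralTriple {H : Type*} [Group H] (c k l : H) : Prop where
  pow_three : c ^ 3 = 1
  conj_l : l * c * l⁻¹ = c⁻¹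
  pow_five : (c * k * c⁻¹ * k⁻¹) ^ 5 = 1
  ne_one : c * k * c⁻¹ * k⁻¹ ≠ 1
  conj_k : k * (c * k * c⁻¹ * k⁻¹) * k⁻¹ = (c * k * c⁻¹ * k⁻¹)⁻¹
  exists_c : ∃ y z, y ^ 5 = 1 ∧ z ^ 5 = 1 ∧ c = y * z
  exists_k : ∃ y z, y ^ 5 = 1 ∧ z ^ 5 = 1 ∧ k = y * z
  exists_l : ∃ y z, y ^ 5 = 1 ∧ z ^ 5 = 1 ∧ l = y * z

theorem IsIcosahedralTriple.map {H H' : Type*} [Group H] [Group H'] {c k l : H}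
    (h : IsIcosahedralTriple c k l) (φ : H →* H') (hφ : Function.Injective φ) :
    IsIcosahedralTriple (φ c) (φ k) (φ l) where
  pow_three := by rw [← map_pow, h.pow_three, map_one]
  conj_l := by simp only [← map_inv, ← map_mul, h.conj_l]
  pow_five := by simp only [← map_inv, ← map_mul, ← map_pow, h.pow_five, map_one]
  ne_one := by
    simp only [← map_inv, ← map_mul]
    exact fun h0 => h.ne_one (hφ (by rw [h0, map_one]))
  conj_k := by simp only [← map_inv, ← map_mul, h.conj_k]
  exists_c := by
    obtain ⟨y, z, hy, hz, e⟩ := h.exists_c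
    exact ⟨φ y, φ z, by rw [← map_pow, hy, map_one], by rw [← map_pow, hz, map_one],
      by rw [e, map_mul]⟩
  exists_k := by
    obtain ⟨y, z, hy, hz, e⟩ := h.exists_k
    exact ⟨φ y, φ z, by rw [← map_pow, hy, map_one], by rw [← map_pow, hz, map_one],
      by rw [e, map_mul]⟩
  exists_l := by
    obtain ⟨y, z, hy, hz, e⟩ := h.exists_l
    exact ⟨φ y, φ z, by rw [← map_pow, hy, map_one], by rw [← map_pow, hz, map_one],
      by rw [e, map_mul]⟩

/-- The elements `c`, `k`, `l` are products of elements of order dividing five, hence preserve both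
summands. In each case the commutator of `c` and `k`, of order five, is shown to have a lift fixing
both the form and a non-zero vector, against `false_of_order_five`. -/
theorem not_fixesSmoothQuartic_of_icosahedral {G : Subgroup PGL(4, ℂ)} (hG : ¬ IsPrimitiveGroup G)
    {c k l : G} (h : IsIcosahedralTriple c k l) : ¬ FixesSmoothQuartic G := by
  rintro ⟨_, ⟨f, hf, hs, rfl⟩, hinv⟩
  have hf0 := ne_zero_of_isNonsingular hs
  obtain ⟨V, W, hVW, hdim, hstab⟩ := exists_isCompl_of_not_isPrimitiveGroup hG
  have mem {x : G} (hx : ∃ y z : G, y ^ 5 = 1 ∧ z ^ 5 = 1 ∧ x = y * z) :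
      (x : PGL(4, ℂ)) ∈ stabilizerOf V ⊓ stabilizerOf W := by
    obtain ⟨y, z, hy, hz, rfl⟩ := hx
    exact mul_mem (hstab y y.2 5 (by norm_num) le_rfl (by exact_mod_cast congrArg Subtype.val hy))
      (hstab z z.2 5 (by norm_num) le_rfl (by exact_mod_cast congrArg Subtype.val hz))
  have hc := mem h.exists_c
  have hk := mem h.exists_k
  have hl := mem h.exists_l
  have h' := h.map G.subtype G.subtype_injective
  simp only [Subgroup.coe_subtype] at h'
  obtain ⟨X, K, hX, hK, hX5, hKX⟩ := exists_real_lift (by decide) h'.pow_five h'.conj_k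
  have semi {B : GL (Fin 4) ℂ} (x : G) (hB : Matrix.ProjGenLinGroup.mk B = x) :
      ∃ a : ℂ, a ≠ 0 ∧ pull B f = a • f := exists_pull_eq_smul hf hs hinv (by rw [hB]; exact x.2)
  have hXf : pull X f = f := pull_eq_self_of_real hf0 (by decide) hX5 hKX
    (semi (c * k * c⁻¹ * k⁻¹) (by rw [hX]; rfl)) (semi k hK)
  have hX1 : (X : M4) ≠ 1 := fun h1 => h'.ne_one <| by
    rw [← hX, show X = 1 from Units.ext h1, map_one]
  -- Since `K` inverts `X`, an eigenvalue `a` common to `e` and `K e` satisfies `a² = 1`; with `a⁵ =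
  -- 1` this leaves the excluded value 1.
  have final {e : Fin 4 → ℂ} (he : e ≠ 0) {a : ℂ} (hXe : (X : M4).mulVec e = a • e)
      (hXK : (X : M4).mulVec ((K : M4).mulVec e) = a • (K : M4).mulVec e) : False := by
    have h1 := smul_mulVec_of_real hKX hXe
    rw [hXK, smul_smul] at h1
    have h2 : (a * a - 1) • (K : M4).mulVec e = 0 := by rw [sub_smul, h1, one_smul, sub_self]
    have h3 := sub_eq_zero.mp ((smul_eq_zero.mp h2).resolve_right (mulVec_ne_zero K he))
    have h5 : (X : M4) ^ 5 = 1 := by rw [← Units.val_pow_eq_pow_val, hX5]; rfl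
    have h4 := eq_one_of_pow_odd (by decide) (pow_eq_one_of_eigenvector he hXe h5) h3
    rw [h4, one_smul] at hXe
    exact false_of_order_five hf hs hXf h5 hX1 he hXe
  rcases hdim with ⟨hV1, -⟩ | ⟨hV2, hW2⟩
  · obtain ⟨⟨e, heV⟩, he0, he⟩ := finrank_eq_one_iff'.mp hV1
    have hspan {B : GL (Fin 4) ℂ} (hB : Matrix.ProjGenLinGroup.mk B ∈ stabilizerOf V) :
        ∃ a : ℂ, (B : M4).mulVec e = a • e := by
      obtain ⟨a, ha⟩ := he ⟨_, preserves_of_mem_stabilizerOf hB e heV⟩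
      exact ⟨a, (congrArg Subtype.val ha).symm⟩
    obtain ⟨a, ha⟩ := hspan (B := X) (by
      rw [hX]
      exact mul_mem (mul_mem (mul_mem hc.1 hk.1) (inv_mem hc.1)) (inv_mem hk.1))
    obtain ⟨b, hb⟩ := hspan (B := K) (by rw [hK]; exact hk.1)
    refine final (e := e) (fun h0 => he0 (Subtype.ext h0)) ha ?_
    rw [hb, Matrix.mulVec_smul, ha, smul_comm]
  · obtain ⟨C, L, hC, hL, hC3, hLC⟩ := exists_real_lift (by decide) h'.pow_three h'.conj_l
    have hCf : pull C f = f := pull_eq_self_of_real hf0 (by decide) hC3 hLC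
      (semi c hC) (semi l hL)
    have scalar {U : Submodule ℂ (Fin 4 → ℂ)} (hU : Module.finrank ℂ U = 2)
        (hkU : (k : PGL(4, ℂ)) ∈ stabilizerOf U)
        (hCU : ∀ v ∈ U, (C : M4).mulVec v = v) : False := by
      have hKU : Preserves K U := preserves_of_mem_stabilizerOf (by rwa [hK])
      have hKU' : Preserves (↑(K⁻¹) : M4) U := preserves_of_mem_stabilizerOf (by
        rw [map_inv, hK]
        exact inv_mem hkU)
      obtain ⟨a, -, ha⟩ := exists_smul_of_mk_eq (A := C * K * C⁻¹ * K⁻¹) (B := X) (by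
        rw [hX, map_mul, map_mul, map_mul, map_inv, map_inv, hC, hK])
      -- The commutator of `C` and `K` is trivial on `U` because `C` is, and `X` is a scalar
      -- multiple of that commutator.
      have hXU : ∀ u ∈ U, (X : M4).mulVec u = a • u := by
        intro u hu
        rw [ha, Matrix.smul_mulVec, Units.val_mul, Units.val_mul, Units.val_mul,
          ← Matrix.mulVec_mulVec, ← Matrix.mulVec_mulVec, ← Matrix.mulVec_mulVec,
          inv_mulVec_eq (hCU _ (hKU' u hu)), mulVec_inv_mulVec, hCU u hu]
      obtain ⟨e, heU, he0⟩ := Submodule.exists_mem_ne_zero_of_ne_bot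
        (p := U) (by rintro rfl; simp at hU)
      exact final he0 (hXU e heU) (hXU _ (hKU e heU))
    have pres {U : Submodule ℂ (Fin 4 → ℂ)} {x : PGL(4, ℂ)} (hx : x ∈ stabilizerOf U)
        {B : GL (Fin 4) ℂ} (hB : Matrix.ProjGenLinGroup.mk B = x) : Preserves B U :=
      preserves_of_mem_stabilizerOf (by rwa [hB])
    rcases fixed_summand_of_order_three hf hs hCf hC3 hLC hVW hV2 hW2 (pres hc.1 hC) (pres hc.2 hC)
      (pres hl.1 hL) (pres hl.2 hL) with hfix | hfix
    · exact scalar hV2 hk.1 hfix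
    · exact scalar hW2 hk.2 hfix

/-! ### Icosahedral triples in the alternating groups -/

/-- An even permutation as an element of the alternating group. -/
def evenPerm {n : ℕ} (σ : Equiv.Perm (Fin n)) (h : Equiv.Perm.sign σ = 1) :
    alternatingGroup (Fin n) :=
  ⟨σ, Equiv.Perm.mem_alternatingGroup.mpr h⟩

open Equiv.Perm in
set_option maxRecDepth 20000 in
theorem exists_isIcosahedralTriple_alternatingGroup_five :
    ∃ c k l : alternatingGroup (Fin 5), IsIcosahedralTriple c k l :=
  ⟨evenPerm (c[0, 1, 2]) (by decide), evenPerm (c[0, 4] * c[1, 3]) (by decide), evenPerm (c[0,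
      1] * c[3, 4]) (by decide),
    { pow_three := by decide
      conj_l := by decide
      pow_five := by decide
      ne_one := by decide
      conj_k := by decide
      exists_c := ⟨evenPerm (c[0, 2, 3, 4, 1]) (by decide), evenPerm (c[0, 4, 3, 2,
          1]) (by decide), by decide,
        by decide, by decide⟩
      exists_k := ⟨evenPerm (c[0, 1, 2, 4, 3]) (by decide), evenPerm (c[0, 2, 1, 4,
          3]) (by decide), by decide,
        by decide, by decide⟩
      exists_l := ⟨evenPerm (c[0, 2, 4, 1, 3]) (by decide), evenPerm (c[0, 4, 1, 3,
          2]) (by decide), by decide,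
        by decide, by decide⟩ }⟩

-- The same permutations of the first five points, with the sixth point fixed.
open Equiv.Perm in
set_option maxRecDepth 20000 in
theorem exists_isIcosahedralTriple_alternatingGroup_six :
    ∃ c k l : alternatingGroup (Fin 6), IsIcosahedralTriple c k l :=
  ⟨evenPerm (c[0, 1, 2]) (by decide), evenPerm (c[0, 4] * c[1, 3]) (by decide), evenPerm (c[0,
      1] * c[3, 4]) (by decide),
    { pow_three := by decide
      conj_l := by decide
      pow_five := by decide
      ne_one := by decide
      conj_k := by decide
      exists_c := ⟨evenPerm (c[0, 2, 3, 4, 1]) (by decide), evenPerm (c[0, 4, 3, 2,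
          1]) (by decide), by decide,
        by decide, by decide⟩
      exists_k := ⟨evenPerm (c[0, 1, 2, 4, 3]) (by decide), evenPerm (c[0, 2, 1, 4,
          3]) (by decide), by decide,
        by decide, by decide⟩
      exists_l := ⟨evenPerm (c[0, 2, 4, 1, 3]) (by decide), evenPerm (c[0, 4, 1, 3,
          2]) (by decide), by decide,
        by decide, by decide⟩ }⟩

/-! ### Generators and relations for the simple group of order 168 -/

/-- The relations between the standard generators of the simple group of order 168. -/
structure IsKleinTriple {H : Type*} [Group H] (s t r : H) : Prop where
  s_pow : s ^ 7 = 1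
  t_pow : t ^ 3 = 1
  r_sq : r * r = 1
  s_mul_t : s * t = t * s ^ 2
  r_mul_t : r * t = t ^ 2 * r
  rs_pow : (r * s) ^ 3 = 1

namespace IsKleinTriple

variable {H : Type*} [Group H] {s t r : H}

theorem map (h : IsKleinTriple s t r) {H' : Type*} [Group H'] (φ : H →* H') :
    IsKleinTriple (φ s) (φ t) (φ r) where
  s_pow := by rw [← map_pow, h.s_pow, map_one]
  t_pow := by rw [← map_pow, h.t_pow, map_one]
  r_sq := by rw [← map_mul, h.r_sq, map_one]
  s_mul_t := by rw [← map_mul, h.s_mul_t, map_mul, map_pow]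
  r_mul_t := by rw [← map_mul, h.r_mul_t, map_mul, map_pow]
  rs_pow := by rw [← map_mul, ← map_pow, h.rs_pow, map_one]

theorem of_injective {H' : Type*} [Group H'] (φ : H →* H') (hφ : Function.Injective φ)
    (h : IsKleinTriple (φ s) (φ t) (φ r)) : IsKleinTriple s t r where
  s_pow := hφ (by rw [map_pow, h.s_pow, map_one])
  t_pow := hφ (by rw [map_pow, h.t_pow, map_one])
  r_sq := hφ (by rw [map_mul, h.r_sq, map_one])
  s_mul_t := hφ (by rw [map_mul, h.s_mul_t, map_mul, map_pow])
  r_mul_t := hφ (by rw [map_mul, h.r_mul_t, map_mul, map_pow])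
  rs_pow := hφ (by rw [map_pow, map_mul, h.rs_pow, map_one])

theorem prod {H' : Type*} [Group H'] {s' t' r' : H'} (h : IsKleinTriple s t r)
    (h' : IsKleinTriple s' t' r') : IsKleinTriple (s, s') (t, t') (r, r') where
  s_pow := Prod.ext h.s_pow h'.s_pow
  t_pow := Prod.ext h.t_pow h'.t_pow
  r_sq := Prod.ext h.r_sq h'.r_sq
  s_mul_t := Prod.ext h.s_mul_t h'.s_mul_t
  r_mul_t := Prod.ext h.r_mul_t h'.r_mul_t
  rs_pow := Prod.ext h.rs_pow h'.rs_pow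

theorem r_inv (h : IsKleinTriple s t r) : r⁻¹ = r := inv_eq_of_mul_eq_one_left h.r_sq

theorem t_inv (h : IsKleinTriple s t r) : t⁻¹ = t ^ 2 :=
  inv_eq_of_mul_eq_one_left (by rw [← pow_succ, h.t_pow])

theorem s_inv (h : IsKleinTriple s t r) : s⁻¹ = s ^ 6 :=
  inv_eq_of_mul_eq_one_left (by rw [← pow_succ, h.s_pow])

theorem conj_t (h : IsKleinTriple s t r) : r * t * r⁻¹ = t⁻¹ := by
  rw [h.r_mul_t, h.t_inv, mul_inv_cancel_right]

/-- This is the relation `(r s)³ = 1` rewritten so that the left side, a product of `r`, `s`, `r`,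
visibly lies in the big Bruhat cell. -/
theorem rsr (h : IsKleinTriple s t r) : r * s * r = s⁻¹ * r * s⁻¹ := by
  have h1 : r * s * (r * s) * (r * s) = 1 := by rw [← sq, ← pow_succ, h.rs_pow]
  rw [mul_assoc s⁻¹, eq_inv_mul_iff_mul_eq, eq_mul_inv_iff_mul_eq, ← h.r_inv,
    eq_inv_iff_mul_eq_one, h.r_inv]
  have h2 : r * (r * s * (r * s) * (r * s)) * r = 1 := by rw [h1, mul_one, h.r_sq]
  rw [← h2]
  simp only [← mul_assoc, h.r_sq, one_mul]

theorem conj_inv_t (h : IsKleinTriple s t r) : t⁻¹ * s * t = s ^ 2 := by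
  rw [mul_assoc, h.s_mul_t, inv_mul_cancel_left]

/-- This symmetry exchanges the two possible sets of non-trivial eigenvalues of `s` on a
three-dimensional summand. -/
theorem inv (h : IsKleinTriple s t r) : IsKleinTriple s⁻¹ t r where
  s_pow := by rw [inv_pow, h.s_pow, inv_one]
  t_pow := h.t_pow
  r_sq := h.r_sq
  s_mul_t := by
    rw [inv_pow, ← h.conj_inv_t]
    group
  r_mul_t := h.r_mul_t
  rs_pow := by
    have h1 : (r * s⁻¹) ^ 3 = r * ((r * s) ^ 3)⁻¹ * r⁻¹ := by
      rw [← inv_pow, ← conj_pow, mul_inv_rev, h.r_inv]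
      simp only [mul_assoc, h.r_sq, mul_one]
    rw [h1, h.rs_pow, inv_one, mul_one, mul_inv_cancel]

theorem pow_s_mul_pow_t (h : IsKleinTriple s t r) (i j : ℕ) :
    s ^ i * t ^ j = t ^ j * s ^ (2 ^ j * i) := by
  induction j with
  | zero => simp
  | succ j ih =>
    have h1 (n : ℕ) : s ^ n * t = t * s ^ (2 * n) := by
      rw [pow_mul, ← h.conj_inv_t]
      have := conj_pow (i := n) (a := t⁻¹) (b := s)
      rw [inv_inv] at this
      rw [this]
      group
    rw [pow_succ, ← mul_assoc, ih, mul_assoc, h1, ← mul_assoc, pow_succ' 2,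
      mul_assoc 2]

theorem r_mul_pow_t (h : IsKleinTriple s t r) (j : ℕ) : r * t ^ j = t ^ (2 * j) * r := by
  induction j with
  | zero => simp
  | succ j ih => rw [pow_succ, ← mul_assoc, ih, mul_assoc, h.r_mul_t, ← mul_assoc, ← pow_add,
      mul_add, mul_one]

/-- The Borel subgroup `⟨s, t⟩`. -/
def borel (h : IsKleinTriple s t r) : Subgroup H where
  carrier := {x | ∃ i j : ℕ, x = t ^ j * s ^ i}
  one_mem' := ⟨0, 0, by simp⟩
  mul_mem' := by
    rintro _ _ ⟨i, j, rfl⟩ ⟨i', j', rfl⟩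
    refine ⟨2 ^ j' * i + i', j + j', ?_⟩
    rw [mul_assoc, ← mul_assoc (s ^ i), h.pow_s_mul_pow_t, pow_add, pow_add]
    simp only [mul_assoc]
  inv_mem' := by
    rintro _ ⟨i, j, rfl⟩
    -- The inverse is `s ^ (6i) * t ^ (2j)`, since `s⁻¹ = s⁶` and `t⁻¹ = t²`; moving the power of
    -- `t` to the left multiplies the exponent of `s` by `2 ^ (2j)`.
    refine ⟨2 ^ (2 * j) * (6 * i), 2 * j, ?_⟩
    rw [mul_inv_rev, ← inv_pow, ← inv_pow, h.s_inv, h.t_inv, ← pow_mul, ← pow_mul,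
      h.pow_s_mul_pow_t]

theorem s_mem_borel (h : IsKleinTriple s t r) : s ∈ h.borel := ⟨1, 0, by simp⟩

theorem t_mem_borel (h : IsKleinTriple s t r) : t ∈ h.borel := ⟨0, 1, by simp⟩

/-- The union of the two Bruhat cells. -/
def InCells (h : IsKleinTriple s t r) (x : H) : Prop :=
  x ∈ h.borel ∨ ∃ b ∈ h.borel, ∃ b' ∈ h.borel, x = b * r * b'

theorem InCells.mul_left {h : IsKleinTriple s t r} {x b : H} (hx : h.InCells x)
    (hb : b ∈ h.borel) : h.InCells (b * x) := by
  rcases hx with hx | ⟨c, hc, c', hc', rfl⟩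
  · exact Or.inl (mul_mem hb hx)
  · exact Or.inr ⟨b * c, mul_mem hb hc, c', hc', by simp only [mul_assoc]⟩

theorem InCells.mul_right {h : IsKleinTriple s t r} {x b : H} (hx : h.InCells x)
    (hb : b ∈ h.borel) : h.InCells (x * b) := by
  rcases hx with hx | ⟨c, hc, c', hc', rfl⟩
  · exact Or.inl (mul_mem hx hb)
  · exact Or.inr ⟨c, hc, c' * b, mul_mem hc' hb, by simp only [mul_assoc]⟩

/-- For exponents `±1` this is `rsr`, applied to `s` and `s⁻¹`. Conjugation by `t` doubles the
exponent, and the orbits `1, 2, 4` and `6, 5, 3` exhaust the non-zero residues modulo 7. -/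
theorem inCells_r_mul_pow_s_mul_r (h : IsKleinTriple s t r) (i : ℕ) :
    h.InCells (r * s ^ i * r) := by
  have hs := h.s_mem_borel
  have conj {x : H} (hx : h.InCells (r * x * r)) : h.InCells (r * (t⁻¹ * x * t) * r) := by
    have h1 : r * (t⁻¹ * x * t) * r = t * (r * x * r) * t⁻¹ := by
      have h2 : r * t⁻¹ = t * r := by
        rw [mul_inv_eq_iff_eq_mul, mul_assoc, h.r_mul_t, ← mul_assoc, ← pow_succ', h.t_pow, one_mul]
      calc r * (t⁻¹ * x * t) * r = (r * t⁻¹) * x * (t * r) := by simp only [mul_assoc]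
        _ = (t * r) * x * (r * t⁻¹) := by rw [h2]
        _ = t * (r * x * r) * t⁻¹ := by simp only [mul_assoc]
    rw [h1]
    exact (hx.mul_left h.t_mem_borel).mul_right (inv_mem h.t_mem_borel)
  have h1 : h.InCells (r * s * r) := Or.inr ⟨s⁻¹, inv_mem hs, s⁻¹, inv_mem hs, h.rsr⟩
  have h6 : h.InCells (r * s⁻¹ * r) := by
    refine Or.inr ⟨s, hs, s, hs, ?_⟩
    have := h.inv.rsr
    rwa [inv_inv] at this
  have hd (n : ℕ) : t⁻¹ * s ^ n * t = s ^ (2 * n) := by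
    rw [pow_mul, ← h.conj_inv_t]
    have := conj_pow (i := n) (a := t⁻¹) (b := s)
    rw [inv_inv] at this
    rw [this]
  have hred (n : ℕ) : s ^ n = s ^ (n % 7) := pow_eq_pow_mod n h.s_pow
  have step {n : ℕ} (hn : h.InCells (r * s ^ n * r)) : h.InCells (r * s ^ (2 * n % 7) * r) := by
    rw [← hred, ← hd]
    exact conj hn
  have c1 : h.InCells (r * s ^ 1 * r) := by rwa [pow_one]
  have c6 : h.InCells (r * s ^ 6 * r) := by rwa [← h.s_inv]
  have c0 : h.InCells (r * s ^ 0 * r) := Or.inl (by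
    rw [pow_zero, mul_one, h.r_sq]
    exact one_mem _)
  have c2 := step c1
  have c4 := step c2
  have c5 := step c6
  have c3 := step c5
  rw [hred]
  have hlt : i % 7 < 7 := Nat.mod_lt _ (by norm_num)
  interval_cases i % 7
  exacts [c0, c1, c2, c3, c4, c5, c6]

theorem InCells.r_mul {h : IsKleinTriple s t r} {x : H} (hx : h.InCells x) :
    h.InCells (r * x) := by
  rcases hx with hx | ⟨b, ⟨i, j, rfl⟩, b', hb', rfl⟩
  · exact Or.inr ⟨1, one_mem _, x, hx, by rw [one_mul]⟩
  · have h1 : r * (t ^ j * s ^ i * r * b') = t ^ (2 * j) * (r * s ^ i * r) * b' := by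
      simp only [← mul_assoc]
      rw [h.r_mul_pow_t]
    rw [h1]
    exact ((h.inCells_r_mul_pow_s_mul_r i).mul_left (pow_mem h.t_mem_borel _)).mul_right hb'

theorem inCells_of_mem_closure (h : IsKleinTriple s t r) {x : H}
    (hx : x ∈ Subgroup.closure {s, t, r}) : h.InCells x := by
  have hs := h.s_mem_borel
  have ht := h.t_mem_borel
  induction hx using Subgroup.closure_induction_left with
  | one => exact Or.inl (one_mem _)
  | mul_left x hx y _ hy =>
    rcases hx with rfl | rfl | rfl
    · exact hy.mul_left hs
    · exact hy.mul_left ht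
    · exact hy.r_mul
  | inv_mul_cancel x hx y _ hy =>
    rcases hx with rfl | rfl | rfl
    · exact hy.mul_left (inv_mem hs)
    · exact hy.mul_left (inv_mem ht)
    · rw [h.r_inv]
      exact hy.r_mul

/-- An element of the kernel lies in one of the two cells. In the Borel subgroup, `h1` makes it
trivial; in the big cell, the image of `r` would lie in the image of the Borel subgroup, against
`h2`. -/
theorem injective_of_closure_eq_top (h : IsKleinTriple s t r)
    (htop : Subgroup.closure {s, t, r} = ⊤) {H' : Type*} [Group H'] (φ : H →* H')
    (h1 : ∀ i < 7, ∀ j < 3, φ t ^ j * φ s ^ i = 1 → i = 0 ∧ j = 0)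
    (h2 : ∀ i < 7, ∀ j < 3, φ t ^ j * φ s ^ i ≠ φ r) : Function.Injective φ := by
  have hred (i j : ℕ) : t ^ j * s ^ i = t ^ (j % 3) * s ^ (i % 7) := by
    rw [← pow_eq_pow_mod i h.s_pow, ← pow_eq_pow_mod j h.t_pow]
  have hi (i : ℕ) : i % 7 < 7 := Nat.mod_lt _ (by norm_num)
  have hj (j : ℕ) : j % 3 < 3 := Nat.mod_lt _ (by norm_num)
  rw [injective_iff_map_eq_one]
  intro x hx
  rcases h.inCells_of_mem_closure (htop ▸ Subgroup.mem_top x) with ⟨i, j, rfl⟩ |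
    ⟨b, hb, b', hb', rfl⟩
  · rw [hred] at hx ⊢
    rw [map_mul, map_pow, map_pow] at hx
    obtain ⟨e1, e2⟩ := h1 _ (hi i) _ (hj j) hx
    rw [e1, e2, pow_zero, pow_zero, mul_one]
  · exfalso
    obtain ⟨i, j, hij⟩ := mul_mem (inv_mem hb) (inv_mem hb')
    rw [hred] at hij
    refine h2 _ (hi i) _ (hj j) ?_
    rw [← map_pow, ← map_pow, ← map_mul, ← hij, map_mul, map_inv, map_inv]
    rw [map_mul, map_mul] at hx
    rw [eq_comm, eq_inv_mul_iff_mul_eq, ← mul_inv_eq_one, inv_inv]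
    exact hx

/-- Two groups generated by Klein triples are isomorphic, provided that their Bruhat normal forms
are non-trivial. -/
theorem nonempty_mulEquiv (h : IsKleinTriple s t r) (htop : Subgroup.closure {s, t, r} = ⊤)
    (h1 : ∀ i < 7, ∀ j < 3, t ^ j * s ^ i = 1 → i = 0 ∧ j = 0)
    (h2 : ∀ i < 7, ∀ j < 3, t ^ j * s ^ i ≠ r) {H' : Type*} [Group H'] {s' t' r' : H'}
    (h' : IsKleinTriple s' t' r') (htop' : Subgroup.closure {s', t', r'} = ⊤)
    (h1' : ∀ i < 7, ∀ j < 3, t' ^ j * s' ^ i = 1 → i = 0 ∧ j = 0)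
    (h2' : ∀ i < 7, ∀ j < 3, t' ^ j * s' ^ i ≠ r') : Nonempty (H ≃* H') := by
  -- This subgroup is to be the graph of the isomorphism: it is generated by a Klein triple, so both
  -- projections are injective by the normal form, and they are surjective on generators.
  let K : Subgroup (H × H') := Subgroup.closure {(s, s'), (t, t'), (r, r')}
  let S : K := ⟨(s, s'), Subgroup.subset_closure (by simp)⟩
  let T : K := ⟨(t, t'), Subgroup.subset_closure (by simp)⟩
  let R : K := ⟨(r, r'), Subgroup.subset_closure (by simp)⟩
  have hK : IsKleinTriple S T R := of_injective K.subtype K.subtype_injective (h.prod h')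
  have hKtop : Subgroup.closure {S, T, R} = ⊤ := by
    rw [← (Subgroup.map_injective K.subtype_injective).eq_iff, MonoidHom.map_closure,
      ← MonoidHom.range_eq_map, Subgroup.range_subtype, Set.image_insert_eq, Set.image_insert_eq,
      Set.image_singleton]
    rfl
  let p : K →* H := (MonoidHom.fst H H').comp K.subtype
  let p' : K →* H' := (MonoidHom.snd H H').comp K.subtype
  have hp : Function.Bijective p := by
    refine ⟨hK.injective_of_closure_eq_top hKtop p h1 h2, ?_⟩
    rw [← MonoidHom.range_eq_top, eq_top_iff, ← htop, Subgroup.closure_le]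
    rintro x (rfl | rfl | rfl)
    exacts [⟨S, rfl⟩, ⟨T, rfl⟩, ⟨R, rfl⟩]
  have hp' : Function.Bijective p' := by
    refine ⟨hK.injective_of_closure_eq_top hKtop p' h1' h2', ?_⟩
    rw [← MonoidHom.range_eq_top, eq_top_iff, ← htop', Subgroup.closure_le]
    rintro x (rfl | rfl | rfl)
    exacts [⟨S, rfl⟩, ⟨T, rfl⟩, ⟨R, rfl⟩]
  exact ⟨(MulEquiv.ofBijective p hp).symm.trans (MulEquiv.ofBijective p' hp')⟩

end IsKleinTriple

/-! ### The group `PSL(2, 𝔽₇)` -/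

instance : Fact (Nat.Prime 7) := ⟨by norm_num⟩

/-- The class in `PSL(2, 𝔽₇)` of a matrix of determinant one. -/
def pslMk (a b c d : ZMod 7) (h : a * d - b * c = 1) : PSL(2, ZMod 7) :=
  QuotientGroup.mk' (Subgroup.center SL(2, ZMod 7))
    (⟨!![a, b; c, d], by rw [Matrix.det_fin_two_of, h]⟩ : SL(2, ZMod 7))

theorem pslMk_congr {a b c d a' b' c' d' : ZMod 7} {h : a * d - b * c = 1}
    {h' : a' * d' - b' * c' = 1} (ha : a = a') (hb : b = b') (hc : c = c') (hd : d = d') :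
    pslMk a b c d h = pslMk a' b' c' d' h' := by
  subst ha hb hc hd
  rfl

theorem pslMk_one : pslMk 1 0 0 1 (by decide) = 1 := by
  unfold pslMk
  refine Eq.trans (congrArg _ ?_) (map_one _)
  apply Subtype.ext
  exact Matrix.one_fin_two.symm

theorem pslMk_mul {a b c d a' b' c' d' : ZMod 7} (h : a * d - b * c = 1)
    (h' : a' * d' - b' * c' = 1) :
    pslMk a b c d h * pslMk a' b' c' d' h' =
      pslMk (a * a' + b * c') (a * b' + b * d') (c * a' + d * c') (c * b' + d * d')
        (by linear_combination h * (a' * d' - b' * c') + h') := by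
  unfold pslMk
  refine ((map_mul _ _ _).symm.trans (congrArg _ ?_))
  apply Subtype.ext
  exact Matrix.mul_fin_two _ _ _ _ _ _ _ _

theorem pslMk_eq_one_iff {a b c d : ZMod 7} (h : a * d - b * c = 1) :
    pslMk a b c d h = 1 ↔ b = 0 ∧ c = 0 ∧ a = d := by
  unfold pslMk
  refine (QuotientGroup.eq_one_iff _).trans (Matrix.SpecialLinearGroup.mem_center_iff.trans ?_)
  constructor
  · rintro ⟨r, -, hr⟩
    have h01 := congrFun (congrFun hr 0) 1
    have h10 := congrFun (congrFun hr 1) 0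
    have h00 := congrFun (congrFun hr 0) 0
    have h11 := congrFun (congrFun hr 1) 1
    simp at h01 h10 h00 h11
    exact ⟨h01.symm, h10.symm, h00.symm.trans h11⟩
  · rintro ⟨rfl, rfl, rfl⟩
    refine ⟨a, by rw [Fintype.card_fin]; linear_combination h, ?_⟩
    ext i j
    fin_cases i <;> fin_cases j <;> simp

theorem pslMk_neg {a b c d : ZMod 7} (h : a * d - b * c = 1) :
    pslMk (-a) (-b) (-c) (-d) (by linear_combination h) = pslMk a b c d h := by
  have h1 : pslMk (-a) (-b) (-c) (-d) (by linear_combination h) =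
      pslMk (-1) 0 0 (-1) (by decide) * pslMk a b c d h := by
    rw [pslMk_mul]
    apply pslMk_congr <;> ring
  rw [h1, (pslMk_eq_one_iff _).mpr (by decide), one_mul]

/-- The unipotent generator of `PSL(2, 𝔽₇)`. -/
def pslS : PSL(2, ZMod 7) := pslMk 1 1 0 1 (by decide)

/-- The diagonal generator of `PSL(2, 𝔽₇)`. -/
def pslT : PSL(2, ZMod 7) := pslMk 2 0 0 4 (by decide)

/-- The Weyl element of `PSL(2, 𝔽₇)`. -/
def pslR : PSL(2, ZMod 7) := pslMk 0 1 (-1) 0 (by decide)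

theorem pslS_pow (n : ℕ) : pslS ^ n = pslMk 1 n 0 1 (by ring) := by
  induction n with
  | zero => rw [pow_zero, ← pslMk_one]; apply pslMk_congr <;> simp
  | succ n ih => rw [pow_succ, ih, pslS, pslMk_mul]; apply pslMk_congr <;> push_cast <;> ring

theorem two_pow_mul_four_pow (n : ℕ) : (2 ^ n * 4 ^ n - 0 * 0 : ZMod 7) = 1 := by
  rw [← mul_pow, show (2 * 4 : ZMod 7) = 1 by decide, one_pow]
  decide

theorem pslT_pow (n : ℕ) : pslT ^ n = pslMk (2 ^ n) 0 0 (4 ^ n) (two_pow_mul_four_pow n) := by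
  induction n with
  | zero => rw [pow_zero, ← pslMk_one]; apply pslMk_congr <;> simp
  | succ n ih => rw [pow_succ, ih, pslT, pslMk_mul]; apply pslMk_congr <;> ring

theorem isKleinTriple_psl : IsKleinTriple pslS pslT pslR where
  s_pow := by
    rw [pslS_pow, pslMk_eq_one_iff]
    decide
  t_pow := by
    rw [pslT_pow, pslMk_eq_one_iff]
    decide
  r_sq := by
    rw [pslR, pslMk_mul, pslMk_eq_one_iff]
    decide
  s_mul_t := by
    rw [pslS_pow, pslS, pslT, pslMk_mul, pslMk_mul]
    apply pslMk_congr <;> decide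
  r_mul_t := by
    rw [pslT_pow, pslT, pslR, pslMk_mul, pslMk_mul]
    apply pslMk_congr <;> decide
  rs_pow := by
    rw [pow_succ, sq, pslR, pslS, pslMk_mul, pslMk_mul, pslMk_mul, pslMk_eq_one_iff]
    decide

/-- Together with `exists_conj_inv_psl` this makes the traces of `r s` and `r s⁻¹` equal to that of
`t` in lifts fixing a common vector, which determines the matrix of `r` up to a scalar on the
three-space. -/
theorem exists_conj_psl : ∃ k, k * pslT = pslR * pslS * k := by
  refine ⟨pslMk 1 4 2 2 (by decide), ?_⟩
  rw [pslR, pslS, pslT, pslMk_mul, pslMk_mul, pslMk_mul]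
  apply pslMk_congr <;> decide

theorem exists_conj_inv_psl : ∃ k, k * pslT = pslR * pslS⁻¹ * k := by
  refine ⟨pslMk 1 3 5 2 (by decide), ?_⟩
  rw [isKleinTriple_psl.s_inv, pslS_pow, pslR, pslT, pslMk_mul, pslMk_mul, pslMk_mul, ← pslMk_neg]
  apply pslMk_congr <;> decide

theorem closure_psl : Subgroup.closure {pslS, pslT, pslR} = ⊤ := by
  rw [eq_top_iff]
  rintro g -
  set K := Subgroup.closure {pslS, pslT, pslR}
  have hS : pslS ∈ K := Subgroup.subset_closure (by simp)
  have hT : pslT ∈ K := Subgroup.subset_closure (by simp)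
  have hR : pslR ∈ K := Subgroup.subset_closure (by simp)
  have hU (x : ZMod 7) : pslMk 1 x 0 1 (by ring) ∈ K := by
    have := pow_mem hS x.val
    rw [pslS_pow] at this
    convert this
    simp
  have hD (a d : ZMod 7) (h : a * d - 0 * 0 = 1) : pslMk a 0 0 d h ∈ K := by
    -- The powers of 2 are the squares modulo 7 and `-1` is not a square, so each unit is `± 2ⁿ`;
    -- the sign disappears in `PSL`.
    have key : ∀ a d : ZMod 7, a * d - 0 * 0 = 1 → ∃ n : Fin 3,
        (a = 2 ^ (n : ℕ) ∧ d = 4 ^ (n : ℕ)) ∨ (a = -2 ^ (n : ℕ) ∧ d = -4 ^ (n : ℕ)) := by decide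
    obtain ⟨n, hn⟩ := key a d h
    have hTn := pow_mem hT (n : ℕ)
    rw [pslT_pow] at hTn
    rcases hn with ⟨rfl, rfl⟩ | ⟨rfl, rfl⟩
    · exact hTn
    · rw [← pslMk_neg] at hTn
      convert hTn <;> simp
  obtain ⟨⟨M, hM⟩, rfl⟩ := QuotientGroup.mk'_surjective (Subgroup.center SL(2, ZMod 7)) g
  obtain ⟨a, b, c, d, hM'⟩ : ∃ a b c d, M = !![a, b; c, d] :=
    ⟨_, _, _, _, Matrix.eta_fin_two M⟩
  subst hM'
  have hdet : a * d - b * c = 1 := by rwa [Matrix.det_fin_two_of] at hM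
  change pslMk a b c d hdet ∈ K
  by_cases hc : c = 0
  · subst hc
    have hmem := mul_mem (hD a d (by linear_combination hdet)) (hU (d * b))
    rw [pslMk_mul] at hmem
    convert hmem using 1
    apply pslMk_congr
    · ring
    · linear_combination (-b) * hdet
    · ring
    · ring
  -- Bruhat decomposition: for `c ≠ 0` the matrix is, up to sign, the product of the unipotent with
  -- entry `a / c`, `diag(1 / c, c)`, the Weyl element and the unipotent with entry `d / c`.
  · have hcc := mul_inv_cancel₀ hc
    have hmem := mul_mem (mul_mem (mul_mem (hU (a * c⁻¹)) (hD (c⁻¹) c (by linear_combination hcc)))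
      hR) (hU (d * c⁻¹))
    rw [pslR, pslMk_mul, pslMk_mul, pslMk_mul, ← pslMk_neg] at hmem
    convert hmem using 1
    apply pslMk_congr
    · linear_combination (-a) * hcc
    · linear_combination (-a * d * c⁻¹ - b) * hcc - c⁻¹ * hdet
    · ring
    · linear_combination (-d) * hcc

theorem psl_normal_form_ne_one : ∀ i < 7, ∀ j < 3, pslT ^ j * pslS ^ i = 1 → i = 0 ∧ j = 0 := by
  intro i hi j hj
  rw [pslS_pow, pslT_pow, pslMk_mul, pslMk_eq_one_iff]
  rintro ⟨h1, -, h2⟩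
  revert h1 h2
  interval_cases i <;> interval_cases j <;> decide

theorem psl_normal_form_ne_r : ∀ i < 7, ∀ j < 3, pslT ^ j * pslS ^ i ≠ pslR := by
  intro i hi j hj h
  have h1 : pslT ^ j * pslS ^ i * pslR = 1 := by rw [h, isKleinTriple_psl.r_sq]
  rw [pslS_pow, pslT_pow, pslR, pslMk_mul, pslMk_mul, pslMk_eq_one_iff] at h1
  obtain ⟨h1, -⟩ := h1
  revert h1
  interval_cases j <;> simp <;> decide

/-! ### The generators of `(P)` -/

theorem ζ_pow_im (k : ℕ) : (ζ ^ k).im = Real.sin (2 * Real.pi * k / 7) := by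
  unfold ζ
  rw [← Complex.exp_nat_mul, show (k : ℂ) * (2 * Real.pi * Complex.I / 7) =
    ((2 * Real.pi * k / 7 : ℝ) : ℂ) * Complex.I by push_cast; ring, Complex.exp_ofReal_mul_I_im]

/-- The quadratic Gauss sum modulo seven. -/
theorem gauss_sum : uMinus + sMinus + tMinus = Complex.I * rt 7 := by
  have h7 := rt_mul_self 7
  push_cast at h7
  have hsq : (uMinus + sMinus + tMinus - Complex.I * rt 7) *
      (uMinus + sMinus + tMinus + Complex.I * rt 7) = 0 := by
    have h1 : (uMinus + sMinus + tMinus) * (uMinus + sMinus + tMinus) = -7 := by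
      unfold uMinus sMinus tMinus
      linear_combination (ζ ^ 5 + ζ ^ 3 + ζ - 6 + 2 * (ζ ^ 4 - ζ ^ 3)) * ζ_pow + ζ_sum
    linear_combination h1 - rt 7 * rt 7 * Complex.I_mul_I + h7
  rcases mul_eq_zero.mp hsq with h | h
  · exact sub_eq_zero.mp h
  -- The square of the sum being `-7`, only the sign remains. The imaginary part is twice `sin(2π/7)
  -- + sin(4π/7) - sin(π/7)`, which is positive.
  · exfalso
    have him := congrArg Complex.im h
    have h1 : (Complex.I * rt 7).im = Real.sqrt 7 := by simp [rt]
    have hpi := Real.pi_pos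
    have e1 := ζ_pow_im 1
    have e2 := ζ_pow_im 2
    have e3 := ζ_pow_im 3
    have e4 := ζ_pow_im 4
    have e5 := ζ_pow_im 5
    have e6 := ζ_pow_im 6
    rw [pow_one] at e1
    have f6 : Real.sin (2 * Real.pi * (6 : ℕ) / 7) = -Real.sin (2 * Real.pi * (1 : ℕ) / 7) := by
      rw [← Real.sin_two_pi_sub]
      congr 1
      push_cast
      ring
    have f5 : Real.sin (2 * Real.pi * (5 : ℕ) / 7) = -Real.sin (2 * Real.pi * (2 : ℕ) / 7) := by
      rw [← Real.sin_two_pi_sub]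
      congr 1
      push_cast
      ring
    have f4 : Real.sin (2 * Real.pi * (4 : ℕ) / 7) = -Real.sin (2 * Real.pi * (3 : ℕ) / 7) := by
      rw [← Real.sin_two_pi_sub]
      congr 1
      push_cast
      ring
    have f3 : Real.sin (2 * Real.pi * (3 : ℕ) / 7) = Real.sin (Real.pi / 7) := by
      rw [← Real.sin_pi_sub]
      congr 1
      push_cast
      ring
    have p2 : 0 < Real.sin (2 * Real.pi * (2 : ℕ) / 7) :=
      Real.sin_pos_of_pos_of_lt_pi (by positivity) (by push_cast; linarith)
    have p1 : Real.sin (Real.pi / 7) < Real.sin (2 * Real.pi * (1 : ℕ) / 7) :=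
      Real.sin_lt_sin_of_lt_of_le_pi_div_two (by linarith) (by push_cast; linarith)
        (by push_cast; linarith)
    have hs : 0 ≤ Real.sqrt 7 := Real.sqrt_nonneg 7
    rw [Complex.add_im, h1, Complex.add_im, Complex.add_im] at him
    unfold uMinus sMinus tMinus at him
    rw [Complex.sub_im, Complex.sub_im, Complex.sub_im, e1, e2, e3, e4, e5, e6, f6, f5, f4, f3,
      Complex.zero_im] at him
    linarith

/-- This and the next five identities are the independent entries of the symmetric relation `R S R =
S⁻¹ R S⁻¹` on the three-space, with the scalar `cR` replaced by one seventh of the Gauss sum. The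
cofactors of `ζ_sum` are quotients by the seventh cyclotomic polynomial. -/
theorem gauss_mul_rsr_11 : (uMinus + sMinus + tMinus) *
    (uMinus * ζ ^ 4 * uMinus + sMinus * ζ ^ 2 * sMinus + tMinus * ζ * tMinus) =
      7 * (ζ ^ 6 * uMinus) := by
  unfold uMinus sMinus tMinus
  linear_combination ((-5) * ζ ^ 7 + 8 * ζ ^ 8 + (-6) * ζ ^ 9 + 1 * ζ ^ 10 + 2 * ζ ^ 11 +
      1 * ζ ^ 12 + (-2) * ζ ^ 13 + 2 * ζ ^ 14 + (-1) * ζ ^ 16) * ζ_sum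

theorem gauss_mul_rsr_12 : (uMinus + sMinus + tMinus) *
    (uMinus * ζ ^ 4 * sMinus + sMinus * ζ ^ 2 * tMinus + tMinus * ζ * uMinus) =
      7 * (ζ ^ 1 * sMinus) := by
  unfold uMinus sMinus tMinus
  linear_combination ((-7) * ζ ^ 3 + 7 * ζ ^ 4 + 6 * ζ ^ 6 + (-6) * ζ ^ 7 + 2 * ζ ^ 8 +
      (-3) * ζ ^ 9 + (-3) * ζ ^ 10 + 4 * ζ ^ 11 + (-1) * ζ ^ 12 + 2 * ζ ^ 13 +
      (-1) * ζ ^ 15) * ζ_sum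

theorem gauss_mul_rsr_13 : (uMinus + sMinus + tMinus) *
    (uMinus * ζ ^ 4 * tMinus + sMinus * ζ ^ 2 * uMinus + tMinus * ζ * sMinus) =
      7 * (ζ ^ 2 * tMinus) := by
  unfold uMinus sMinus tMinus
  linear_combination (7 * ζ ^ 5 + (-13) * ζ ^ 6 + 6 * ζ ^ 7 + (-1) * ζ ^ 8 + 2 * ζ ^ 9 +
      (-4) * ζ ^ 10 + 6 * ζ ^ 11 + (-2) * ζ ^ 12 + (-2) * ζ ^ 13 + 1 * ζ ^ 14) * ζ_sum

theorem gauss_mul_rsr_22 : (uMinus + sMinus + tMinus) *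
    (sMinus * ζ ^ 4 * sMinus + tMinus * ζ ^ 2 * tMinus + uMinus * ζ * uMinus) =
      7 * (ζ ^ 3 * tMinus) := by
  unfold uMinus sMinus tMinus
  linear_combination (1 * ζ ^ 4 + 5 * ζ ^ 6 + (-12) * ζ ^ 7 + 5 * ζ ^ 8 + (-1) * ζ ^ 10 +
      2 * ζ ^ 11 + 2 * ζ ^ 12 + (-1) * ζ ^ 13 + (-1) * ζ ^ 14) * ζ_sum

theorem gauss_mul_rsr_23 : (uMinus + sMinus + tMinus) *
    (sMinus * ζ ^ 4 * tMinus + tMinus * ζ ^ 2 * uMinus + uMinus * ζ * sMinus) =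
      7 * (ζ ^ 4 * uMinus) := by
  unfold uMinus sMinus tMinus
  linear_combination ((-6) * ζ ^ 5 + 7 * ζ ^ 6 + (-3) * ζ ^ 7 + 2 * ζ ^ 8 + 3 * ζ ^ 10 +
      (-3) * ζ ^ 11 + (-1) * ζ ^ 12 + 1 * ζ ^ 13) * ζ_sum

theorem gauss_mul_rsr_33 : (uMinus + sMinus + tMinus) *
    (tMinus * ζ ^ 4 * tMinus + uMinus * ζ ^ 2 * uMinus + sMinus * ζ * sMinus) =
      7 * (ζ ^ 5 * sMinus) := by
  unfold uMinus sMinus tMinus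
  linear_combination (1 * ζ ^ 5 + 1 * ζ ^ 6 + (-9) * ζ ^ 7 + 7 * ζ ^ 8 + (-2) * ζ ^ 9 +
      3 * ζ ^ 10 + (-1) * ζ ^ 11 + 1 * ζ ^ 12 + (-1) * ζ ^ 14) * ζ_sum

/-- The scalar factor of the third generator of `(P)`. -/
noncomputable def cR : ℂ := Complex.I / rt 7

theorem seven_mul_cR : 7 * cR = uMinus + sMinus + tMinus := by
  rw [gauss_sum, cR]
  have h7 := rt_mul_self 7
  have hr := rt_ne_zero (n := 7) (by norm_num)
  push_cast at h7
  field_simp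
  linear_combination -h7

theorem matR_eq : matR = !![1, 0, 0, 0;
    0, cR * uMinus, cR * sMinus, cR * tMinus;
    0, cR * sMinus, cR * tMinus, cR * uMinus;
    0, cR * tMinus, cR * uMinus, cR * sMinus] := by
  have hr := rt_ne_zero (n := 7) (by norm_num)
  have hd : Complex.I / rt 7 * (-Complex.I * rt 7) = 1 := by
    field_simp
    linear_combination -Complex.I_mul_I
  unfold matR
  ext i j
  fin_cases i <;> fin_cases j <;> simp [cR]
  simpa using hd

theorem matS_eq : matS = Matrix.diagonal ![1, ζ ^ 4, ζ ^ 2, ζ] := by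
  ext i j
  fin_cases i <;> fin_cases j <;> simp [matS]

/-- The generators of `(P)` as invertible matrices. -/
noncomputable def glS : GL (Fin 4) ℂ := Matrix.GeneralLinearGroup.mkOfDetNeZero matS det_matS

/-- The generators of `(P)` as invertible matrices. -/
noncomputable def glT : GL (Fin 4) ℂ := Matrix.GeneralLinearGroup.mkOfDetNeZero matT det_matT

/-- The generators of `(P)` as invertible matrices. -/
noncomputable def glR : GL (Fin 4) ℂ := Matrix.GeneralLinearGroup.mkOfDetNeZero matR det_matR

theorem val_glS : (glS : M4) = matS := rfl

theorem val_glT : (glT : M4) = matT := rfl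

theorem val_glR : (glR : M4) = matR := rfl

theorem matS_pow (n : ℕ) :
    matS ^ n = Matrix.diagonal ![1, (ζ ^ 4) ^ n, (ζ ^ 2) ^ n, ζ ^ n] := by
  rw [matS_eq, Matrix.diagonal_pow]
  congr 1
  ext i
  fin_cases i <;> simp

theorem matS_pow_seven : matS ^ 7 = 1 := by
  rw [matS_pow, ← pow_mul, ← pow_mul, mul_comm, pow_mul, mul_comm, pow_mul, ζ_pow, one_pow, one_pow]
  ext i j
  fin_cases i <;> fin_cases j <;> simp

theorem cR_mul_norm : cR * cR * 7 = -1 := by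
  have h7 := rt_mul_self 7
  have hr := rt_ne_zero (n := 7) (by norm_num)
  push_cast at h7
  unfold cR
  field_simp
  linear_combination 7 * Complex.I_mul_I + h7

theorem matR_mul_self : matR * matR = 1 := by
  have h1 : uMinus * uMinus + sMinus * sMinus + tMinus * tMinus = -7 := by
    unfold uMinus sMinus tMinus
    linear_combination (ζ ^ 5 + ζ ^ 3 + ζ - 6) * ζ_pow + ζ_sum
  have h2 : uMinus * sMinus + sMinus * tMinus + tMinus * uMinus = 0 := by
    unfold uMinus sMinus tMinus
    linear_combination (ζ ^ 4 - ζ ^ 3) * ζ_pow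
  have hc := cR_mul_norm
  rw [matR_eq]
  ext i j
  fin_cases i <;> fin_cases j <;> simp [Matrix.mul_apply, Fin.sum_univ_succ] <;>
    first
      | linear_combination cR * cR * h1 - hc
      | linear_combination cR * cR * h2

theorem matR_mul_matS_mul_matR : matR * matS * matR = matS ^ 6 * matR * matS ^ 6 := by
  have h7 := seven_mul_cR
  have hred {a b : ℂ} (h : (uMinus + sMinus + tMinus) * a = 7 * b) : cR * (cR * a) = cR * b := by
    linear_combination (cR / 7) * h + (cR * a / 7) * h7
  have hp : ζ ^ 24 = ζ ^ 3 ∧ ζ ^ 12 = ζ ^ 5 :=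
    ⟨by linear_combination (ζ ^ 17 + ζ ^ 10 + ζ ^ 3) * ζ_pow, by linear_combination ζ ^ 5 * ζ_pow⟩
  have key (i j : Fin 4) : (matR * matS * matR) i j = (matS ^ 6 * matR * matS ^ 6) i j := by
    rw [matS_pow, ← pow_mul, ← pow_mul, hp.1, hp.2, matS_eq]
    rw [Matrix.mul_diagonal, Matrix.diagonal_mul, Matrix.mul_apply, Fin.sum_univ_four]
    simp only [Matrix.mul_diagonal]
    rw [matR_eq]
    have e11 := hred gauss_mul_rsr_11
    have e12 := hred gauss_mul_rsr_12
    have e13 := hred gauss_mul_rsr_13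
    have e22 := hred gauss_mul_rsr_22
    have e23 := hred gauss_mul_rsr_23
    have e33 := hred gauss_mul_rsr_33
    have z := ζ_pow
    fin_cases i <;> fin_cases j <;> simp
    · linear_combination e11
    · linear_combination e12 - cR * sMinus * ζ * z
    · linear_combination e13 - cR * tMinus * ζ ^ 2 * z
    · linear_combination e12 - cR * sMinus * ζ * z
    · linear_combination e22 - cR * tMinus * ζ ^ 3 * z
    · linear_combination e23 - cR * uMinus * ζ ^ 4 * z
    · linear_combination e13 - cR * tMinus * ζ ^ 2 * z
    · linear_combination e23 - cR * uMinus * ζ ^ 4 * z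
    · linear_combination e33 - cR * sMinus * ζ ^ 5 * z
  exact Matrix.ext key

/-- The relations hold for the matrices themselves and not only up to scalars, as they must, since
all three fix the first coordinate vector. -/
theorem isKleinTriple_gl : IsKleinTriple glS glT glR where
  s_pow := Units.ext (by rw [Units.val_pow_eq_pow_val, val_glS, matS_pow_seven]; rfl)
  t_pow := Units.ext (by
    rw [Units.val_pow_eq_pow_val, val_glT, pow_succ, sq]
    ext i j
    fin_cases i <;> fin_cases j <;> simp [matT, Matrix.mul_apply, Fin.sum_univ_succ])
  r_sq := Units.ext matR_mul_self
  s_mul_t := Units.ext (by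
    rw [Units.val_mul, Units.val_mul, Units.val_pow_eq_pow_val, val_glS, val_glT, matS_pow, matS_eq]
    ext i j
    rw [Matrix.diagonal_mul, Matrix.mul_diagonal]
    fin_cases i <;> fin_cases j <;> simp [matT] <;>
      first | ring1 | linear_combination (-ζ) * ζ_pow)
  r_mul_t := Units.ext (by
    rw [Units.val_mul, Units.val_mul, Units.val_pow_eq_pow_val, val_glR, val_glT, matR_eq, sq]
    ext i j
    fin_cases i <;> fin_cases j <;> simp [matT, Matrix.mul_apply, Fin.sum_univ_succ])
  rs_pow := Units.ext (by
    rw [Units.val_pow_eq_pow_val, Units.val_mul, val_glR, val_glS, pow_succ, sq, ← mul_assoc,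
      ← mul_assoc, matR_mul_matS_mul_matR]
    have h1 : matS ^ 6 * matR * matS ^ 6 * matS * matR * matS =
        matS ^ 6 * (matR * (matS ^ 6 * matS) * matR) * matS := by
      simp only [mul_assoc]
    rw [h1, ← pow_succ, matS_pow_seven, mul_one, matR_mul_self, mul_one, ← pow_succ,
      matS_pow_seven]
    rfl)

theorem groupP_eq : groupP = Subgroup.closure {Matrix.ProjGenLinGroup.mk glS,
    Matrix.ProjGenLinGroup.mk glT, Matrix.ProjGenLinGroup.mk glR} := by
  unfold groupP generatedBy
  congr 1
  ext g
  simp only [Set.mem_ofPred_eq, Set.mem_insert_iff, Set.mem_singleton_iff]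
  constructor
  · rintro ⟨A, hA | hA | hA, rfl⟩
    · exact Or.inl (congrArg _ (Units.ext hA))
    · exact Or.inr (Or.inl (congrArg _ (Units.ext hA)))
    · exact Or.inr (Or.inr (congrArg _ (Units.ext hA)))
  · rintro (rfl | rfl | rfl)
    exacts [⟨glS, Or.inl rfl, rfl⟩, ⟨glT, Or.inr (Or.inl rfl), rfl⟩,
      ⟨glR, Or.inr (Or.inr rfl), rfl⟩]

/-! ### Lifts fixing a vector -/

/-- The invertible matrices which fix the vector `e`. -/
def fixingSubgroup (e : Fin 4 → ℂ) : Subgroup (GL (Fin 4) ℂ) where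
  carrier := {A | (A : M4).mulVec e = e}
  one_mem' := by simp
  mul_mem' := by
    intro A B hA hB
    change ((A * B : GL (Fin 4) ℂ) : M4).mulVec e = e
    rw [Units.val_mul, ← Matrix.mulVec_mulVec, hB, hA]
  inv_mem' := fun hA => inv_mulVec_eq hA

/-- The projection of the matrices fixing `e` to projectivities. -/
def fixingToPGL (e : Fin 4 → ℂ) : fixingSubgroup e →* PGL(4, ℂ) :=
  Matrix.ProjGenLinGroup.mk.comp (fixingSubgroup e).subtype

/-- Lifts normalised to fix `e` are unique, so relations between projectivities become exact
relations between these lifts. -/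
theorem fixingToPGL_injective {e : Fin 4 → ℂ} (he : e ≠ 0) :
    Function.Injective (fixingToPGL e) := fun A B h =>
  Subtype.ext (eq_of_mk_eq_of_mulVec_eq he A.2 B.2 h)

theorem isPrimitiveRoot_of_pow_seven {l : ℂ} (h7 : l ^ 7 = 1) (h1 : l ≠ 1) :
    IsPrimitiveRoot l 7 := by
  have h3 := orderOf_eq_prime (p := 7) (by simpa using h7) h1
  have := IsPrimitiveRoot.orderOf l
  rwa [h3] at this

/-- If `S T = T S²`, then `T` maps eigenvectors of `S` to eigenvectors for the squared
eigenvalue. -/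
theorem mulVec_of_mul_eq_mul_sq {S T : GL (Fin 4) ℂ} (h : S * T = T * S ^ 2) {l : ℂ}
    {v : Fin 4 → ℂ} (hv : (S : M4).mulVec v = l • v) :
    (S : M4).mulVec ((T : M4).mulVec v) = l ^ 2 • (T : M4).mulVec v := by
  rw [Matrix.mulVec_mulVec, ← Units.val_mul, h, Units.val_mul, ← Matrix.mulVec_mulVec,
    Units.val_pow_eq_pow_val, pow_mulVec_eq hv, Matrix.mulVec_smul]

/-- A matrix of order seven fixing one of two complementary subspaces pointwise has an eigenvector
with non-trivial eigenvalue in the other one. -/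
theorem exists_eigenvector_of_order_seven {S : GL (Fin 4) ℂ} (h7 : S ^ 7 = 1) (h1 : S ≠ 1)
    {V W : Submodule ℂ (Fin 4 → ℂ)} (hVW : IsCompl V W) (hV : ∀ v ∈ V, (S : M4).mulVec v = v)
    (hW : Preserves S W) : ∃ l : ℂ, IsPrimitiveRoot l 7 ∧ ∃ w ∈ W, w ≠ 0 ∧
      (S : M4).mulVec w = l • w := by
  obtain ⟨w, hw, hne⟩ : ∃ w ∈ W, (S : M4).mulVec w ≠ w := by
    by_contra! h
    apply h1
    apply Units.ext
    refine Matrix.ext_of_mulVec_single fun i => ?_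
    obtain ⟨a, ha, b, hb, hab⟩ := Submodule.mem_sup.mp
      (hVW.sup_eq_top ▸ Submodule.mem_top : Pi.single i 1 ∈ V ⊔ W)
    rw [← hab, Matrix.mulVec_add, hV a ha, h b hb]
    simp
  obtain ⟨l, hl1, hl7, w', hw', hw0, hw'l⟩ := exists_eigenvector_ne_one hW (m := 7) (by norm_num)
    (by rw [← Units.val_pow_eq_pow_val, h7]; rfl) hw hne
  exact ⟨l, isPrimitiveRoot_of_pow_seven hl7 hl1, w', hw', hw0, hw'l⟩

/-- A Klein triple preserving two complementary planes does not fix a smooth quartic. -/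
theorem false_of_klein_of_planes {f : MvPolynomial (Fin 4) ℂ} (hf : f.IsHomogeneous 4)
    (hs : IsNonsingular f) {G : Subgroup PGL(4, ℂ)} (hG : IsInvariantUnder G (surfaceOf f))
    {s t r : PGL(4, ℂ)} (h : IsKleinTriple s t r) (hs1 : s ≠ 1) (htG : t ∈ G) (hrG : r ∈ G)
    {V W : Submodule ℂ (Fin 4 → ℂ)} (hVW : IsCompl V W) (hV : Module.finrank ℂ V = 2)
    (hW : Module.finrank ℂ W = 2) (hsS : s ∈ stabilizerOf V ⊓ stabilizerOf W)
    (htS : t ∈ stabilizerOf V ⊓ stabilizerOf W) (hrS : r ∈ stabilizerOf V ⊓ stabilizerOf W) :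
    False := by
  obtain ⟨A, K, rfl, rfl, hA3, hKA⟩ := exists_real_lift (by decide) h.t_pow h.conj_t
  have hAf : pull A f = f := pull_eq_self_of_real (ne_zero_of_isNonsingular hs) (by decide) hA3 hKA
    (exists_pull_eq_smul hf hs hG htG) (exists_pull_eq_smul hf hs hG hrG)
  have main {U U' : Submodule ℂ (Fin 4 → ℂ)} (hUU : IsCompl U U') (hU : Module.finrank ℂ U = 2)
      (hU' : Module.finrank ℂ U' = 2) (hsU : s ∈ stabilizerOf U) (hsU' : s ∈ stabilizerOf U')
      (htU' : Matrix.ProjGenLinGroup.mk A ∈ stabilizerOf U')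
      (hAU : ∀ u ∈ U, (A : M4).mulVec u = u) : False := by
    obtain ⟨e, heU, he0⟩ := Submodule.exists_mem_ne_zero_of_ne_bot
      (p := U) (by rintro rfl; simp at hU)
    -- On `U` the lift `A` of `t` is the identity, so the relation `s t = t s²` reads `C² u = c C
    -- u`. Hence `s` acts on `U` as a scalar.
    have hscal {C : GL (Fin 4) ℂ} (hC : Matrix.ProjGenLinGroup.mk C = s) :
        ∃ c : ℂ, ∀ u ∈ U, (C : M4).mulVec u = c • u := by
      have hCU : Preserves C U := preserves_of_mem_stabilizerOf (by rwa [hC])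
      obtain ⟨c, -, hc⟩ := exists_smul_of_mk_eq (A := C * A) (B := A * C ^ 2) (by
        rw [map_mul, map_mul, map_pow, hC, h.s_mul_t])
      refine ⟨c, fun u hu => ?_⟩
      have h1 := congrArg (fun M => Matrix.mulVec M u) hc
      simp only [Units.val_mul, Matrix.smul_mulVec,
        ← Matrix.mulVec_mulVec, sq] at h1
      rw [hAU u hu, hAU _ (hCU _ (hCU u hu)), ← Matrix.mulVec_smul] at h1
      have h2 := congrArg ((↑(C⁻¹) : M4).mulVec) h1
      rwa [inv_mulVec_eq rfl, inv_mulVec_eq rfl] at h2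
    obtain ⟨C, hC⟩ := Matrix.ProjGenLinGroup.mk_surjective s
    obtain ⟨c, hc⟩ := hscal hC
    obtain ⟨B, hBC, hBe⟩ := exists_lift_mulVec_eq he0 (hc e heU)
    have hB := hBC.trans hC
    obtain ⟨b, hb⟩ := hscal hB
    have hb1 : b = 1 := by
      have h1 : (b - 1) • e = 0 := by rw [sub_smul, ← hb e heU, hBe, one_smul, sub_self]
      exact sub_eq_zero.mp ((smul_eq_zero.mp h1).resolve_right he0)
    have hBU : ∀ u ∈ U, (B : M4).mulVec u = u := fun u hu => by rw [hb u hu, hb1, one_smul]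
    have hAe := hAU e heU
    have hB7 : B ^ 7 = 1 := congrArg Subtype.val (fixingToPGL_injective he0
      (a₁ := (⟨B, hBe⟩ : fixingSubgroup e) ^ 7) (a₂ := 1) (by
        rw [map_pow, map_one]
        exact (congrArg (· ^ 7) hB).trans h.s_pow))
    have hBA : B * A = A * B ^ 2 := congrArg Subtype.val (fixingToPGL_injective he0
      (a₁ := (⟨B, hBe⟩ : fixingSubgroup e) * ⟨A, hAe⟩)
      (a₂ := (⟨A, hAe⟩ : fixingSubgroup e) * ⟨B, hBe⟩ ^ 2) (by
        rw [map_mul, map_mul, map_pow]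
        change Matrix.ProjGenLinGroup.mk B * Matrix.ProjGenLinGroup.mk A =
          Matrix.ProjGenLinGroup.mk A * Matrix.ProjGenLinGroup.mk B ^ 2
        rw [hB, h.s_mul_t]))
    have hB1 : B ≠ 1 := fun h1 => hs1 (by rw [← hB, h1, map_one])
    have hAU' : Preserves A U' := preserves_of_mem_stabilizerOf htU'
    obtain ⟨l, hl, w, hwU, hw0, hw⟩ := exists_eigenvector_of_order_seven hB7 hB1 hUU hBU
      (preserves_of_mem_stabilizerOf (by rwa [hB]))
    have hw2 := mulVec_of_mul_eq_mul_sq hBA hw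
    have hw4 := mulVec_of_mul_eq_mul_sq hBA hw2
    -- With `B` trivial on `U`, applying `A` to an eigenvector in `U'` squares its eigenvalue. The
    -- distinct values `l`, `l²`, `l⁴` do not fit on a plane.
    have key : ∀ i : Fin 3, ∃ w ∈ U', w ≠ 0 ∧ (B : M4).mulVec w = l ^ (2 ^ (i : ℕ)) • w := by
      intro i
      fin_cases i
      · exact ⟨w, hwU, hw0, by simpa using hw⟩
      · exact ⟨_, hAU' _ hwU, mulVec_ne_zero A hw0, by simpa using hw2⟩
      · refine ⟨_, hAU' _ (hAU' _ hwU), mulVec_ne_zero A (mulVec_ne_zero A hw0), ?_⟩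
        rw [hw4, ← pow_mul]
        rfl
    choose ws hwsV hws0 hws using key
    have := card_le_finrank_of_eigenvectors (U := U') (l := fun i : Fin 3 => l ^ (2 ^ (i : ℕ)))
      (fun i j hij => by
        have := hl.pow_inj (by fin_cases i <;> simp) (by fin_cases j <;> simp) hij
        exact Fin.ext (Nat.pow_right_injective le_rfl this)) hwsV hws0 hws
    omega
  have pres {U : Submodule ℂ (Fin 4 → ℂ)} {B : GL (Fin 4) ℂ}
      (hB : Matrix.ProjGenLinGroup.mk B ∈ stabilizerOf U) : Preserves B U :=
    preserves_of_mem_stabilizerOf hB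
  rcases fixed_summand_of_order_three hf hs hAf hA3 hKA hVW hV hW (pres htS.1) (pres htS.2)
    (pres hrS.1) (pres hrS.2) with hfix | hfix
  · exact main hVW hV hW hsS.1 hsS.2 htS.2 hfix
  · exact main hVW.symm hW hV hsS.2 hsS.1 htS.1 hfix

/-! ### The normal form of a Klein triple preserving a line and a complementary space -/

theorem ζ_isPrimitiveRoot : IsPrimitiveRoot ζ 7 := isPrimitiveRoot_of_pow_seven ζ_pow ζ_ne_one

theorem val_inv_glS : ((glS⁻¹ : GL (Fin 4) ℂ) : M4) = matS ^ 6 := by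
  rw [isKleinTriple_gl.s_inv, Units.val_pow_eq_pow_val, val_glS]

/-- The entries of a matrix which satisfies the same linear relations as `matR`. -/
theorem eq_smul_gauss {x y z : ℂ} (h1 : x * ζ ^ 4 + z * ζ ^ 2 + y * ζ = 0)
    (h2 : x * ζ ^ 3 + z * ζ ^ 5 + y * ζ ^ 6 = 0) :
    ∃ k : ℂ, x = k * (cR * uMinus) ∧ y = k * (cR * sMinus) ∧ z = k * (cR * tMinus) := by
  have hz : ζ ≠ 0 := ζ_isPrimitiveRoot.ne_zero (by norm_num)
  have hu : uMinus ≠ 0 := by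
    intro h
    have h3 : ζ ^ 1 = ζ ^ 6 := by
      rw [pow_one]
      exact sub_eq_zero.mp h
    exact absurd (ζ_isPrimitiveRoot.pow_inj (by norm_num) (by norm_num) h3) (by norm_num)
  have hc : cR ≠ 0 := by
    intro h
    have := cR_mul_norm
    rw [h] at this
    norm_num at this
  have h5 : ζ ^ 5 - 1 ≠ 0 := fun h => by
    have h3 : ζ ^ 5 = ζ ^ 0 := by
      rw [pow_zero]
      exact sub_eq_zero.mp h
    exact absurd (ζ_isPrimitiveRoot.pow_inj (by norm_num) (by norm_num) h3) (by norm_num)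
  have hy : y = -(x * ζ ^ 3 + z * ζ) := by
    have h3 : ζ * (y + (x * ζ ^ 3 + z * ζ)) = 0 := by linear_combination h1
    exact eq_neg_of_add_eq_zero_left ((mul_eq_zero.mp h3).resolve_left hz)
  -- Eliminating `y` from the two equations fixes the ratio of `x` to `z`, which is that of `uMinus`
  -- to `tMinus`.
  have hxz : x * (ζ ^ 3 - ζ ^ 2) + z * (ζ ^ 5 - 1) = 0 := by
    rw [hy] at h2
    linear_combination h2 + (x * ζ ^ 2 + z) * ζ_pow
  have ht : x * tMinus = z * uMinus := by
    have h3 : (ζ ^ 5 - 1) * (x * tMinus - z * uMinus) = 0 := by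
      unfold uMinus tMinus
      linear_combination (-(ζ - ζ ^ 6)) * hxz
    exact sub_eq_zero.mp ((mul_eq_zero.mp h3).resolve_left h5)
  refine ⟨x / (cR * uMinus), ?_, ?_, ?_⟩
  · field_simp
  · field_simp
    have h3 : sMinus = -(uMinus * ζ ^ 3 + tMinus * ζ) := by
      unfold uMinus tMinus sMinus
      linear_combination (-ζ ^ 2) * ζ_pow
    rw [h3, hy]
    linear_combination ζ * ht
  · field_simp
    exact ht.symm

theorem trace_glR_mul {x y z : ℂ} (d : Fin 4 → ℂ) :
    Matrix.trace (!![1, 0, 0, 0; 0, x, y, z; 0, y, z, x; 0, z, x, y] * Matrix.diagonal d) =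
      d 0 + x * d 1 + z * d 2 + y * d 3 := by
  simp only [Matrix.trace, Matrix.diag_apply, Matrix.mul_diagonal, Fin.sum_univ_four]
  simp

/-- A matrix which extends `matS`, `matT` to a Klein triple is `matR`. -/
theorem eq_matR {R : GL (Fin 4) ℂ} (h : IsKleinTriple glS glT R) (h00 : (R : M4) 0 0 = 1)
    (hi0 : ∀ i, i ≠ 0 → (R : M4) i 0 = 0) (h0i : ∀ i, i ≠ 0 → (R : M4) 0 i = 0)
    (htr : ((R * glS : GL (Fin 4) ℂ) : M4).trace = 1)
    (htr' : ((R * glS⁻¹ : GL (Fin 4) ℂ) : M4).trace = 1) : R = glR := by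
  have hT2 : ((glT ^ 2 : GL (Fin 4) ℂ) : M4) =
      !![1, 0, 0, 0; 0, 0, 0, 1; 0, 1, 0, 0; 0, 0, 1, 0] := by
    rw [Units.val_pow_eq_pow_val, val_glT, sq]
    ext i j
    fin_cases i <;> fin_cases j <;> simp [matT, Matrix.mul_apply, Fin.sum_univ_succ]
  have hRT : (R : M4) * matT = !![1, 0, 0, 0; 0, 0, 0, 1; 0, 1, 0, 0; 0, 0, 1, 0] * (R : M4) := by
    have := congrArg Units.val h.r_mul_t
    rwa [Units.val_mul, Units.val_mul, hT2] at this
  have ent (i j : Fin 4) := congrFun (congrFun hRT i) j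
  have e11 := ent 1 1
  have e12 := ent 1 2
  have e13 := ent 1 3
  have e21 := ent 2 1
  have e22 := ent 2 2
  have e23 := ent 2 3
  simp [matT, Matrix.mul_apply, Fin.sum_univ_succ] at e11 e12 e13 e21 e22 e23
  -- The relation `R T = T² R` forces the lower block to be constant along cyclic anti-diagonals,
  -- leaving three unknown entries, for which the two traces give two linear equations.
  have hform : (R : M4) = !![1, 0, 0, 0;
      0, (R : M4) 1 1, (R : M4) 1 2, (R : M4) 1 3;
      0, (R : M4) 1 2, (R : M4) 1 3, (R : M4) 1 1;
      0, (R : M4) 1 3, (R : M4) 1 1, (R : M4) 1 2] := by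
    ext i j
    fin_cases i <;> fin_cases j <;>
      simp [h00, hi0, h0i, e11, e12, e13, e21, e22, e23]
  rw [Units.val_mul, hform, val_glS, matS_eq, trace_glR_mul] at htr
  rw [Units.val_mul, hform, val_inv_glS, matS_pow, trace_glR_mul] at htr'
  simp at htr htr'
  obtain ⟨k, hx, hy, hz⟩ := eq_smul_gauss (x := (R : M4) 1 1) (y := (R : M4) 1 2)
    (z := (R : M4) 1 3) (by linear_combination htr)
    (by linear_combination htr' - ((R : M4) 1 1 * (ζ ^ 17 + ζ ^ 10 + ζ ^ 3) +
      (R : M4) 1 3 * ζ ^ 5) * ζ_pow)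
  have hR : (R : M4) = Matrix.diagonal ![1, k, k, k] * matR := by
    rw [hform, hx, hy, hz, matR_eq]
    ext i j
    rw [Matrix.diagonal_mul]
    fin_cases i <;> fin_cases j <;> simp
  have hcomm : Commute (Matrix.diagonal ![1, k, k, k]) matR := by
    rw [matR_eq]
    ext i j
    rw [Matrix.diagonal_mul, Matrix.mul_diagonal]
    fin_cases i <;> fin_cases j <;> simp <;> ring
  have hcommS : Commute (Matrix.diagonal ![1, k, k, k]) matS := by
    rw [matS_eq, commute_iff_eq, Matrix.diagonal_mul_diagonal, Matrix.diagonal_mul_diagonal]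
    congr 1
    ext i
    ring
  -- The remaining scalar `k` on the three-space commutes with `matR` and `matS`, so `r² = 1` and
  -- `(r s)³ = 1` give `k² = k³ = 1`.
  have h2 : k ^ 2 = 1 := by
    have h3 := congrArg Units.val h.r_sq
    rw [Units.val_mul, hR, ← sq, hcomm.mul_pow, sq matR, matR_mul_self, mul_one,
      Matrix.diagonal_pow] at h3
    simpa using congrFun (congrFun h3 1) 1
  have h3 : k ^ 3 = 1 := by
    have h4 := congrArg Units.val h.rs_pow
    have h5 := congrArg Units.val isKleinTriple_gl.rs_pow
    rw [Units.val_pow_eq_pow_val, Units.val_mul, val_glR, val_glS] at h5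
    rw [Units.val_pow_eq_pow_val, Units.val_mul, hR, val_glS, mul_assoc,
      (hcomm.mul_right hcommS).mul_pow, h5, Units.val_one, mul_one, Matrix.diagonal_pow] at h4
    simpa using congrFun (congrFun h4 1) 1
  have hk : k = 1 := by
    rw [pow_succ, h2, one_mul] at h3
    exact h3
  apply Units.ext
  rw [hR, hk, val_glR]
  have : Matrix.diagonal ![(1 : ℂ), 1, 1, 1] = 1 := by
    ext i j
    fin_cases i <;> fin_cases j <;> simp
  rw [this, one_mul]

/-- The vectors `e`, `v`, `T² v`, `T v` form an eigenbasis of `S` in which `S` and `T` become `matS`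
and `matT`; then `eq_matR` identifies `R`. -/
theorem exists_conj_of_eigenvector {S T R : GL (Fin 4) ℂ} (h : IsKleinTriple S T R)
    {e : Fin 4 → ℂ} (he : e ≠ 0) (hSe : (S : M4).mulVec e = e) (hTe : (T : M4).mulVec e = e)
    (hRe : (R : M4).mulVec e = e) {V W : Submodule ℂ (Fin 4 → ℂ)} (hVW : Disjoint V W)
    (heV : e ∈ V) (hTW : Preserves T W) (hRW : Preserves R W)
    (htr : ((R * S : GL (Fin 4) ℂ) : M4).trace = (T : M4).trace)
    (htr' : ((R * S⁻¹ : GL (Fin 4) ℂ) : M4).trace = (T : M4).trace) {v : Fin 4 → ℂ}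
    (hv : v ∈ W) (hv0 : v ≠ 0) (hSv : (S : M4).mulVec v = ζ ^ 4 • v) :
    ∃ B : GL (Fin 4) ℂ, S = B * glS * B⁻¹ ∧ T = B * glT * B⁻¹ ∧ R = B * glR * B⁻¹ := by
  set v₃ := (T : M4).mulVec v with hv₃
  set v₂ := (T : M4).mulVec v₃ with hv₂
  have hS3 : (S : M4).mulVec v₃ = ζ • v₃ := by
    rw [hv₃, mulVec_of_mul_eq_mul_sq h.s_mul_t hSv]
    congr 1
    linear_combination ζ * ζ_pow
  have hS2 : (S : M4).mulVec v₂ = ζ ^ 2 • v₂ := mulVec_of_mul_eq_mul_sq h.s_mul_t hS3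
  have hT2 : (T : M4).mulVec v₂ = v := by
    have h3 : (T : M4) * (T : M4) * (T : M4) = 1 := by
      rw [← sq, ← pow_succ, ← Units.val_pow_eq_pow_val, h.t_pow]
      rfl
    rw [hv₂, hv₃, Matrix.mulVec_mulVec, Matrix.mulVec_mulVec, h3, Matrix.one_mulVec]
  have hv3W : v₃ ∈ W := hTW v hv
  have hv2W : v₂ ∈ W := hTW _ hv3W
  let b : Fin 4 → Fin 4 → ℂ := ![e, v, v₂, v₃]
  let l : Fin 4 → ℂ := ![1, ζ ^ 4, ζ ^ 2, ζ]
  have hl : l = fun i => ζ ^ (![0, 4, 2, 1] i : ℕ) := by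
    ext i
    fin_cases i <;> simp [l]
  have hlinj : Function.Injective l := by
    rw [hl]
    intro i j hij
    have h1 := ζ_isPrimitiveRoot.pow_inj (by fin_cases i <;> simp) (by fin_cases j <;> simp) hij
    revert h1
    fin_cases i <;> fin_cases j <;> simp
  have hSb : ∀ i, (S : M4).mulVec (b i) = l i • b i := by
    intro i
    fin_cases i
    · simpa [b, l] using hSe
    · exact hSv
    · exact hS2
    · exact hS3
  have hb0 : ∀ i, b i ≠ 0 := by
    intro i
    fin_cases i
    · exact he
    · exact hv0
    · exact mulVec_ne_zero T (mulVec_ne_zero T hv0)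
    · exact mulVec_ne_zero T hv0
  have hli : LinearIndependent ℂ b :=
    Module.End.eigenvectors_linearIndependent' (Matrix.toLin' (S : M4)) l hlinj b fun i =>
      Module.End.hasEigenvector_iff.mpr ⟨Module.End.mem_eigenspace_iff.mpr (by simpa using hSb i),
        hb0 i⟩
  let Bm : M4 := (Matrix.of b).transpose
  have hBunit : IsUnit Bm := Matrix.linearIndependent_cols_iff_isUnit.mp hli
  obtain ⟨B, hB⟩ := hBunit
  have hBcol (i : Fin 4) : (B : M4).mulVec (Pi.single i 1) = b i := by
    rw [hB, Matrix.mulVec_single_one]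
    rfl
  have hBS : S * B = B * glS := by
    apply Units.ext
    refine Matrix.ext_of_mulVec_single fun i => ?_
    rw [Units.val_mul, Units.val_mul, ← Matrix.mulVec_mulVec, ← Matrix.mulVec_mulVec, hBcol, hSb,
      val_glS, matS_eq, Matrix.diagonal_mulVec_single, mul_one]
    have : (Pi.single i (l i) : Fin 4 → ℂ) = l i • Pi.single i 1 := by
      rw [← Pi.single_smul, smul_eq_mul, mul_one]
    change _ = (B : M4).mulVec (Pi.single i (l i))
    rw [this, Matrix.mulVec_smul, hBcol]
  have hBT : T * B = B * glT := by
    apply Units.ext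
    refine Matrix.ext_of_mulVec_single fun i => ?_
    rw [Units.val_mul, Units.val_mul, ← Matrix.mulVec_mulVec, ← Matrix.mulVec_mulVec, hBcol,
      val_glT]
    have hT (j : Fin 4) (hj : matT.mulVec (Pi.single i 1) = Pi.single j 1)
        (hb : (T : M4).mulVec (b i) = b j) :
        (T : M4).mulVec (b i) = (B : M4).mulVec (matT.mulVec (Pi.single i 1)) := by
      rw [hj, hBcol, hb]
    fin_cases i
    · refine hT 0 ?_ hTe
      ext j
      fin_cases j <;> simp [matT]
    · refine hT 3 ?_ rfl
      ext j
      fin_cases j <;> simp [matT]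
    · refine hT 1 ?_ hT2
      ext j
      fin_cases j <;> simp [matT]
    · refine hT 2 ?_ rfl
      ext j
      fin_cases j <;> simp [matT]
  have hS' : B⁻¹ * S * B = glS := by rw [mul_assoc, hBS, inv_mul_cancel_left]
  have hT' : B⁻¹ * T * B = glT := by rw [mul_assoc, hBT, inv_mul_cancel_left]
  set R' := B⁻¹ * R * B with hR'
  have hK : IsKleinTriple glS glT R' := by
    have := h.map (MulAut.conj B⁻¹).toMonoidHom
    simp only [MulEquiv.toMonoidHom_eq_coe, MonoidHom.coe_coe, MulAut.conj_apply, inv_inv] at this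
    rwa [hS', hT'] at this
  have trace_conj (A : GL (Fin 4) ℂ) : ((B⁻¹ * A * B : GL (Fin 4) ℂ) : M4).trace =
      (A : M4).trace := by
    rw [Units.val_mul, Matrix.trace_mul_comm, ← Units.val_mul, mul_inv_cancel_left]
  have htrT : (T : M4).trace = 1 := by
    rw [← trace_conj, hT', val_glT]
    simp [Matrix.trace, Fin.sum_univ_four, matT]
  have hcol0 : (R' : M4).mulVec (Pi.single 0 1) = Pi.single 0 1 := by
    rw [hR', Units.val_mul, Units.val_mul, ← Matrix.mulVec_mulVec, ← Matrix.mulVec_mulVec, hBcol]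
    change (↑(B⁻¹) : M4).mulVec ((R : M4).mulVec e) = _
    rw [hRe]
    exact inv_mulVec_eq (hBcol 0)
  rw [Matrix.mulVec_single_one] at hcol0
  -- The last three basis vectors lie in `W` and `e` does not, so the coordinate along `e` vanishes
  -- on `W`. This gives the zeros in the first row of `R'`.
  have hcoord {w : Fin 4 → ℂ} (hw : w ∈ W) : (↑(B⁻¹) : M4).mulVec w 0 = 0 := by
    set c := (↑(B⁻¹) : M4).mulVec w with hc
    have h1 : (B : M4).mulVec c = w := mulVec_inv_mulVec B w
    have h2 : (B : M4).mulVec c = ∑ i, c i • b i := by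
      have h3 : c = ∑ i, c i • (Pi.single i 1 : Fin 4 → ℂ) := by
        simpa using (pi_eq_sum_univ' c)
      conv_lhs => rw [h3]
      simp only [Matrix.mulVec_sum, Matrix.mulVec_smul, hBcol]
    rw [Fin.sum_univ_four] at h2
    have h4 : c 0 • e = w - (c 1 • v + c 2 • v₂ + c 3 • v₃) := by
      rw [← h1, h2]
      simp only [b, Matrix.cons_val_zero, Matrix.cons_val_one, Matrix.cons_val]
      abel
    have h5 : c 0 • e ∈ W := by
      rw [h4]
      exact W.sub_mem hw (W.add_mem (W.add_mem (W.smul_mem _ hv) (W.smul_mem _ hv2W))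
        (W.smul_mem _ hv3W))
    exact (smul_eq_zero.mp (Submodule.disjoint_def.mp hVW _ (V.smul_mem _ heV) h5)).resolve_right he
  have hbW : ∀ i, i ≠ 0 → b i ∈ W := by
    intro i hi
    fin_cases i
    exacts [absurd rfl hi, hv, hv2W, hv3W]
  have hrow : ∀ i, i ≠ 0 → (R' : M4) 0 i = 0 := by
    intro i hi
    have h1 : (R' : M4).mulVec (Pi.single i 1) 0 = 0 := by
      rw [hR', Units.val_mul, Units.val_mul, ← Matrix.mulVec_mulVec, ← Matrix.mulVec_mulVec, hBcol]
      exact hcoord (hRW _ (hbW i hi))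
    rwa [Matrix.mulVec_single_one] at h1
  have hRR : R' = glR := by
    refine eq_matR hK ?_ ?_ hrow ?_ ?_
    · simpa using congrFun hcol0 0
    · intro i hi
      simpa [hi] using congrFun hcol0 i
    · have h1 : R' * glS = B⁻¹ * (R * S) * B := by
        rw [hR', ← hS']
        group
      rw [h1, trace_conj, htr, htrT]
    · have h1 : R' * glS⁻¹ = B⁻¹ * (R * S⁻¹) * B := by
        rw [hR', ← hS']
        group
      rw [h1, trace_conj, htr', htrT]
  refine ⟨B, by rw [← hBS, mul_inv_cancel_right], by rw [← hBT, mul_inv_cancel_right], ?_⟩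
  rw [← hRR, hR']
  group

theorem areConjugate_of_conj {s t r : PGL(4, ℂ)} {S T R B : GL (Fin 4) ℂ}
    (hS : Matrix.ProjGenLinGroup.mk S = s) (hT : Matrix.ProjGenLinGroup.mk T = t)
    (hR : Matrix.ProjGenLinGroup.mk R = r) (h1 : S = B * glS * B⁻¹) (h2 : T = B * glT * B⁻¹)
    (h3 : R = B * glR * B⁻¹) : AreConjugate (Subgroup.closure {s, t, r}) groupP := by
  refine ⟨Matrix.ProjGenLinGroup.mk B, ?_⟩
  rw [groupP_eq, MonoidHom.map_closure, Set.image_insert_eq, Set.image_insert_eq,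
    Set.image_singleton, ← hS, ← hT, ← hR, h1, h2, h3]
  simp only [map_mul, map_inv, MulEquiv.toMonoidHom_eq_coe, MonoidHom.coe_coe, MulAut.conj_apply]

/-- A Klein triple preserving a line and a complementary space generates a conjugate of `(P)`. -/
theorem areConjugate_of_klein_of_line {s t r : PGL(4, ℂ)} (h : IsKleinTriple s t r) (hs1 : s ≠ 1)
    {V W : Submodule ℂ (Fin 4 → ℂ)} (hVW : IsCompl V W) (hV : Module.finrank ℂ V = 1)
    (hstab : Subgroup.closure {s, t, r} ≤ stabilizerOf V ⊓ stabilizerOf W)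
    (hk : ∃ k ∈ Subgroup.closure {s, t, r}, k * t = r * s * k)
    (hk' : ∃ k ∈ Subgroup.closure {s, t, r}, k * t = r * s⁻¹ * k) :
    AreConjugate (Subgroup.closure {s, t, r}) groupP := by
  obtain ⟨⟨e, heV⟩, he0', he⟩ := finrank_eq_one_iff'.mp hV
  have he0 : e ≠ 0 := fun h0 => he0' (Subtype.ext h0)
  have hlift {x : PGL(4, ℂ)} (hx : x ∈ Subgroup.closure {s, t, r}) :
      ∃ A : fixingSubgroup e, fixingToPGL e A = x := by
    obtain ⟨A, rfl⟩ := Matrix.ProjGenLinGroup.mk_surjective x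
    obtain ⟨a, ha⟩ := he ⟨_, preserves_of_mem_stabilizerOf (hstab hx).1 e heV⟩
    obtain ⟨B, hB, hBe⟩ := exists_lift_mulVec_eq (A := A) he0 (congrArg Subtype.val ha).symm
    exact ⟨⟨B, hBe⟩, hB⟩
  have hinj := fixingToPGL_injective he0
  obtain ⟨S, hS⟩ := hlift (x := s) (Subgroup.subset_closure (by simp))
  obtain ⟨T, hT⟩ := hlift (x := t) (Subgroup.subset_closure (by simp))
  obtain ⟨R, hR⟩ := hlift (x := r) (Subgroup.subset_closure (by simp))
  obtain ⟨k, hkmem, hk⟩ := hk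
  obtain ⟨k', hkmem', hk'⟩ := hk'
  obtain ⟨K, hK⟩ := hlift hkmem
  obtain ⟨K', hK'⟩ := hlift hkmem'
  have hSTR : IsKleinTriple S T R := IsKleinTriple.of_injective (fixingToPGL e) hinj
    (by rwa [hS, hT, hR])
  have hSTR' := hSTR.map (fixingSubgroup e).subtype
  simp only [Subgroup.coe_subtype] at hSTR'
  have htr0 {A B C : fixingSubgroup e} (hABC : C * A = B * C) :
      ((B : GL (Fin 4) ℂ) : M4).trace = ((A : GL (Fin 4) ℂ) : M4).trace := by
    have h1 : (B : GL (Fin 4) ℂ) = C * A * (C : GL (Fin 4) ℂ)⁻¹ := by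
      rw [← Subgroup.coe_mul, hABC, Subgroup.coe_mul, mul_inv_cancel_right]
    rw [h1, Units.val_mul, Matrix.trace_mul_comm, ← Units.val_mul, inv_mul_cancel_left]
  have htr := htr0 (A := T) (B := R * S) (C := K) (hinj (by
    rw [map_mul, map_mul, map_mul, hK, hT, hR, hS, hk]))
  have htr' := htr0 (A := T) (B := R * S⁻¹) (C := K') (hinj (by
    rw [map_mul, map_mul, map_mul, map_inv, hK', hT, hR, hS, hk']))
  have pres {x : PGL(4, ℂ)} (hx : x ∈ Subgroup.closure {s, t, r}) {A : GL (Fin 4) ℂ}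
      (hA : Matrix.ProjGenLinGroup.mk A = x) : Preserves A W :=
    preserves_of_mem_stabilizerOf (by rw [hA]; exact (hstab hx).2)
  have hSW : Preserves (S : GL (Fin 4) ℂ) W := pres (x := s) (Subgroup.subset_closure (by simp)) hS
  have hTW : Preserves (T : GL (Fin 4) ℂ) W := pres (x := t) (Subgroup.subset_closure (by simp)) hT
  have hRW : Preserves (R : GL (Fin 4) ℂ) W := pres (x := r) (Subgroup.subset_closure (by simp)) hR
  have hSV : ∀ v ∈ V, ((S : GL (Fin 4) ℂ) : M4).mulVec v = v := by
    intro v hv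
    obtain ⟨a, ha⟩ := he ⟨v, hv⟩
    have ha' : a • e = v := congrArg Subtype.val ha
    rw [← ha', Matrix.mulVec_smul]
    exact congrArg _ S.2
  have hS1 : (S : GL (Fin 4) ℂ) ≠ 1 := fun h1 => hs1 (by
    rw [← hS, show S = 1 from Subtype.ext h1, map_one])
  obtain ⟨l, hl, w, hwW, hw0, hw⟩ := exists_eigenvector_of_order_seven hSTR'.s_pow hS1 hVW hSV hSW
  have reach {A : GL (Fin 4) ℂ} (hA : A * (T : GL (Fin 4) ℂ) = T * A ^ 2) {m : ℂ}
      (hm : m = ζ ∨ m = ζ ^ 2 ∨ m = ζ ^ 4) (hAm : (A : M4).mulVec w = m • w) :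
      ∃ v ∈ W, v ≠ 0 ∧ (A : M4).mulVec v = ζ ^ 4 • v := by
    have h2 := mulVec_of_mul_eq_mul_sq hA hAm
    have h4 := mulVec_of_mul_eq_mul_sq hA h2
    rcases hm with rfl | rfl | rfl
    · refine ⟨_, hTW _ (hTW w hwW), mulVec_ne_zero _ (mulVec_ne_zero _ hw0), ?_⟩
      rw [h4, ← pow_mul]
    · refine ⟨_, hTW w hwW, mulVec_ne_zero _ hw0, ?_⟩
      rw [h2, ← pow_mul]
    · exact ⟨w, hwW, hw0, hAm⟩
  obtain ⟨i, hi7, hi⟩ := ζ_isPrimitiveRoot.eq_pow_of_pow_eq_one hl.pow_eq_one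
  have hi0 : i ≠ 0 := by
    rintro rfl
    exact hl.ne_one (by norm_num) (by rw [← hi, pow_zero])
  -- The exponents `1, 2, 4` are the squares modulo 7; a non-square exponent becomes a square one on
  -- passing to the inverse of `S`, whose eigenvalue is `l⁻¹ = l⁶`.
  have hcases : (l = ζ ∨ l = ζ ^ 2 ∨ l = ζ ^ 4) ∨ (l ^ 6 = ζ ∨ l ^ 6 = ζ ^ 2 ∨ l ^ 6 = ζ ^ 4) := by
    rw [← hi]
    have hz (n : ℕ) : ζ ^ n = ζ ^ (n % 7) := pow_eq_pow_mod n ζ_pow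
    interval_cases i
    · exact absurd rfl hi0
    · left; left; rw [pow_one]
    · left; right; left; rfl
    · right; right; right; rw [← pow_mul, hz]
    · left; right; right; rfl
    · right; right; left; rw [← pow_mul, hz]
    · right; left; rw [← pow_mul, hz]; norm_num
  rcases hcases with hm | hm
  · obtain ⟨v, hv, hv0, hSv⟩ := reach hSTR'.s_mul_t hm hw
    obtain ⟨B, h1, h2, h3⟩ := exists_conj_of_eigenvector hSTR' he0 S.2 T.2 R.2 hVW.disjoint heV hTW
      hRW htr htr' hv hv0 hSv
    exact areConjugate_of_conj hS hT hR h1 h2 h3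
  · have hw6 : (((S : GL (Fin 4) ℂ)⁻¹ : GL (Fin 4) ℂ) : M4).mulVec w = l ^ 6 • w := by
      rw [hSTR'.s_inv, Units.val_pow_eq_pow_val, pow_mulVec_eq hw]
    -- The triple with `s⁻¹` in place of `s` generates the same group, and the two trace conditions
    -- exchange roles.
    obtain ⟨v, hv, hv0, hSv⟩ := reach hSTR'.inv.s_mul_t hm hw6
    obtain ⟨B, h1, h2, h3⟩ := exists_conj_of_eigenvector hSTR'.inv he0 (inv_mulVec_eq S.2) T.2 R.2
      hVW.disjoint heV hTW hRW htr' (by rw [inv_inv]; exact htr) hv hv0 hSv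
    have hSinv : Matrix.ProjGenLinGroup.mk (S : GL (Fin 4) ℂ)⁻¹ = s⁻¹ := by
      rw [map_inv]
      exact congrArg _ hS
    have hcl : Subgroup.closure {s, t, r} = Subgroup.closure {s⁻¹, t, r} := by
      apply le_antisymm <;> rw [Subgroup.closure_le] <;> rintro x (rfl | rfl | rfl)
      · rw [SetLike.mem_coe, ← inv_mem_iff]
        exact Subgroup.subset_closure (by simp)
      · exact Subgroup.subset_closure (by simp)
      · exact Subgroup.subset_closure (by simp)
      · exact inv_mem (Subgroup.subset_closure (by simp))
      · exact Subgroup.subset_closure (by simp)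
      · exact Subgroup.subset_closure (by simp)
    rw [hcl]
    exact areConjugate_of_conj hSinv hT hR h1 h2 h3

/-- A non-primitive group isomorphic to `PSL(2, 𝔽₇)` which fixes a smooth quartic surface is
conjugate to `(P)`. -/
theorem areConjugate_of_mulEquiv_psl {G : Subgroup PGL(4, ℂ)} (hG : ¬ IsPrimitiveGroup G)
    (hfix : FixesSmoothQuartic G) (φ : PSL(2, ZMod 7) ≃* G) : AreConjugate G groupP := by
  obtain ⟨_, ⟨f, hf, hs, rfl⟩, hinv⟩ := hfix
  obtain ⟨V, W, hVW, hdim, hstab⟩ := exists_isCompl_of_not_isPrimitiveGroup hG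
  let ψ : PSL(2, ZMod 7) →* PGL(4, ℂ) := G.subtype.comp φ.toMonoidHom
  have hψ : Function.Injective ψ := G.subtype_injective.comp φ.injective
  have hψG (x : PSL(2, ZMod 7)) : ψ x ∈ G := (φ x).2
  have hrange : ψ.range = G := by
    rw [MonoidHom.range_comp, MonoidHom.range_eq_top.mpr φ.surjective, ← MonoidHom.range_eq_map,
      Subgroup.range_subtype]
  have hclosure : Subgroup.closure {ψ pslS, ψ pslT, ψ pslR} = G := by
    rw [← hrange, MonoidHom.range_eq_map, ← closure_psl, MonoidHom.map_closure,
      Set.image_insert_eq, Set.image_insert_eq, Set.image_singleton]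
  have hψK : IsKleinTriple (ψ pslS) (ψ pslT) (ψ pslR) := isKleinTriple_psl.map ψ
  have hs1 : ψ pslS ≠ 1 := fun h => by
    have h1 : pslS = 1 := hψ (by rw [h, map_one])
    have h2 := psl_normal_form_ne_one 1 (by norm_num) 0 (by norm_num) (by rw [h1]; simp)
    simp at h2
  -- The generators are products of elements of order dividing seven: `r = s (r s r) s`, where `r s
  -- r` is a conjugate of `s`, then `t² = (t r t⁻¹) r`, and `t = t⁴`.
  have hle : G ≤ stabilizerOf V ⊓ stabilizerOf W := by
    set Q := (stabilizerOf V ⊓ stabilizerOf W).comap ψ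
    have hQ {x : PSL(2, ZMod 7)} (hx : x ^ 7 = 1) : x ∈ Q :=
      hstab (ψ x) (hψG x) 7 (by norm_num) (by norm_num) (by rw [← map_pow, hx, map_one])
    have hK := isKleinTriple_psl
    have hr1 : pslR = pslS * (pslR * pslS * pslR) * pslS := by
      rw [hK.rsr]
      group
    have hrsr : (pslR * pslS * pslR) ^ 7 = 1 := by
      have := conj_pow (i := 7) (a := pslR) (b := pslS)
      rw [hK.r_inv] at this
      rw [this, hK.s_pow, mul_one, hK.r_sq]
    have hconj {x : PSL(2, ZMod 7)} (hx : x ^ 7 = 1) : (pslT * x * pslT⁻¹) ^ 7 = 1 := by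
      rw [conj_pow, hx, mul_one, mul_inv_cancel]
    have hSQ : pslS ∈ Q := hQ hK.s_pow
    have hRQ : pslR ∈ Q := by
      rw [hr1]
      exact mul_mem (mul_mem hSQ (hQ hrsr)) hSQ
    have hTRT : pslT * pslR * pslT⁻¹ ∈ Q := by
      have h1 : pslT * pslR * pslT⁻¹ = (pslT * pslS * pslT⁻¹) *
          (pslT * (pslR * pslS * pslR) * pslT⁻¹) * (pslT * pslS * pslT⁻¹) := by
        conv_lhs => rw [hr1]
        group
      rw [h1]
      exact mul_mem (mul_mem (hQ (hconj hK.s_pow)) (hQ (hconj hrsr))) (hQ (hconj hK.s_pow))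
    have hT2 : pslT ^ 2 = pslT * pslR * pslT⁻¹ * pslR := by
      rw [mul_assoc, mul_assoc, sq]
      congr 1
      rw [eq_comm, ← mul_assoc, hK.t_inv, mul_assoc, ← hK.r_mul_t, ← mul_assoc, hK.r_sq, one_mul]
    have hTQ : pslT ∈ Q := by
      have h1 : pslT = pslT ^ 2 * pslT ^ 2 := by
        rw [← pow_add, show 2 + 2 = 3 + 1 by rfl, pow_succ, hK.t_pow, one_mul]
      rw [h1, hT2]
      exact mul_mem (mul_mem hTRT hRQ) (mul_mem hTRT hRQ)
    rw [← hclosure, Subgroup.closure_le]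
    rintro x (rfl | rfl | rfl)
    exacts [hSQ, hTQ, hRQ]
  rcases hdim with ⟨hV1, -⟩ | ⟨hV2, hW2⟩
  · rw [← hclosure]
    obtain ⟨k, hk⟩ := exists_conj_psl
    obtain ⟨k', hk'⟩ := exists_conj_inv_psl
    refine areConjugate_of_klein_of_line hψK hs1 hVW hV1 (by rwa [hclosure])
      ⟨ψ k, by rw [hclosure]; exact hψG k, ?_⟩ ⟨ψ k', by rw [hclosure]; exact hψG k', ?_⟩
    · simp only [← map_mul, hk]
    · simp only [← map_mul, ← map_inv, hk']
  · exact (false_of_klein_of_planes hf hs hinv hψK hs1 (hψG _) (hψG _) hVW hV2 hW2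
      (hle (hψG _)) (hle (hψG _)) (hle (hψG _))).elim

/-! ### The other groups of the list -/

theorem ω_ne_one : ω ≠ 1 :=
  (Complex.isPrimitiveRoot_exp 3 (by norm_num)).ne_one (by norm_num)

theorem ω_sum : ω ^ 2 + ω + 1 = 0 := by
  have h : (ω - 1) * (ω ^ 2 + ω + 1) = 0 := by linear_combination ω_pow
  exact (mul_eq_zero.mp h).resolve_left (sub_ne_zero.mpr ω_ne_one)

theorem ω_sq_ne_one : ω ^ 2 ≠ 1 := fun h =>
  ω_ne_one (by linear_combination ω_pow - ω * h)

theorem mk_mem_generatedBy {S : Set M4} {A : GL (Fin 4) ℂ} (hA : (A : M4) ∈ S) :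
    Matrix.ProjGenLinGroup.mk A ∈ generatedBy S :=
  Subgroup.subset_closure ⟨A, hA, rfl⟩

theorem exists_gl_eq {M : M4} (hM : M.det ≠ 0) : ∃ A : GL (Fin 4) ℂ, (A : M4) = M :=
  ⟨Matrix.GeneralLinearGroup.mkOfDetNeZero M hM, rfl⟩

/-- A group which contains `D = diag(ω, ω, ω², ω²)` and an element which inverts `D` fixes no smooth
quartic surface. -/
theorem not_fixesSmoothQuartic_of_matQ41 {S : Set M4} (hA : matQ41 ∈ S) {K : M4} (hK : K ∈ S)
    (hdet : K.det ≠ 0) (h : K * matQ41 = matQ41 ^ 2 * K) :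
    ¬ FixesSmoothQuartic (generatedBy S) := by
  rintro ⟨_, ⟨f, hf, hs, rfl⟩, hinv⟩
  obtain ⟨A, hAv⟩ := exists_gl_eq det_matQ41
  obtain ⟨B, hBv⟩ := exists_gl_eq hdet
  have hdiag : matQ41 = Matrix.diagonal ![ω, ω, ω ^ 2, ω ^ 2] := by
    ext i j
    fin_cases i <;> fin_cases j <;> simp [matQ41]
  have h3 : matQ41 ^ 3 = 1 := by
    have h2 : (ω ^ 2) ^ 3 = 1 := by linear_combination (ω ^ 3 + 1) * ω_pow
    rw [hdiag, Matrix.diagonal_pow, ← Matrix.diagonal_one]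
    congr 1
    ext i
    fin_cases i <;> simp [ω_pow, h2]
  have hA3 : A ^ 3 = 1 := Units.ext (by rw [Units.val_pow_eq_pow_val, hAv, h3, Units.val_one])
  have hinvA : A⁻¹ = A ^ 2 := inv_eq_of_mul_eq_one_left (by rw [← pow_succ, hA3])
  have hBA : B * A = A⁻¹ * B := by
    rw [hinvA]
    exact Units.ext (by rw [Units.val_mul, Units.val_mul, Units.val_pow_eq_pow_val, hAv, hBv, h])
  have hfix : pull (A : M4) f = f := pull_eq_self_of_real (ne_zero_of_isNonsingular hs)
    (by decide : Odd 3) hA3 hBA (exists_pull_eq_smul hf hs hinv (mk_mem_generatedBy (hAv ▸ hA)))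
    (exists_pull_eq_smul hf hs hinv (mk_mem_generatedBy (hBv ▸ hK)))
  rw [hAv] at hfix
  obtain ⟨e, he, hfe⟩ := exists_fixed_of_order_three hf hs hfix h3
  refine he (funext fun i => ?_)
  have hi := congrFun hfe i
  rw [hdiag, Matrix.mulVec_diagonal] at hi
  by_contra h0
  have h1 := mul_right_cancel₀ h0 (hi.trans (one_mul (e i)).symm)
  fin_cases i
  exacts [ω_ne_one h1, ω_ne_one h1, ω_sq_ne_one h1, ω_sq_ne_one h1]

theorem matQ43_mul_matQ41 : matQ43 * matQ41 = matQ41 ^ 2 * matQ43 := by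
  rw [sq]
  ext i j
  fin_cases i <;> fin_cases j <;> simp [matQ43, matQ41, Matrix.mul_apply, Fin.sum_univ_succ]
  · ring
  · ring
  · linear_combination -nuMinus * ω * ω_pow
  · linear_combination -nuMinus * ω * ω_pow

theorem matQ53_mul_matQ41 : matQ53 * matQ41 = matQ41 ^ 2 * matQ53 := by
  rw [sq]
  ext i j
  fin_cases i <;> fin_cases j <;> simp [matQ53, matQ41, Matrix.mul_apply, Fin.sum_univ_succ]
  · ring
  · ring
  · linear_combination -nuPlus * ω * ω_pow
  · linear_combination -nuMinus * ω * ω_pow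

/-! ### An element of order five in `(Q₁)` -/

theorem lamPlus_root : lamPlus ^ 2 + (1 / 2) * lamPlus + 1 = 0 := by
  have h := rt_mul_self 15
  push_cast at h
  unfold lamPlus
  linear_combination (1 / 16) * rt 15 * rt 15 * Complex.I_mul_I - (1 / 16) * h

theorem lamMinus_eq : lamMinus = -(1 / 2) - lamPlus := by
  unfold lamMinus lamPlus
  ring

/-- This is the product of the three generators of `(Q₁)`. Its square and fourth power below are
reduced modulo the quadratic equations of `ω` and `lamPlus`, so that `q1X ^ 5 = 1` can be checked in
three multiplications. -/
noncomputable def q1X : Matrix (Fin 4) (Fin 4) ℂ :=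
  !![1, 0, 0, 0;
    0, (1 / 3), (-1 / 3) + (-2 / 3) * lamPlus, (2 / 3) * lamPlus;
    0, (-2 / 3) * ω, (-1 / 3) * ω + (-2 / 3) * ω * lamPlus, (-1 / 3) * ω * lamPlus;
    0, (2 / 3) + (2 / 3) * ω, (-1 / 6) + (-1 / 3) * lamPlus + (-1 / 6) * ω +
        (-1 / 3) * ω * lamPlus, (-2 / 3) * lamPlus + (-2 / 3) * ω * lamPlus]

noncomputable def q1X2 : Matrix (Fin 4) (Fin 4) ℂ :=
  !![1, 0, 0, 0;
    0, (1 / 9) + (4 / 9) * lamPlus + (2 / 9) * ω + (8 / 9) * ω * lamPlus, (1 / 9) +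
        (-2 / 9) * lamPlus + (-1 / 9) * ω + (2 / 9) * ω * lamPlus, (4 / 9) + (4 / 9) * lamPlus +
        (2 / 9) * ω + (2 / 9) * ω * lamPlus;
    0, (-2 / 9) + (-2 / 9) * lamPlus + (-4 / 9) * ω + (-4 / 9) * ω * lamPlus, (4 / 9) +
        (-2 / 9) * lamPlus + (5 / 9) * ω + (2 / 9) * ω * lamPlus, (4 / 9) + (1 / 9) * lamPlus +
        (2 / 9) * ω + (-4 / 9) * ω * lamPlus;
    0, (1 / 9) + (-2 / 9) * lamPlus + (2 / 9) * ω + (-4 / 9) * ω * lamPlus, (-1 / 18) +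
        (-5 / 9) * lamPlus + (-4 / 9) * ω + (-4 / 9) * ω * lamPlus, (1 / 9) + (4 / 9) * lamPlus +
        (-4 / 9) * ω + (2 / 9) * ω * lamPlus]

noncomputable def q1X4 : Matrix (Fin 4) (Fin 4) ℂ :=
  !![1, 0, 0, 0;
    0, (1 / 3), (2 / 3) + (2 / 3) * ω, (-2 / 3) * ω;
    0, (2 / 3) * lamPlus, (-2 / 3) * lamPlus + (-2 / 3) * ω * lamPlus, (-1 / 3) * ω * lamPlus;
    0, (-1 / 3) + (-2 / 3) * lamPlus, (-1 / 6) + (-1 / 3) * lamPlus + (-1 / 6) * ω +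
        (-1 / 3) * ω * lamPlus, (-1 / 3) * ω + (-2 / 3) * ω * lamPlus]

theorem q1X_mul_self : q1X * q1X = q1X2 := by
  ext i j
  fin_cases i <;> fin_cases j <;> simp [q1X, q1X2, Matrix.mul_apply, Fin.sum_univ_succ]
  · linear_combination (0) * lamPlus_root
  · linear_combination ((-2 / 9) + (2 / 9) * ω) * lamPlus_root
  · linear_combination ((-4 / 9) + (-2 / 9) * ω) * lamPlus_root
  · linear_combination ((2 / 9) + (2 / 9) * lamPlus) * ω_sum
  · linear_combination ((1 / 9) + (1 / 2) * lamPlus + (5 / 9) * lamPlus ^ 2) * ω_sum +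
      ((-5 / 9) + (-4 / 9) * ω) * lamPlus_root
  · linear_combination ((1 / 9) * lamPlus + (4 / 9) * lamPlus ^ 2) * ω_sum + ((-4 / 9) +
      (-2 / 9) * ω) * lamPlus_root
  · linear_combination ((1 / 9) + (-2 / 9) * lamPlus) * ω_sum
  · linear_combination ((1 / 18) + (1 / 3) * lamPlus + (4 / 9) * lamPlus ^ 2) * ω_sum +
      ((-2 / 9) + (2 / 9) * ω) * lamPlus_root
  · linear_combination ((1 / 18) * lamPlus + (5 / 9) * lamPlus ^ 2) * ω_sum + ((-1 / 9) +
      (4 / 9) * ω) * lamPlus_root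

theorem q1X2_mul_self : q1X2 * q1X2 = q1X4 := by
  ext i j
  fin_cases i <;> fin_cases j <;> simp [q1X2, q1X4, Matrix.mul_apply, Fin.sum_univ_succ]
  · linear_combination ((4 / 27) + (8 / 27) * lamPlus + (16 / 27) * lamPlus ^ 2) * ω_sum +
      ((-4 / 9)) * lamPlus_root
  · linear_combination ((-5 / 27) + (-4 / 27) * lamPlus + (4 / 27) * lamPlus ^ 2) * ω_sum +
      ((-4 / 9) + (-2 / 3) * ω) * lamPlus_root
  · linear_combination ((-2 / 27) + (8 / 27) * lamPlus + (4 / 27) * lamPlus ^ 2) * ω_sum +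
      ((2 / 9) + (2 / 3) * ω) * lamPlus_root
  · linear_combination ((-8 / 27) + (-28 / 27) * lamPlus + (-8 / 27) * lamPlus ^ 2) * ω_sum +
      ((2 / 9)) * lamPlus_root
  · linear_combination ((7 / 27) + (8 / 27) * lamPlus + (4 / 27) * lamPlus ^ 2) * ω_sum +
      ((-1 / 9)) * lamPlus_root
  · linear_combination ((-2 / 27) + (-4 / 27) * lamPlus + (-8 / 27) * lamPlus ^ 2) * ω_sum +
      ((2 / 9)) * lamPlus_root
  · linear_combination ((4 / 27) + (20 / 27) * lamPlus + (-8 / 27) * lamPlus ^ 2) * ω_sum +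
      ((2 / 9)) * lamPlus_root
  · linear_combination ((-2 / 27) + (-4 / 27) * lamPlus + (-8 / 27) * lamPlus ^ 2) * ω_sum +
      ((2 / 9)) * lamPlus_root
  · linear_combination ((4 / 27) + (-4 / 27) * lamPlus + (4 / 27) * lamPlus ^ 2) * ω_sum +
      ((-1 / 9)) * lamPlus_root

theorem q1X4_mul : q1X4 * q1X = 1 := by
  ext i j
  fin_cases i <;> fin_cases j <;> simp [q1X4, q1X, Matrix.mul_apply, Fin.sum_univ_succ]
  · linear_combination ((-8 / 9)) * ω_sum
  · linear_combination ((-1 / 9) + (-2 / 9) * lamPlus) * ω_sum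
  · linear_combination ((2 / 9) * lamPlus) * ω_sum
  · linear_combination ((2 / 9) * lamPlus) * ω_sum
  · linear_combination ((5 / 18) * lamPlus + (5 / 9) * lamPlus ^ 2) * ω_sum + ((-1)) * lamPlus_root
  · linear_combination ((4 / 9) * lamPlus ^ 2) * ω_sum
  · linear_combination ((-1 / 9) + (-2 / 9) * lamPlus) * ω_sum
  · linear_combination ((1 / 9) + (4 / 9) * lamPlus + (4 / 9) * lamPlus ^ 2) * ω_sum
  · linear_combination ((5 / 18) * lamPlus + (5 / 9) * lamPlus ^ 2) * ω_sum + ((-1)) * lamPlus_root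

theorem matQ1_mul : matQ11 * matQ12 * matQ13 = q1X := by
  ext i j
  fin_cases i <;> fin_cases j <;>
    simp [matQ11, matQ12, matQ13, q1X, Matrix.mul_apply, Fin.sum_univ_succ, lamMinus_eq]
  · ring
  · ring
  · ring
  · ring
  · exact Or.inl (by ring)
  · linear_combination -(2 / 3) * ω_sum
  · linear_combination (1 / 6 + lamPlus / 3) * ω_sum
  · linear_combination (2 / 3) * lamPlus * ω_sum

theorem not_fixesSmoothQuartic_groupQ1 : ¬ FixesSmoothQuartic groupQ1 := by
  rintro ⟨_, ⟨f, hf, hs, rfl⟩, hinv⟩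
  obtain ⟨A, hAv⟩ := exists_gl_eq det_matQ11
  obtain ⟨B, hBv⟩ := exists_gl_eq det_matQ12
  obtain ⟨C, hCv⟩ := exists_gl_eq det_matQ13
  have hf0 := ne_zero_of_isNonsingular hs
  have hAc := exists_pull_eq_smul hf hs hinv (A := A) (mk_mem_generatedBy (by simp [hAv]))
  have hBc := exists_pull_eq_smul hf hs hinv (A := B) (mk_mem_generatedBy (by simp [hBv]))
  have hCc := exists_pull_eq_smul hf hs hinv (A := C) (mk_mem_generatedBy (by simp [hCv]))
  have hA3 : A ^ 3 = 1 := by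
    refine Units.ext ?_
    rw [Units.val_pow_eq_pow_val, hAv, Units.val_one]
    have h2 : (ω ^ 2) ^ 3 = 1 := by linear_combination (ω ^ 3 + 1) * ω_pow
    have hdiag : matQ11 = Matrix.diagonal ![1, 1, ω, ω ^ 2] := by
      ext i j
      fin_cases i <;> fin_cases j <;> simp [matQ11]
    rw [hdiag, Matrix.diagonal_pow, ← Matrix.diagonal_one]
    congr 1
    ext i
    fin_cases i <;> simp [ω_pow, h2]
  have hinvA : A⁻¹ = A ^ 2 := inv_eq_of_mul_eq_one_left (by rw [← pow_succ, hA3])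
  have hCA : C * A = A⁻¹ * C := by
    rw [hinvA]
    refine Units.ext ?_
    rw [Units.val_mul, Units.val_mul, Units.val_pow_eq_pow_val, hAv, hCv, sq]
    ext i j
    fin_cases i <;> fin_cases j <;> simp [matQ13, matQ11, Matrix.mul_apply, Fin.sum_univ_succ]
    · ring
    · linear_combination -lamMinus * ω * ω_pow
  have hA1 : pull (A : M4) f = f := pull_eq_self_of_real hf0 (by decide : Odd 3) hA3 hCA hAc hCc
  rw [hAv] at hA1
  have sq_eq {M : M4} (hM : M * M = 1) {c : ℂ} (h : pull M f = c • f) : c ^ 2 = 1 :=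
    smul_form_injective hf0 (by rw [← pull_pow_eq h, sq, hM, pull_one, one_smul])
  obtain ⟨b, -, hb⟩ := hBc
  obtain ⟨c, -, hc⟩ := hCc
  rw [hBv] at hb
  rw [hCv] at hc
  have hb2 := sq_eq (M := matQ12) (by
    ext i j
    fin_cases i <;> fin_cases j <;> simp [matQ12, Matrix.mul_apply, Fin.sum_univ_succ] <;>
      norm_num) hb
  have hc2 := sq_eq (M := matQ13) (by
    ext i j
    fin_cases i <;> fin_cases j <;> simp [matQ13, Matrix.mul_apply, Fin.sum_univ_succ] <;>
      linear_combination lamPlus_mul_lamMinus) hc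
  have hX : pull q1X f = (b * c) • f := by
    rw [← matQ1_mul, ← pull_pull, ← pull_pull, hA1, hb, map_smul, hc, smul_smul]
  have hX5 : q1X ^ 5 = 1 := by
    rw [pow_succ, show q1X ^ 4 = (q1X ^ 2) ^ 2 from pow_mul q1X 2 2, sq q1X, q1X_mul_self, sq,
        q1X2_mul_self,
      q1X4_mul]
  have h5 : (b * c) ^ 5 = 1 :=
    smul_form_injective hf0 (by rw [← pull_pow_eq hX, hX5, pull_one, one_smul])
  -- The diagonal generator fixes the form exactly, being inverted by the third one; the other two
  -- are involutions and scale it by signs. Thus `b c` is a sign whose fifth power is 1.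
  have h1 : b * c = 1 :=
    eq_one_of_pow_odd (by decide : Odd 5) h5 (by linear_combination c ^ 2 * hb2 + hc2)
  rw [h1, one_smul] at hX
  refine false_of_order_five hf hs hX hX5 (fun h => ?_) (e := Pi.single 0 1) (by simp) ?_
  · have := congrFun (congrFun h 1) 1
    norm_num [q1X] at this
  · ext i
    fin_cases i <;> simp [q1X]

/-! ### The pencil is fixed by `(P)` -/

theorem pencil_isHomogeneous (l : Fin 2 → ℂ) : (pencil l).IsHomogeneous 4 := by
  have hX (i : Fin 4) (n : ℕ) : (X i ^ n : MvPolynomial (Fin 4) ℂ).IsHomogeneous n := by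
    simpa using (isHomogeneous_X ℂ i).pow n
  have hX1 (i : Fin 4) : (X i : MvPolynomial (Fin 4) ℂ).IsHomogeneous 1 := isHomogeneous_X ℂ i
  have hC (c : ℂ) {p : MvPolynomial (Fin 4) ℂ} (hp : p.IsHomogeneous 4) :
      (C c * p).IsHomogeneous 4 := by
    simpa using (isHomogeneous_C (Fin 4) c).mul hp
  exact (hC _ (hX 0 4)).add (hC _ ((((hX 1 3).mul (hX1 2)).add ((hX1 1).mul (hX 3 3))).add
    ((hX 2 3).mul (hX1 3))))

theorem eval_pencil (l : Fin 2 → ℂ) (v : Fin 4 → ℂ) : eval v (pencil l) =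
    l 0 * v 0 ^ 4 + l 1 * (v 1 ^ 3 * v 2 + v 1 * v 3 ^ 3 + v 2 ^ 3 * v 3) := by
  simp [pencil]

/-- Substituting `R` in the Klein quartic groups the quartic monomials into five cyclic orbits. This
and the next four identities evaluate their coefficients, up to `cR ^ 4` and, for the last two, a
factor 3; only the orbit of `x³ y` survives, with 49 cancelling `cR ^ 4`. -/
theorem klein_coeff_zero :
    sMinus ^ 3 * tMinus + uMinus * tMinus ^ 3 + uMinus ^ 3 * sMinus = 0 := by
  unfold uMinus sMinus tMinus
  linear_combination (ζ ^ 5 - ζ ^ 6 - ζ ^ 8 - 2 * ζ ^ 10 + 6 * ζ ^ 11 - 2 * ζ ^ 12 - ζ ^ 14 -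
    ζ ^ 16 + ζ ^ 17) * ζ_sum

theorem klein_coeff_one : sMinus * tMinus ^ 3 + 3 * sMinus ^ 2 * tMinus ^ 2 + uMinus * sMinus ^ 3 +
    3 * uMinus ^ 2 * tMinus ^ 2 + 3 * uMinus ^ 2 * sMinus ^ 2 + uMinus ^ 3 * tMinus = 49 := by
  unfold uMinus sMinus tMinus
  linear_combination (-49 + 49 * ζ + 2 * ζ ^ 6 - 49 * ζ ^ 7 + 50 * ζ ^ 8 - 15 * ζ ^ 9 +
    15 * ζ ^ 10 - 13 * ζ ^ 11 + 15 * ζ ^ 12 - 15 * ζ ^ 13 + ζ ^ 14 + 2 * ζ ^ 16) * ζ_sum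

theorem klein_coeff_two : tMinus ^ 4 + sMinus ^ 4 + 3 * uMinus * sMinus * tMinus ^ 2 +
    3 * uMinus * sMinus ^ 2 * tMinus + 3 * uMinus ^ 2 * sMinus * tMinus + uMinus ^ 4 = 0 := by
  unfold uMinus sMinus tMinus
  linear_combination (ζ ^ 4 - ζ ^ 5 - 3 * ζ ^ 7 + 4 * ζ ^ 8 + ζ ^ 9 - 5 * ζ ^ 10 + 6 * ζ ^ 11 -
    5 * ζ ^ 12 + ζ ^ 13 + 4 * ζ ^ 14 - 3 * ζ ^ 15 - ζ ^ 17 + ζ ^ 18) * ζ_sum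

theorem klein_coeff_three : sMinus * tMinus ^ 3 + uMinus * sMinus * tMinus ^ 2 +
    uMinus * sMinus ^ 2 * tMinus + uMinus * sMinus ^ 3 + uMinus ^ 2 * sMinus * tMinus +
    uMinus ^ 3 * tMinus = 0 := by
  unfold uMinus sMinus tMinus
  linear_combination (1 / 3) * ((-3) * ζ ^ 6 + 6 * ζ ^ 7 - 3 * ζ ^ 8 + 6 * ζ ^ 9 - 18 * ζ ^ 10 +
    24 * ζ ^ 11 - 18 * ζ ^ 12 + 6 * ζ ^ 13 - 3 * ζ ^ 14 + 6 * ζ ^ 15 - 3 * ζ ^ 16) * ζ_sum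

theorem klein_coeff_four : sMinus ^ 2 * tMinus ^ 2 + sMinus ^ 3 * tMinus + uMinus * tMinus ^ 3 +
    2 * uMinus * sMinus * tMinus ^ 2 + 2 * uMinus * sMinus ^ 2 * tMinus + uMinus ^ 2 * tMinus ^ 2 +
    2 * uMinus ^ 2 * sMinus * tMinus + uMinus ^ 2 * sMinus ^ 2 + uMinus ^ 3 * sMinus = 0 := by
  unfold uMinus sMinus tMinus
  linear_combination (1 / 3) * (3 * ζ ^ 5 - 9 * ζ ^ 7 + 6 * ζ ^ 8 - 3 * ζ ^ 9 - 6 * ζ ^ 10 +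
    18 * ζ ^ 11 - 6 * ζ ^ 12 - 3 * ζ ^ 13 + 6 * ζ ^ 14 - 9 * ζ ^ 15 + 3 * ζ ^ 17) * ζ_sum

theorem klein_hankel (x y z : ℂ) :
    (cR * uMinus * x + cR * sMinus * y + cR * tMinus * z) ^ 3 *
      (cR * sMinus * x + cR * tMinus * y + cR * uMinus * z) +
    (cR * uMinus * x + cR * sMinus * y + cR * tMinus * z) *
      (cR * tMinus * x + cR * uMinus * y + cR * sMinus * z) ^ 3 +
    (cR * sMinus * x + cR * tMinus * y + cR * uMinus * z) ^ 3 *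
      (cR * tMinus * x + cR * uMinus * y + cR * sMinus * z) =
    x ^ 3 * y + x * z ^ 3 + y ^ 3 * z := by
  have h0 := klein_coeff_zero
  have h1 := klein_coeff_one
  have h2 := klein_coeff_two
  have h3 := klein_coeff_three
  have h4 := klein_coeff_four
  have hc : cR ^ 4 * 49 = 1 := by linear_combination (cR * cR * 7 - 1) * cR_mul_norm
  generalize uMinus = u at *
  generalize sMinus = s at *
  generalize tMinus = t at *
  generalize cR = c at *
  linear_combination c ^ 4 * (x ^ 4 + y ^ 4 + z ^ 4) * h0 +
    c ^ 4 * (x ^ 3 * y + x * z ^ 3 + y ^ 3 * z) * h1 +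
    c ^ 4 * (x ^ 3 * z + x * y ^ 3 + y * z ^ 3) * h2 +
    c ^ 4 * 3 * (x ^ 2 * y ^ 2 + y ^ 2 * z ^ 2 + z ^ 2 * x ^ 2) * h3 +
    c ^ 4 * 3 * (x ^ 2 * y * z + x * y ^ 2 * z + x * y * z ^ 2) * h4 +
    (x ^ 3 * y + x * z ^ 3 + y ^ 3 * z) * hc

theorem matS_mulVec (v : Fin 4 → ℂ) :
    matS.mulVec v = ![v 0, ζ ^ 4 * v 1, ζ ^ 2 * v 2, ζ * v 3] := by
  rw [matS_eq]
  ext i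
  rw [Matrix.mulVec_diagonal]
  fin_cases i <;> simp

theorem matT_mulVec (v : Fin 4 → ℂ) : matT.mulVec v = ![v 0, v 2, v 3, v 1] := by
  ext i
  fin_cases i <;> simp [matT, Matrix.mulVec, dotProduct, Fin.sum_univ_four]

theorem matR_mulVec (v : Fin 4 → ℂ) : matR.mulVec v =
    ![v 0, cR * uMinus * v 1 + cR * sMinus * v 2 + cR * tMinus * v 3,
      cR * sMinus * v 1 + cR * tMinus * v 2 + cR * uMinus * v 3,
      cR * tMinus * v 1 + cR * uMinus * v 2 + cR * sMinus * v 3] := by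
  rw [matR_eq]
  ext i
  fin_cases i <;> simp [Matrix.mulVec, dotProduct, Fin.sum_univ_four]

theorem pull_matS_pencil (l : Fin 2 → ℂ) : pull matS (pencil l) = pencil l := by
  refine MvPolynomial.funext fun v => ?_
  rw [eval_pull, matS_mulVec, eval_pencil, eval_pencil]
  simp only [Matrix.cons_val]
  linear_combination l 1 * (v 1 ^ 3 * v 2 * (ζ ^ 7 + 1) + v 1 * v 3 ^ 3 + v 2 ^ 3 * v 3) * ζ_pow

theorem pull_matT_pencil (l : Fin 2 → ℂ) : pull matT (pencil l) = pencil l := by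
  refine MvPolynomial.funext fun v => ?_
  rw [eval_pull, matT_mulVec, eval_pencil, eval_pencil]
  simp only [Matrix.cons_val]
  ring

theorem pull_matR_pencil (l : Fin 2 → ℂ) : pull matR (pencil l) = pencil l := by
  refine MvPolynomial.funext fun v => ?_
  rw [eval_pull, matR_mulVec, eval_pencil, eval_pencil]
  simp only [Matrix.cons_val]
  rw [klein_hankel]

theorem isInvariantUnder_pencil (l : Fin 2 → ℂ) :
    IsInvariantUnder groupP (surfaceOf (pencil l)) := by
  have hgen (A : GL (Fin 4) ℂ) (hA : pull (A : M4) (pencil l) = pencil l) :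
      Matrix.ProjGenLinGroup.mk A ∈ MulAction.stabilizer PGL(4, ℂ) (surfaceOf (pencil l)) := by
    rw [← inv_mem_iff, MulAction.mem_stabilizer_iff, inv_smul_surfaceOf (pencil_isHomogeneous l),
      hA]
  have hle : groupP ≤ MulAction.stabilizer PGL(4, ℂ) (surfaceOf (pencil l)) := by
    rw [groupP_eq, Subgroup.closure_le]
    rintro _ (rfl | rfl | rfl)
    exacts [hgen _ (pull_matS_pencil l), hgen _ (pull_matT_pencil l), hgen _ (pull_matR_pencil l)]
  exact fun A hA => hle hA

/-! ### The smooth members of the pencil -/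

/-- Multiplying `z³ = -3x²y`, `x³ = -3y²z` and `y³ = -3xz²` gives `28 (xyz)³ = 0`; once one
coordinate is zero, the equations kill the others. -/
theorem eq_zero_of_klein_pderiv {x y z : ℂ} (h1 : 3 * x ^ 2 * y + z ^ 3 = 0)
    (h2 : x ^ 3 + 3 * y ^ 2 * z = 0) (h3 : 3 * x * z ^ 2 + y ^ 3 = 0) :
    x = 0 ∧ y = 0 ∧ z = 0 := by
  have h : (x * y * z) ^ 3 * 28 = 0 := by
    linear_combination x ^ 3 * y ^ 3 * h1 - 3 * x ^ 2 * y * y ^ 3 * h2 +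
      3 * x ^ 2 * y * (3 * y ^ 2 * z) * h3
  rcases (by simpa [or_assoc] using h : x = 0 ∨ y = 0 ∨ z = 0) with rfl | rfl | rfl
  · exact ⟨rfl, by simpa using h3, by simpa using h1⟩
  · exact ⟨by simpa using h2, rfl, by simpa using h1⟩
  · exact ⟨by simpa using h2, by simpa using h3, rfl⟩

theorem isNonsingular_pencil_iff (l : Fin 2 → ℂ) :
    IsNonsingular (pencil l) ↔ l 0 ≠ 0 ∧ l 1 ≠ 0 := by
  have hd (v : Fin 4 → ℂ) : eval v (pderiv 0 (pencil l)) = 4 * l 0 * v 0 ^ 3 ∧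
      eval v (pderiv 1 (pencil l)) = l 1 * (3 * v 1 ^ 2 * v 2 + v 3 ^ 3) ∧
      eval v (pderiv 2 (pencil l)) = l 1 * (v 1 ^ 3 + 3 * v 2 ^ 2 * v 3) ∧
      eval v (pderiv 3 (pencil l)) = l 1 * (3 * v 1 * v 3 ^ 2 + v 2 ^ 3) := by
    refine ⟨?_, ?_, ?_, ?_⟩ <;> simp [pencil, pderiv_X] <;>
      first | ring1 | exact Or.inl (by ring1)
  constructor
  · refine fun h => ⟨fun h0 => ?_, fun h0 => ?_⟩
    -- Without the term `x₀⁴` the surface is a cone with this vertex.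
    · obtain ⟨i, hi⟩ := h ![1, 0, 0, 0] (by simp) (by simp [eval_pencil, h0])
      apply hi
      obtain ⟨d0, d1, d2, d3⟩ := hd ![1, 0, 0, 0]
      fin_cases i
      exacts [d0.trans (by simp [h0]), d1.trans (by simp), d2.trans (by simp), d3.trans (by simp)]
    -- The form is now a multiple of `x₀⁴`, singular wherever `x₀ = 0`.
    · obtain ⟨i, hi⟩ := h ![0, 1, 0, 0] (by simp) (by simp [eval_pencil])
      apply hi
      obtain ⟨d0, d1, d2, d3⟩ := hd ![0, 1, 0, 0]
      fin_cases i
      exacts [d0.trans (by simp), d1.trans (by simp [h0]), d2.trans (by simp [h0]),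
        d3.trans (by simp [h0])]
  · rintro ⟨h0, h1⟩ v hv -
    by_contra! h
    obtain ⟨d0, d1, d2, d3⟩ := hd v
    rw [h] at d0 d1 d2 d3
    have e0 : v 0 = 0 := by simpa [h0] using d0.symm
    obtain ⟨e1, e2, e3⟩ := eq_zero_of_klein_pderiv (x := v 1) (y := v 2) (z := v 3)
      (by simpa [h1] using d1.symm) (by simpa [h1] using d2.symm) (by simpa [h1] using d3.symm)
    apply hv
    ext i
    fin_cases i
    exacts [e0, e1, e2, e3]

theorem not_isNonsingular_pencil_iff (l : Fin 2 → ℂ) (hl : l ≠ 0) : ¬ IsNonsingular (pencil l) ↔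
    Projectivization.mk ℂ l hl = Projectivization.mk ℂ ![1, 0] (by simp) ∨
      Projectivization.mk ℂ l hl = Projectivization.mk ℂ ![0, 1] (by simp) := by
  have hne : l 0 ≠ 0 ∨ l 1 ≠ 0 := by
    by_contra! h
    exact hl (by ext i; fin_cases i <;> simp [h.1, h.2])
  rw [isNonsingular_pencil_iff, Projectivization.mk_eq_mk_iff', Projectivization.mk_eq_mk_iff']
  constructor
  · intro h
    by_cases h0 : l 0 = 0
    · exact Or.inr ⟨l 1, by ext i; fin_cases i <;> simp [h0]⟩
    · have h1 : l 1 = 0 := by tauto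
      exact Or.inl ⟨l 0, by ext i; fin_cases i <;> simp [h1]⟩
  · rintro (⟨a, rfl⟩ | ⟨a, rfl⟩) <;> simp

/-! ### Quartic forms fixed by `(P)` -/

theorem coeff_pull_diagonal (d : Fin 4 → ℂ) (f : MvPolynomial (Fin 4) ℂ) (m : Fin 4 →₀ ℕ) :
    coeff m (pull (Matrix.diagonal d) f) = (∏ i, d i ^ m i) * coeff m f := by
  induction f using MvPolynomial.induction_on' with
  | monomial n a =>
    have h : pull (Matrix.diagonal d) (monomial n a) = monomial n ((∏ i, d i ^ n i) * a) := by
      refine MvPolynomial.funext fun v => ?_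
      rw [eval_pull, eval_monomial, eval_monomial, Finsupp.prod_fintype _ _ (by simp),
        Finsupp.prod_fintype _ _ (by simp)]
      simp only [Matrix.mulVec_diagonal, mul_pow, Finset.prod_mul_distrib]
      ring
    rw [h, coeff_monomial, coeff_monomial]
    split_ifs with hn
    · rw [hn]
    · rw [mul_zero]
  | add p q hp hq => rw [map_add, coeff_add, coeff_add, hp, hq, mul_add]

/-- A diagonal matrix scales each monomial, so a monomial survives only if `4 m₁ + 2 m₂ + m₃` is
divisible by 7; in degree four just five do. -/
theorem exponents_of_coeff_ne_zero {f : MvPolynomial (Fin 4) ℂ} (hf : f.IsHomogeneous 4)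
    (hS : pull matS f = f) {m : Fin 4 →₀ ℕ} (hm : coeff m f ≠ 0) :
    (m 0 = 4 ∧ m 1 = 0 ∧ m 2 = 0 ∧ m 3 = 0) ∨ (m 0 = 1 ∧ m 1 = 1 ∧ m 2 = 1 ∧ m 3 = 1) ∨
      (m 0 = 0 ∧ m 1 = 3 ∧ m 2 = 1 ∧ m 3 = 0) ∨ (m 0 = 0 ∧ m 1 = 1 ∧ m 2 = 0 ∧ m 3 = 3) ∨
        (m 0 = 0 ∧ m 1 = 0 ∧ m 2 = 3 ∧ m 3 = 1) := by
  have hdeg : m 0 + m 1 + m 2 + m 3 = 4 := by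
    have := hf hm
    rw [Finsupp.weight_apply, Finsupp.sum_fintype _ _ (by simp)] at this
    simpa [Fin.sum_univ_four] using this
  have h1 := congrArg (coeff m) hS
  rw [matS_eq, coeff_pull_diagonal] at h1
  have h2 := mul_right_cancel₀ hm (h1.trans (one_mul _).symm)
  have h7 : ζ ^ (4 * m 1 + 2 * m 2 + m 3) = 1 := by
    rw [← h2]
    simp [Fin.prod_univ_four, pow_add, pow_mul]
  have hdvd := ζ_isPrimitiveRoot.dvd_of_pow_eq_one _ h7
  have hm1 : m 1 ≤ 4 := by omega
  have hm2 : m 2 ≤ 4 := by omega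
  generalize m 1 = a at *
  generalize m 2 = b at *
  interval_cases a <;> interval_cases b <;> omega

theorem exists_eval_eq {f : MvPolynomial (Fin 4) ℂ} (hf : f.IsHomogeneous 4)
    (hS : pull matS f = f) : ∃ a b c₁ c₂ c₃ : ℂ, ∀ v : Fin 4 → ℂ, eval v f =
      a * v 0 ^ 4 + b * (v 0 * v 1 * v 2 * v 3) + c₁ * (v 1 ^ 3 * v 2) + c₂ * (v 1 * v 3 ^ 3) +
        c₃ * (v 2 ^ 3 * v 3) := by
  have key (s : Finset (Fin 4 →₀ ℕ)) (hs : ∀ m ∈ s, coeff m f ≠ 0) :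
      ∃ a b c₁ c₂ c₃ : ℂ, ∀ v : Fin 4 → ℂ, ∑ m ∈ s, coeff m f * ∏ i, v i ^ m i =
        a * v 0 ^ 4 + b * (v 0 * v 1 * v 2 * v 3) + c₁ * (v 1 ^ 3 * v 2) + c₂ * (v 1 * v 3 ^ 3) +
          c₃ * (v 2 ^ 3 * v 3) := by
    induction s using Finset.induction_on with
    | empty => exact ⟨0, 0, 0, 0, 0, fun v => by simp⟩
    | insert m s hm ih =>
      obtain ⟨a, b, c₁, c₂, c₃, h⟩ := ih fun n hn => hs n (Finset.mem_insert_of_mem hn)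
      have hsum (v : Fin 4 → ℂ) : ∑ n ∈ insert m s, coeff n f * ∏ i, v i ^ n i =
          coeff m f * (v 0 ^ m 0 * v 1 ^ m 1 * v 2 ^ m 2 * v 3 ^ m 3) +
          (a * v 0 ^ 4 + b * (v 0 * v 1 * v 2 * v 3) + c₁ * (v 1 ^ 3 * v 2) +
            c₂ * (v 1 * v 3 ^ 3) + c₃ * (v 2 ^ 3 * v 3)) := by
        rw [Finset.sum_insert hm, h v, Fin.prod_univ_four]
      rcases exponents_of_coeff_ne_zero hf hS (hs m (Finset.mem_insert_self m s)) with
        ⟨h0, h1, h2, h3⟩ | ⟨h0, h1, h2, h3⟩ | ⟨h0, h1, h2, h3⟩ | ⟨h0, h1, h2, h3⟩ | ⟨h0, h1, h2, h3⟩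
      · exact ⟨a + coeff m f, b, c₁, c₂, c₃, fun v => by rw [hsum, h0, h1, h2, h3]; ring⟩
      · exact ⟨a, b + coeff m f, c₁, c₂, c₃, fun v => by rw [hsum, h0, h1, h2, h3]; ring⟩
      · exact ⟨a, b, c₁ + coeff m f, c₂, c₃, fun v => by rw [hsum, h0, h1, h2, h3]; ring⟩
      · exact ⟨a, b, c₁, c₂ + coeff m f, c₃, fun v => by rw [hsum, h0, h1, h2, h3]; ring⟩
      · exact ⟨a, b, c₁, c₂, c₃ + coeff m f, fun v => by rw [hsum, h0, h1, h2, h3]; ring⟩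
  obtain ⟨a, b, c₁, c₂, c₃, h⟩ := key f.support fun m hm => mem_support_iff.mp hm
  exact ⟨a, b, c₁, c₂, c₃, fun v => by rw [eval_eq', h v]⟩

theorem cR_ne_zero : cR ≠ 0 := by
  intro h
  have := cR_mul_norm
  rw [h] at this
  norm_num at this

theorem ζ_pow_sub_ne_zero {i j : ℕ} (hi : i < 7) (hj : j < 7) (hij : i ≠ j) :
    ζ ^ i - ζ ^ j ≠ 0 := fun h =>
  hij (ζ_isPrimitiveRoot.pow_inj hi hj (sub_eq_zero.mp h))

theorem uMinus_ne_zero : uMinus ≠ 0 := by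
  simpa [uMinus] using ζ_pow_sub_ne_zero (i := 1) (j := 6) (by norm_num) (by norm_num) (by norm_num)

theorem sMinus_ne_zero : sMinus ≠ 0 :=
  ζ_pow_sub_ne_zero (by norm_num) (by norm_num) (by norm_num)

theorem tMinus_ne_zero : tMinus ≠ 0 :=
  ζ_pow_sub_ne_zero (by norm_num) (by norm_num) (by norm_num)

theorem exists_eq_pencil {f : MvPolynomial (Fin 4) ℂ} (hf : f.IsHomogeneous 4)
    (hS : pull matS f = f) (hT : pull matT f = f) (hR : pull matR f = f) : ∃ l, f = pencil l := by
  obtain ⟨a, b, c₁, c₂, c₃, h⟩ := exists_eval_eq hf hS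
  have h12 : c₂ = c₁ := by
    have := congrArg (eval ![0, 1, 1, 0]) hT
    rw [eval_pull, matT_mulVec, h, h] at this
    simpa using this
  have h13 : c₃ = c₁ := by
    have := congrArg (eval ![0, 0, 1, 1]) hT
    rw [eval_pull, matT_mulVec, h, h] at this
    simpa using this.symm
  -- The monomial `x₀x₁x₂x₃` is the only one odd in `x₀`. It vanishes at `(±1, 1, 0, 0)` but not at
  -- the images of these points under `matR`, so comparing the two signs isolates `b`.
  have hb : b = 0 := by
    have e1 := congrArg (eval ![1, 1, 0, 0]) hR
    have e2 := congrArg (eval ![-1, 1, 0, 0]) hR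
    rw [eval_pull, matR_mulVec, h, h] at e1 e2
    simp at e1 e2
    have e3 : b * (cR * uMinus * (cR * sMinus) * (cR * tMinus)) = 0 := by
      linear_combination (1 / 2) * e1 - (1 / 2) * e2
    simpa [cR_ne_zero, uMinus_ne_zero, sMinus_ne_zero, tMinus_ne_zero] using e3
  refine ⟨![a, c₁], MvPolynomial.funext fun v => ?_⟩
  rw [h, eval_pencil, h12, h13, hb]
  simp only [Matrix.cons_val]
  ring

theorem mk_glS_mem : Matrix.ProjGenLinGroup.mk glS ∈ groupP := by
  rw [groupP_eq]
  exact Subgroup.subset_closure (by simp)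

theorem mk_glT_mem : Matrix.ProjGenLinGroup.mk glT ∈ groupP := by
  rw [groupP_eq]
  exact Subgroup.subset_closure (by simp)

theorem mk_glR_mem : Matrix.ProjGenLinGroup.mk glR ∈ groupP := by
  rw [groupP_eq]
  exact Subgroup.subset_closure (by simp)

theorem exists_eq_pencil_of_isInvariantUnder {f : MvPolynomial (Fin 4) ℂ} (hf : f.IsHomogeneous 4)
    (hs : IsNonsingular f) (hinv : IsInvariantUnder groupP (surfaceOf f)) :
    ∃ l, f = pencil l := by
  have hf0 := ne_zero_of_isNonsingular hs
  obtain ⟨a, ha, hSa⟩ := exists_pull_eq_smul hf hs hinv mk_glS_mem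
  obtain ⟨b, hb, hTb⟩ := exists_pull_eq_smul hf hs hinv mk_glT_mem
  obtain ⟨c, hc, hRc⟩ := exists_pull_eq_smul hf hs hinv mk_glR_mem
  have mul {A B : M4} {x y : ℂ} (hA : pull A f = x • f) (hB : pull B f = y • f) :
      pull (A * B) f = (x * y) • f := by rw [← pull_pull, hA, map_smul, hB, smul_smul]
  have uniq {A B : GL (Fin 4) ℂ} (h : A = B) {x y : ℂ} (hA : pull (A : M4) f = x • f)
      (hB : pull (B : M4) f = y • f) : x = y := smul_form_injective hf0 (by rw [← hA, ← hB, h])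
  have hone : pull ((1 : GL (Fin 4) ℂ) : M4) f = (1 : ℂ) • f := by simp
  -- The scalars `a`, `b`, `c` behave like a character, and the Klein relations make every character
  -- trivial.
  have ha1 : a = 1 := by
    have := uniq isKleinTriple_gl.s_mul_t (mul hSa hTb) (mul hTb (pull_pow_eq hSa 2))
    have h1 : a * b * (a - 1) = 0 := by linear_combination -this
    simpa [ha, hb, sub_eq_zero] using h1
  have hb1 : b = 1 := by
    have := uniq isKleinTriple_gl.r_mul_t (mul hRc hTb) (mul (pull_pow_eq hTb 2) hRc)
    have h1 : b * c * (b - 1) = 0 := by linear_combination -this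
    simpa [hb, hc, sub_eq_zero] using h1
  have hc2 : c * c = 1 := uniq isKleinTriple_gl.r_sq (mul hRc hRc) hone
  have hc3 : (c * a) ^ 3 = 1 := uniq isKleinTriple_gl.rs_pow (pull_pow_eq (mul hRc hSa) 3) hone
  have hc1 : c = 1 := by
    rw [ha1] at hc3
    linear_combination hc3 - c * hc2
  rw [ha1, one_smul] at hSa
  rw [hb1, one_smul] at hTb
  rw [hc1, one_smul] at hRc
  exact exists_eq_pencil hf hSa hTb hRc

theorem fixesSmoothQuartic_of_areConjugate {G : Subgroup PGL(4, ℂ)} (h : AreConjugate G groupP) :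
    FixesSmoothQuartic G := by
  obtain ⟨T, rfl⟩ := h
  obtain ⟨A, hA⟩ : ∃ A : GL (Fin 4) ℂ, Matrix.ProjGenLinGroup.mk A = T⁻¹ :=
    Matrix.ProjGenLinGroup.mk_surjective _
  have hs : IsNonsingular (pencil ![1, 1]) := (isNonsingular_pencil_iff _).mpr (by simp)
  refine ⟨T • surfaceOf (pencil ![1, 1]), ⟨pull A (pencil ![1, 1]),
    pull_isHomogeneous A (pencil_isHomogeneous _), isNonsingular_pull hs A, ?_⟩, ?_⟩
  · rw [← inv_smul_surfaceOf (pencil_isHomogeneous _), hA, inv_inv]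
  · rintro _ ⟨p, hp, rfl⟩
    have := isInvariantUnder_pencil ![1, 1] p hp
    simp only [MulEquiv.coe_toMonoidHom, MulAut.conj_apply, mul_smul, inv_smul_smul, this]

/-! ### The structure of `(P)` -/

theorem matS_mulVec_single : matS.mulVec (Pi.single 0 1) = Pi.single 0 1 := by
  rw [matS_mulVec]
  ext i
  fin_cases i <;> simp

theorem matT_mulVec_single : matT.mulVec (Pi.single 0 1) = Pi.single 0 1 := by
  rw [matT_mulVec]
  ext i
  fin_cases i <;> simp

theorem matR_mulVec_single : matR.mulVec (Pi.single 0 1) = Pi.single 0 1 := by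
  rw [matR_mulVec]
  ext i
  fin_cases i <;> simp

/-- Since these words fix a vector, as `glR` does, equalities between them in `PGL` can be tested on
matrices. -/
theorem val_normal_form_mulVec_single (i j : ℕ) :
    ((glT ^ j * glS ^ i : GL (Fin 4) ℂ) : M4).mulVec (Pi.single 0 1) = Pi.single 0 1 := by
  have hpow {A : M4} (hA : A.mulVec (Pi.single 0 1) = Pi.single 0 1) (n : ℕ) :
      (A ^ n).mulVec (Pi.single 0 1) = Pi.single 0 1 := by
    induction n with
    | zero => rw [pow_zero, Matrix.one_mulVec]
    | succ n ih => rw [pow_succ, ← Matrix.mulVec_mulVec, hA, ih]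
  rw [Units.val_mul, Units.val_pow_eq_pow_val, Units.val_pow_eq_pow_val, val_glS, val_glT,
    ← Matrix.mulVec_mulVec, hpow matS_mulVec_single, hpow matT_mulVec_single]

theorem matT_pow_apply {j : ℕ} (hj : j < 3) : (matT ^ j) 1 1 = (if j = 0 then 1 else 0) ∧
    (j = 0 → matT ^ j = 1) := by
  interval_cases j
  · simp
  · simp [matT]
  · simp [sq, matT, Matrix.mul_apply, Fin.sum_univ_four]

theorem gl_normal_form_ne_one {i : ℕ} (hi : i < 7) {j : ℕ} (hj : j < 3)
    (h : glT ^ j * glS ^ i = 1) : i = 0 ∧ j = 0 := by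
  have h' : matT ^ j * Matrix.diagonal ![1, (ζ ^ 4) ^ i, (ζ ^ 2) ^ i, ζ ^ i] = 1 := by
    rw [← matS_pow]
    simpa [val_glS, val_glT] using congrArg Units.val h
  obtain ⟨h1, h2⟩ := matT_pow_apply hj
  by_cases h0 : j = 0
  · rw [h2 h0, one_mul] at h'
    have h3 := congrFun (congrFun h' 3) 3
    simp at h3
    exact ⟨ζ_isPrimitiveRoot.pow_inj hi (by norm_num) (by rw [h3, pow_zero]), h0⟩
  · have h3 := congrFun (congrFun h' 1) 1
    rw [Matrix.mul_diagonal, h1, if_neg h0] at h3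
    simp at h3

/-- For `j = 0` the left side is diagonal, and for `j = 1, 2` it has a zero at position `(1, 1)`;
`matR` has non-zero entries at `(1, 2)` and `(1, 1)`. -/
theorem gl_normal_form_ne_glR (i : ℕ) {j : ℕ} (hj : j < 3) : glT ^ j * glS ^ i ≠ glR := by
  intro h
  have h' : matT ^ j * Matrix.diagonal ![1, (ζ ^ 4) ^ i, (ζ ^ 2) ^ i, ζ ^ i] = matR := by
    rw [← matS_pow]
    simpa [val_glS, val_glT, val_glR] using congrArg Units.val h
  rw [matR_eq] at h'
  obtain ⟨h1, h2⟩ := matT_pow_apply hj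
  by_cases h0 : j = 0
  · rw [h2 h0, one_mul] at h'
    have h3 := congrFun (congrFun h' 1) 2
    simp [cR_ne_zero, sMinus_ne_zero] at h3
  · have h3 := congrFun (congrFun h' 1) 1
    rw [Matrix.mul_diagonal, h1, if_neg h0] at h3
    simp [cR_ne_zero, uMinus_ne_zero] at h3

theorem nonempty_groupP_mulEquiv : Nonempty (groupP ≃* PSL(2, ZMod 7)) := by
  let S : groupP := ⟨_, mk_glS_mem⟩
  let T : groupP := ⟨_, mk_glT_mem⟩
  let R : groupP := ⟨_, mk_glR_mem⟩
  have hK : IsKleinTriple S T R := IsKleinTriple.of_injective groupP.subtype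
    groupP.subtype_injective (isKleinTriple_gl.map Matrix.ProjGenLinGroup.mk)
  have htop : Subgroup.closure {S, T, R} = ⊤ := by
    apply Subgroup.map_injective groupP.subtype_injective
    rw [MonoidHom.map_closure, ← MonoidHom.range_eq_map, Subgroup.range_subtype]
    conv_rhs => rw [groupP_eq]
    congr 1
    simp [Set.image_insert_eq, S, T, R]
  have he : (Pi.single 0 1 : Fin 4 → ℂ) ≠ 0 := by simp
  have hval (i j : ℕ) : ((T ^ j * S ^ i : groupP) : PGL(4, ℂ)) =
      Matrix.ProjGenLinGroup.mk (glT ^ j * glS ^ i) := by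
    simp [S, T]
  refine hK.nonempty_mulEquiv htop (fun i hi j hj h => ?_) (fun i hi j hj h => ?_)
    isKleinTriple_psl closure_psl psl_normal_form_ne_one psl_normal_form_ne_r
  · refine gl_normal_form_ne_one hi hj (eq_of_mk_eq_of_mulVec_eq he
      (val_normal_form_mulVec_single i j) (by rw [Units.val_one, Matrix.one_mulVec]) ?_)
    rw [← hval, h, map_one]
    rfl
  · refine gl_normal_form_ne_glR i hj (eq_of_mk_eq_of_mulVec_eq he
      (val_normal_form_mulVec_single i j) matR_mulVec_single ?_)
    rw [← hval, h]

theorem preserves_span_single {A : M4} (hA : A.mulVec (Pi.single 0 1) = Pi.single 0 1) :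
    Preserves A (ℂ ∙ (Pi.single 0 1 : Fin 4 → ℂ)) := by
  intro v hv
  obtain ⟨a, rfl⟩ := Submodule.mem_span_singleton.mp hv
  rw [Matrix.mulVec_smul, hA]
  exact hv

theorem groupP_le_stabilizerOf {U : Submodule ℂ (Fin 4 → ℂ)} (hS : Preserves matS U)
    (hT : Preserves matT U) (hR : Preserves matR U) : groupP ≤ stabilizerOf U := by
  rw [groupP_eq, Subgroup.closure_le]
  have hK := isKleinTriple_gl
  rintro _ (rfl | rfl | rfl)
  · refine ⟨glS, rfl, hS, ?_⟩
    rw [hK.s_inv, Units.val_pow_eq_pow_val]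
    exact hS.pow 6
  · refine ⟨glT, rfl, hT, ?_⟩
    rw [hK.t_inv, Units.val_pow_eq_pow_val]
    exact hT.pow 2
  · refine ⟨glR, rfl, hR, ?_⟩
    rw [hK.r_inv]
    exact hR

theorem map_eq_of_mk_mem_stabilizerOf {U : Submodule ℂ (Fin 4 → ℂ)} {A : GL (Fin 4) ℂ}
    (hA : Matrix.ProjGenLinGroup.mk A ∈ stabilizerOf U) :
    U.map (Matrix.mulVecLin (A : M4)) = U := by
  have h1 := preserves_of_mem_stabilizerOf hA
  have h2 : Preserves ((A⁻¹ : GL (Fin 4) ℂ) : M4) U :=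
    preserves_of_mem_stabilizerOf (by rw [map_inv]; exact inv_mem hA)
  refine le_antisymm (Submodule.map_le_iff_le_comap.mpr h1) fun v hv => ?_
  refine ⟨_, h2 v hv, ?_⟩
  rw [Matrix.mulVecLin_apply, Matrix.mulVec_mulVec, ← Units.val_mul, mul_inv_cancel,
    Units.val_one, Matrix.one_mulVec]

theorem not_isPrimitiveGroup_groupP : ¬ IsPrimitiveGroup groupP := by
  let V : Submodule ℂ (Fin 4 → ℂ) := ℂ ∙ Pi.single 0 1
  let W : Submodule ℂ (Fin 4 → ℂ) := LinearMap.ker (LinearMap.proj 0)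
  have hW (v : Fin 4 → ℂ) : v ∈ W ↔ v 0 = 0 := Iff.rfl
  have hV : groupP ≤ stabilizerOf V := groupP_le_stabilizerOf
    (preserves_span_single matS_mulVec_single) (preserves_span_single matT_mulVec_single)
    (preserves_span_single matR_mulVec_single)
  have hW' : groupP ≤ stabilizerOf W := groupP_le_stabilizerOf
    (fun v hv => by rw [hW, matS_mulVec]; exact hv) (fun v hv => by rw [hW, matT_mulVec]; exact hv)
    (fun v hv => by rw [hW, matR_mulVec]; exact hv)
  have hdisj : Disjoint V W := by
    rw [Submodule.disjoint_def]
    intro v hv hv'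
    obtain ⟨a, rfl⟩ := Submodule.mem_span_singleton.mp hv
    rw [hW] at hv'
    have ha : a = 0 := by simpa using hv'
    rw [ha, zero_smul]
  have hVb : V ≠ ⊥ := by simp [V]
  have hne : V ≠ W := fun h => hVb (disjoint_self.mp (h ▸ hdisj : Disjoint V V))
  refine not_not.mpr ⟨{V, W}, Set.nontrivial_pair hne, ?_, (sSupIndep_pair hne).mpr hdisj, ?_, ?_⟩
  · rintro _ (rfl | rfl)
    · exact hVb
    · exact (Submodule.ne_bot_iff _).mpr ⟨Pi.single 1 1, by simp [hW], by simp⟩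
  · rw [sSup_pair, eq_top_iff]
    intro v _
    rw [Submodule.mem_sup]
    refine ⟨v 0 • Pi.single 0 1, Submodule.smul_mem _ _ (Submodule.mem_span_singleton_self _),
      v - v 0 • Pi.single 0 1, by simp [hW], by simp⟩
  · rintro A hA _ (rfl | rfl)
    · exact Or.inl (map_eq_of_mk_mem_stabilizerOf (hV hA))
    · exact Or.inr (map_eq_of_mk_mem_stabilizerOf (hW' hA))

end QuarticSurface

/-! ### Assembly of the theorem -/

open QuarticSurface
theorem mainTheorem3 :
    -- `(P)` is a non-primitive group isomorphic to `PSL₂(𝔽₇)`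
    (¬ IsPrimitiveGroup groupP ∧ Nonempty (groupP ≃* PSL(2, ZMod 7))) ∧
    -- up to conjugation, it is the only non-primitive projective image of one of the four groups
    -- that fixes a smooth quartic surface
    (∀ G : Subgroup PGL(4, ℂ), ¬ IsPrimitiveGroup G →
      (Nonempty (G ≃* alternatingGroup (Fin 5)) ∨ Nonempty (G ≃* Equiv.Perm (Fin 5)) ∨
        Nonempty (G ≃* alternatingGroup (Fin 6)) ∨ Nonempty (G ≃* PSL(2, ZMod 7))) →
      (FixesSmoothQuartic G ↔ AreConjugate G groupP)) ∧
    -- none of the other five groups of the explicit list fixes a smooth quartic surface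
    (¬ FixesSmoothQuartic groupQ1 ∧ ¬ FixesSmoothQuartic groupQ4 ∧ ¬ FixesSmoothQuartic groupQ5 ∧
      ¬ FixesSmoothQuartic groupR3 ∧ ¬ FixesSmoothQuartic groupQ7) ∧
    -- the smooth quartic surfaces fixed by `(P)` are the smooth members of the pencil
    (∀ S : Set P3, (IsSmoothQuarticSurface S ∧ IsInvariantUnder groupP S) ↔
      ∃ l : Fin 2 → ℂ, IsNonsingular (pencil l) ∧ S = surfaceOf (pencil l)) ∧
    -- whose singular members are exactly those over `[1 : 0]` and `[0 : 1]`
    (∀ (l : Fin 2 → ℂ) (hl : l ≠ 0), ¬ IsNonsingular (pencil l) ↔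
      Projectivization.mk ℂ l hl = Projectivization.mk ℂ ![1, 0] (by simp) ∨
      Projectivization.mk ℂ l hl = Projectivization.mk ℂ ![0, 1] (by simp)) := by
  refine ⟨⟨not_isPrimitiveGroup_groupP, nonempty_groupP_mulEquiv⟩, fun G hG hiso =>
    ⟨fun hfix => ?_, fixesSmoothQuartic_of_areConjugate⟩, ⟨not_fixesSmoothQuartic_groupQ1, ?_, ?_,
      ?_, ?_⟩, fun S => ⟨?_, ?_⟩, not_isNonsingular_pencil_iff⟩
  · have hicos {H : Type} [Group H] {c k l : H} (h : IsIcosahedralTriple c k l) (φ : H →* G)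
        (hφ : Function.Injective φ) : False :=
      not_fixesSmoothQuartic_of_icosahedral hG (h.map φ hφ) hfix
    obtain ⟨c, k, l, h5⟩ := exists_isIcosahedralTriple_alternatingGroup_five
    rcases hiso with ⟨⟨φ⟩⟩ | ⟨⟨φ⟩⟩ | ⟨⟨φ⟩⟩ | ⟨⟨φ⟩⟩
    · exact (hicos h5 φ.symm.toMonoidHom φ.symm.injective).elim
    -- For the symmetric group the triple is taken in its alternating subgroup.
    · exact (hicos h5 (φ.symm.toMonoidHom.comp (alternatingGroup (Fin 5)).subtype)
        (φ.symm.injective.comp (Subgroup.subtype_injective _))).elim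
    · obtain ⟨c, k, l, h6⟩ := exists_isIcosahedralTriple_alternatingGroup_six
      exact (hicos h6 φ.symm.toMonoidHom φ.symm.injective).elim
    · exact areConjugate_of_mulEquiv_psl hG hfix φ.symm
  · exact not_fixesSmoothQuartic_of_matQ41 (by simp) (by simp) det_matQ43 matQ43_mul_matQ41
  · exact not_fixesSmoothQuartic_of_matQ41 (by simp) (by simp) det_matQ53 matQ53_mul_matQ41
  · exact not_fixesSmoothQuartic_of_matQ41 (by simp) (by simp) det_matQ53 matQ53_mul_matQ41
  · exact not_fixesSmoothQuartic_of_matQ41 (by simp) (by simp) det_matQ53 matQ53_mul_matQ41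
  · rintro ⟨⟨f, hf, hs, rfl⟩, hinv⟩
    obtain ⟨l, rfl⟩ := exists_eq_pencil_of_isInvariantUnder hf hs hinv
    exact ⟨l, hs, rfl⟩
  · rintro ⟨l, hs, rfl⟩
    exact ⟨⟨pencil l, pencil_isHomogeneous l, hs, rfl⟩, isInvariantUnder_pencil l⟩
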